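/- Let $\mathcal{E}$ be an exact category (in the sense of Quillen; in particular additive) and $N\ge 2$ an integer. All subcategories are full and additive. **Notation.** For an additive category $\mathcal{A}$, let $\mathcal{C}_N(\mathcal{A})$ be the category of $N$-complexes over $\mathcal{A}$, i.e. of sequences $\cdots\to X^n\to X^{n+1}\to\cdots$ ($n\in\mathbb{Z}$) in $\mathcal{A}$ all of whose $N$-fold compositions vanish, with the exact structure given by the sequences that are split short exact in each degree. A Frobenius category is an exact category with enough projectives and enough injectives in which projectives and injectives coincide. Its stable category (morphisms modulo those factoring through projectives) carries the usual suspension $\Sigma X=\operatorname{coker}(X\rightarrowtail I(X))$, $I(X)$ injective, and as distinguished triangles those isomorphic to standard triangles $X\xrightarrow{f}Y\to C(f)\to\Sigma X$, where $C(f)$ is the pushout of $X\rightarrowtail I(X)$ along $f$. A sub-Frobenius category of a Frobenius category $\mathcal{F}$ is an exact subcategory (an exact category with exact inclusion) which has, for each of its objects $X$, an admissible epic $P\twoheadrightarrow X$ and an admissible monic $X\rightarrowtail I$ in the subcategory with $P$ projective and $I$ injective in $\mathcal{F}$. A pair $X'\to X\to X''$ in $\mathcal{E}$ is acyclic if its morphisms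 factor as $X'\twoheadrightarrow Z\rightarrowtail X$ and $X\twoheadrightarrow W\rightarrowtail X''$ (admissible epics followed by admissible monics) with $Z\rightarrowtail X\twoheadrightarrow W$ short exact. An $N$-complex $X$ over $\mathcal{E}$ is acyclic at position $n$ if $X^{n-N+r}\to X^n\to X^{n+r}$ (compositions of consecutive differentials) is acyclic for all $r\in\{1,\dots,N-1\}$. It is totally acyclic at $n$ if, in addition, for each projective $P$ of $\mathcal{E}$ the $N$-complex of abelian groups $\operatorname{Hom}(X,P)$, with $\operatorname{Hom}(X,P)^k=\operatorname{Hom}_{\mathcal{E}}(X^{-k},P)$, is acyclic at $-n$. For $\#\in\{\infty,+,-,b\}$ and $\natural\in\{\infty,+,-,b,\varnothing,\varnothing^\ast\}$, let $\mathcal{C}^{\#,\natural}_N(\mathcal{E})\subseteq\mathcal{C}_N(\mathcal{E})$ consist of the $X$ such that * $\#$: no condition for $\infty$; $X^k=0$ for all sufficiently small $k$ ($+$), all sufficiently large $k$ ($-$), almost all $k$ ($b$); * $\natural$: no condition for $\infty$; $X$ is acyclic at all sufficiently small ($+$), all sufficiently large ($-$), almost all ($b$), all ($\varnothing$) positions;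 $X$ is totally acyclic at all positions ($\varnothing^\ast$). Write $\mathcal{K}^{\#,\natural}_N(\mathcal{E})$ for the stable category of $\mathcal{C}^{\#,\natural}_N(\mathcal{E})$, $\mathcal{K}^{\#}_N:=\mathcal{K}^{\#,\infty}_N$ and $\mathcal{K}_N:=\mathcal{K}^{\infty,\infty}_N$, the stable category of the Frobenius category $\mathcal{C}_N(\mathcal{E})$. **Theorem.** For all $\#$ and $\natural$ as above: (a) $\mathcal{C}^{\#,\natural}_N(\mathcal{E})$ is extension-closed and hence fully exact in $\mathcal{C}_N(\mathcal{E})$: it is an exact category whose short exact sequences are those of $\mathcal{C}_N(\mathcal{E})$ with objects in $\mathcal{C}^{\#,\natural}_N(\mathcal{E})$. (b) $\mathcal{C}^{\#,\natural}_N(\mathcal{E})$ is a sub-Frobenius category of the Frobenius category $\mathcal{C}_N(\mathcal{E})$. (c) The stable categories $\mathcal{K}^{\#,\natural}_N(\mathcal{E})$ are triangulated, and inclusions of subcategories induce commutative diagrams of canonical fully faithful triangulated functors between them and into $\mathcal{K}_N(\mathcal{E})$. In particular there are such diagrams with the following arrows (with arguments $\mathcal{E}$ omitted): $$\mathcal{K}^{b,\varnothing}_N\to\mathcal{K}^{\pm,\varnothing}_N,\quad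 \mathcal{K}^{b,\varnothing}_N\to\mathcal{K}^{b}_N,\quad \mathcal{K}^{\pm,\varnothing}_N\to\mathcal{K}^{\infty,\varnothing}_N,\quad \mathcal{K}^{\pm,\varnothing}_N\to\mathcal{K}^{\pm,b}_N,\quad \mathcal{K}^{b}_N\to\mathcal{K}^{\pm,b}_N,\quad \mathcal{K}^{\infty,\varnothing}_N\to\mathcal{K}^{\infty,b}_N,$$ $$\mathcal{K}^{\pm,b}_N\to\mathcal{K}^{\pm}_N,\quad \mathcal{K}^{\pm,b}_N\to\mathcal{K}^{\infty,b}_N,\quad \mathcal{K}^{\pm}_N\to\mathcal{K}^{\infty,\pm}_N,\quad \mathcal{K}^{\infty,b}_N\to\mathcal{K}^{\infty,\pm}_N,\quad \mathcal{K}^{\infty,\pm}_N\to\mathcal{K}_N,$$ and $$\mathcal{K}^{b,\varnothing^\ast}_N\to\mathcal{K}^{\pm,\varnothing^\ast}_N\to\mathcal{K}^{\infty,\varnothing^\ast}_N,\quad \mathcal{K}^{b,\varnothing}_N\to\mathcal{K}^{\pm,\varnothing}_N\to\mathcal{K}^{\infty,\varnothing}_N,\quad \mathcal{K}^{\#,\varnothing^\ast}_N\to\mathcal{K}^{\#,\varnothing}_N\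 \ (\#\in\{\infty,+,-,b\}).$$ More generally, for every subcategory $\mathcal{A}$ of $\mathcal{E}$, the statements (a), (b), (c) hold for the subcategories $\mathcal{C}^{\#,\natural_{\mathcal{E}}}_N(\mathcal{A}):=\mathcal{C}_N(\mathcal{A})\cap\mathcal{C}^{\#,\natural}_N(\mathcal{E})$ of $\mathcal{C}_N(\mathcal{A})$ and their stable categories, where (total) acyclicity is taken in $\mathcal{E}$. -/

import Mathlib

open CategoryTheory CategoryTheory.Limits

universe v v' u u'

namespace NCplx

/-! ## Exact categories -/

section Exact

variable {C : Type u} [Category.{v} C] [Preadditive C]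

/-- `i` is an admissible monic for the class `S` of short exact sequences. -/
def AdmissibleMono (S : ObjectProperty (ShortComplex C)) {X Y : C} (i : X ⟶ Y) : Prop :=
  ∃ (Z : C) (p : Y ⟶ Z) (w : i ≫ p = 0), S (ShortComplex.mk i p w)

/-- `p` is an admissible epic for the class `S` of short exact sequences. -/
def AdmissibleEpi (S : ObjectProperty (ShortComplex C)) {Y Z : C} (p : Y ⟶ Z) : Prop :=
  ∃ (X : C) (i : X ⟶ Y) (w : i ≫ p = 0), S (ShortComplex.mk i p w)

/-- `(C, S)` is a (Quillen) exact category: `C` is additive and `S` is an exact structure. -/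
structure IsExactCategory (S : ObjectProperty (ShortComplex C)) : Prop where
  hasZeroObject : HasZeroObject C
  hasBinaryBiproducts : HasBinaryBiproducts C
  closedUnderIso : S.IsClosedUnderIsomorphisms
  kernel : ∀ T : ShortComplex C, S T → Nonempty (IsLimit (KernelFork.ofι T.f T.zero))
  cokernel : ∀ T : ShortComplex C, S T → Nonempty (IsColimit (CokernelCofork.ofπ T.g T.zero))
  id_mono : ∀ X : C, AdmissibleMono S (𝟙 X)
  id_epi : ∀ X : C, AdmissibleEpi S (𝟙 X)
  comp_mono : ∀ ⦃X Y Z : C⦄ (i : X ⟶ Y) (j : Y ⟶ Z),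
    AdmissibleMono S i → AdmissibleMono S j → AdmissibleMono S (i ≫ j)
  comp_epi : ∀ ⦃X Y Z : C⦄ (p : X ⟶ Y) (q : Y ⟶ Z),
    AdmissibleEpi S p → AdmissibleEpi S q → AdmissibleEpi S (p ≫ q)
  hasPushout : ∀ ⦃X Y Z : C⦄ (i : X ⟶ Y) (f : X ⟶ Z), AdmissibleMono S i → HasPushout i f
  pushout : ∀ ⦃X Y Z W : C⦄ (i : X ⟶ Y) (f : X ⟶ Z) (f' : Y ⟶ W) (i' : Z ⟶ W),
    AdmissibleMono S i → IsPushout i f f' i' → AdmissibleMono S i'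
  hasPullback : ∀ ⦃X Y Z : C⦄ (p : X ⟶ Z) (f : Y ⟶ Z), AdmissibleEpi S p → HasPullback p f
  pullback : ∀ ⦃W X Y Z : C⦄ (f' : W ⟶ X) (p' : W ⟶ Y) (p : X ⟶ Z) (f : Y ⟶ Z),
    AdmissibleEpi S p → IsPullback f' p' p f → AdmissibleEpi S p'

/-- The maximal exact structure on the category of abelian groups. -/
def abExact : ObjectProperty (ShortComplex AddCommGrpCat.{v}) := fun T => T.ShortExact

/-- Projective objects of an exact category. -/
def IsProjective (S : ObjectProperty (ShortComplex C)) (P : C) : Prop :=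
  ∀ ⦃X Y : C⦄ (p : X ⟶ Y), AdmissibleEpi S p → ∀ f : P ⟶ Y, ∃ g : P ⟶ X, g ≫ p = f

/-- Injective objects of an exact category. -/
def IsInjective (S : ObjectProperty (ShortComplex C)) (I : C) : Prop :=
  ∀ ⦃X Y : C⦄ (i : X ⟶ Y), AdmissibleMono S i → ∀ f : X ⟶ I, ∃ g : Y ⟶ I, i ≫ g = f

/-- Frobenius exact categories. -/
structure IsFrobenius (S : ObjectProperty (ShortComplex C)) : Prop where
  exact : IsExactCategory S
  enoughInjectives : ∀ X : C, ∃ (I : C) (i : X ⟶ I), IsInjective S I ∧ AdmissibleMono S i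
  enoughProjectives : ∀ X : C, ∃ (P : C) (p : P ⟶ X), IsProjective S P ∧ AdmissibleEpi S p
  projective_iff_injective : ∀ X : C, IsProjective S X ↔ IsInjective S X

/-- The short exact sequences of `(C, S)` all of whose objects lie in the full subcategory `P`.
With this class the inclusion of `P` preserves and reflects short exact sequences. -/
def induced (S : ObjectProperty (ShortComplex C)) (P : ObjectProperty C) :
    ObjectProperty (ShortComplex P.FullSubcategory) :=
  fun T => S (ShortComplex.mk T.f.hom T.g.hom (congrArg (fun k => k.hom) T.zero))

/-- The full subcategory `P` is extension-closed in `(C, S)`. -/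
def IsExtensionClosed (S : ObjectProperty (ShortComplex C)) (P : ObjectProperty C) : Prop :=
  ∀ T : ShortComplex C, S T → P T.X₁ → P T.X₃ → P T.X₂

/-- The full subcategory `P` is a fully exact subcategory of `(C, S)`: with the class of those
short exact sequences of `(C, S)` whose objects lie in `P`, it is itself an exact category. -/
def IsFullyExact (S : ObjectProperty (ShortComplex C)) (P : ObjectProperty C) : Prop :=
  IsExactCategory (induced S P)

/-- The full subcategory `P`, with the induced short exact sequences, is a sub-Frobenius category
of the Frobenius category `(C, S)`: an exact subcategory with enough `C`-projectives and
enough `C`-injectives. -/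
structure IsSubFrobenius (S : ObjectProperty (ShortComplex C)) (P : ObjectProperty C) : Prop where
  frobenius : IsFrobenius S
  exact : IsExactCategory (induced S P)
  enoughProjectives : ∀ X : P.FullSubcategory, ∃ (Q : P.FullSubcategory) (p : Q ⟶ X),
    IsProjective S Q.obj ∧ AdmissibleEpi (induced S P) p
  enoughInjectives : ∀ X : P.FullSubcategory, ∃ (I : P.FullSubcategory) (i : X ⟶ I),
    IsInjective S I.obj ∧ AdmissibleMono (induced S P) i

/-- A sequence `X' ⟶ X ⟶ X''` is acyclic: both morphisms are admissible, with factorizations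
`X' ↠ Z ↣ X` and `X ↠ W ↣ X''` such that `Z ↣ X ↠ W` is short exact. -/
def IsAcyclicPair (S : ObjectProperty (ShortComplex C)) {X' X X'' : C}
    (f : X' ⟶ X) (g : X ⟶ X'') : Prop :=
  ∃ (Z W : C) (e : X' ⟶ Z) (m : Z ⟶ X) (e' : X ⟶ W) (m' : W ⟶ X'') (w : m ≫ e' = 0),
    f = e ≫ m ∧ g = e' ≫ m' ∧ AdmissibleEpi S e ∧ AdmissibleMono S m' ∧
      S (ShortComplex.mk m e' w)

end Exact

/-! ## Stable categories -/

section Stable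

variable {C : Type u} [Category.{v} C] [Preadditive C]

/-- The morphisms that factor through a projective, as a subgroup of `X ⟶ Y`. (When `C` is an
exact category, they are closed under addition, see `mem_projIdeal_iff`.) -/
def projIdeal (S : ObjectProperty (ShortComplex C)) (X Y : C) : AddSubgroup (X ⟶ Y) :=
  AddSubgroup.closure {f | ∃ (P : C) (a : X ⟶ P) (b : P ⟶ Y), IsProjective S P ∧ f = a ≫ b}

theorem mem_projIdeal_iff {S : ObjectProperty (ShortComplex C)} (hS : IsExactCategory S)
    {X Y : C} (f : X ⟶ Y) : f ∈ projIdeal S X Y ↔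
      ∃ (P : C) (a : X ⟶ P) (b : P ⟶ Y), IsProjective S P ∧ f = a ≫ b := by
  refine ⟨fun hf => ?_, fun hf => AddSubgroup.subset_closure hf⟩
  have := hS.hasBinaryBiproducts
  refine AddSubgroup.closure_induction (fun x hx => hx) ?_ ?_ ?_ hf
  · obtain ⟨O, hO⟩ := hS.hasZeroObject.zero
    exact ⟨O, 0, 0, fun A B p _ g => ⟨0, hO.eq_of_src _ _⟩, by simp⟩
  · rintro x y _ _ ⟨P, a, b, hP, rfl⟩ ⟨Q, c, d, hQ, rfl⟩
    refine ⟨P ⊞ Q, biprod.lift a c, biprod.desc b d, fun A B p hp g => ?_, by simp⟩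
    obtain ⟨g₁, h₁⟩ := hP p hp (biprod.inl ≫ g)
    obtain ⟨g₂, h₂⟩ := hQ p hp (biprod.inr ≫ g)
    exact ⟨biprod.desc g₁ g₂, by ext <;> simp [h₁, h₂]⟩
  · rintro x _ ⟨P, a, b, hP, rfl⟩
    exact ⟨P, -a, b, hP, by simp⟩

theorem comp_mem_projIdeal {S : ObjectProperty (ShortComplex C)} {X Y Z : C} (f : X ⟶ Y)
    {g : Y ⟶ Z} (hg : g ∈ projIdeal S Y Z) : f ≫ g ∈ projIdeal S X Z := by
  refine AddSubgroup.closure_induction (p := fun g _ => f ≫ g ∈ projIdeal S X Z)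
    ?_ ?_ ?_ ?_ hg
  · rintro _ ⟨P, a, b, hP, rfl⟩
    exact AddSubgroup.subset_closure ⟨P, f ≫ a, b, hP, by simp⟩
  · simp
  · intro x y _ _ hx hy
    simpa using (projIdeal S X Z).add_mem hx hy
  · intro x _ hx
    simpa using (projIdeal S X Z).neg_mem hx

theorem mem_projIdeal_comp {S : ObjectProperty (ShortComplex C)} {X Y Z : C} {f : X ⟶ Y}
    (hf : f ∈ projIdeal S X Y) (g : Y ⟶ Z) : f ≫ g ∈ projIdeal S X Z := by
  refine AddSubgroup.closure_induction (p := fun f _ => f ≫ g ∈ projIdeal S X Z)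
    ?_ ?_ ?_ ?_ hf
  · rintro _ ⟨P, a, b, hP, rfl⟩
    exact AddSubgroup.subset_closure ⟨P, a, b ≫ g, hP, by simp⟩
  · simp
  · intro x y _ _ hx hy
    simpa using (projIdeal S X Z).add_mem hx hy
  · intro x _ hx
    simpa using (projIdeal S X Z).neg_mem hx

/-- Two morphisms are identified if their difference factors through a projective. -/
def stableRel (S : ObjectProperty (ShortComplex C)) : HomRel C :=
  fun X Y f g => f - g ∈ projIdeal S X Y

instance (S : ObjectProperty (ShortComplex C)) : Congruence (stableRel S) where
  comp_left {X Y Z} f g g' h := by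
    have := comp_mem_projIdeal f h
    rwa [Preadditive.comp_sub] at this
  comp_right {X Y Z} f f' g h := by
    have := mem_projIdeal_comp h g
    rwa [Preadditive.sub_comp] at this
  equivalence := fun {X Y} =>
    { refl := fun f => by
        simp [stableRel]
      symm := fun {f g} h => by
        simpa [stableRel] using (projIdeal S X Y).neg_mem h
      trans := fun {f g k} h h' => by
        simpa [stableRel] using (projIdeal S X Y).add_mem h h' }

theorem stableRel_add (S : ObjectProperty (ShortComplex C)) ⦃X Y : C⦄ (f₁ f₂ g₁ g₂ : X ⟶ Y)
    (hf : stableRel S f₁ f₂) (hg : stableRel S g₁ g₂) :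
    stableRel S (f₁ + g₁) (f₂ + g₂) := by
  have := (projIdeal S X Y).add_mem hf hg
  rwa [sub_add_sub_comm] at this

/-- The (projectively) stable category of `(C, S)`. -/
abbrev StableCategory (S : ObjectProperty (ShortComplex C)) := CategoryTheory.Quotient (stableRel S)

instance (S : ObjectProperty (ShortComplex C)) : Preadditive (StableCategory S) :=
  CategoryTheory.Quotient.preadditive (stableRel S) (stableRel_add S)

/-- The projection onto the stable category. -/
abbrev toStable (S : ObjectProperty (ShortComplex C)) : C ⥤ StableCategory S :=
  CategoryTheory.Quotient.functor (stableRel S)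

variable {D : Type u'} [Category.{v'} D] [Preadditive D]

/-- The canonical functor of stable categories induced by an additive functor `F` that
preserves projectives. -/
noncomputable def stableMap (S : ObjectProperty (ShortComplex C)) (S' : ObjectProperty (ShortComplex D))
    (F : C ⥤ D) [F.Additive] (hF : ∀ P : C, IsProjective S P → IsProjective S' (F.obj P)) :
    StableCategory S ⥤ StableCategory S' :=
  CategoryTheory.Quotient.lift (stableRel S) (F ⋙ toStable S') (fun X Y f g hfg => by
    refine CategoryTheory.Quotient.sound _ ?_
    change F.map f - F.map g ∈ projIdeal S' (F.obj X) (F.obj Y)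
    rw [← F.map_sub]
    refine AddSubgroup.closure_induction
      (p := fun k _ => F.map k ∈ projIdeal S' (F.obj X) (F.obj Y)) ?_ ?_ ?_ ?_ hfg
    · rintro _ ⟨P, a, b, hP, rfl⟩
      exact AddSubgroup.subset_closure ⟨F.obj P, F.map a, F.map b, hF P hP, by simp⟩
    · simp
    · intro x y _ _ hx hy
      simpa using (projIdeal S' (F.obj X) (F.obj Y)).add_mem hx hy
    · intro x _ hx
      simpa using (projIdeal S' (F.obj X) (F.obj Y)).neg_mem hx)

end Stable

/-! ## Triangulated categories whose suspension is an autoequivalence -/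

section Triangulated

/-- A candidate triangle `X₁ ⟶ X₂ ⟶ X₃ ⟶ Σ X₁`. -/
structure Tri {T : Type u} [Category.{v} T] (susp : T ⥤ T) where
  X₁ : T
  X₂ : T
  X₃ : T
  f : X₁ ⟶ X₂
  g : X₂ ⟶ X₃
  h : X₃ ⟶ susp.obj X₁

/-- Isomorphy of candidate triangles. -/
def Tri.Isomorphic {T : Type u} [Category.{v} T] {susp : T ⥤ T} (A B : Tri susp) : Prop :=
  ∃ (a : A.X₁ ≅ B.X₁) (b : A.X₂ ≅ B.X₂) (c : A.X₃ ≅ B.X₃),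
    A.f ≫ b.hom = a.hom ≫ B.f ∧ A.g ≫ c.hom = b.hom ≫ B.g ∧
      A.h ≫ susp.map a.hom = c.hom ≫ B.h

/-- `T` is a triangulated category with suspension functor `susp` (an autoequivalence) and
class `dist` of distinguished triangles. -/
structure IsTriangulatedCategory {T : Type u} [Category.{v} T] [Preadditive T]
    (susp : T ⥤ T) (dist : Set (Tri susp)) : Prop where
  hasZeroObject : HasZeroObject T
  hasBinaryBiproducts : HasBinaryBiproducts T
  additive : susp.Additive
  isEquivalence : susp.IsEquivalence
  isomorphic : ∀ A B : Tri susp, A ∈ dist → A.Isomorphic B → B ∈ dist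
  contractible : ∀ X Z : T, IsZero Z → (⟨X, X, Z, 𝟙 X, 0, 0⟩ : Tri susp) ∈ dist
  exists_triangle : ∀ ⦃X Y : T⦄ (f : X ⟶ Y), ∃ (Z : T) (g : Y ⟶ Z) (h : Z ⟶ susp.obj X),
    (⟨X, Y, Z, f, g, h⟩ : Tri susp) ∈ dist
  rotate_iff : ∀ A : Tri susp, A ∈ dist ↔
    (⟨A.X₂, A.X₃, susp.obj A.X₁, A.g, A.h, -susp.map A.f⟩ : Tri susp) ∈ dist
  complete : ∀ A B : Tri susp, A ∈ dist → B ∈ dist →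
    ∀ (a : A.X₁ ⟶ B.X₁) (b : A.X₂ ⟶ B.X₂), A.f ≫ b = a ≫ B.f →
      ∃ c : A.X₃ ⟶ B.X₃, A.g ≫ c = b ≫ B.g ∧ A.h ≫ susp.map a = c ≫ B.h
  octahedral : ∀ ⦃X₁ X₂ X₃ Z₁₂ Z₂₃ Z₁₃ : T⦄ (u₁₂ : X₁ ⟶ X₂) (u₂₃ : X₂ ⟶ X₃)
    (v₁₂ : X₂ ⟶ Z₁₂) (w₁₂ : Z₁₂ ⟶ susp.obj X₁) (v₂₃ : X₃ ⟶ Z₂₃) (w₂₃ : Z₂₃ ⟶ susp.obj X₂)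
    (v₁₃ : X₃ ⟶ Z₁₃) (w₁₃ : Z₁₃ ⟶ susp.obj X₁),
    (⟨X₁, X₂, Z₁₂, u₁₂, v₁₂, w₁₂⟩ : Tri susp) ∈ dist →
    (⟨X₂, X₃, Z₂₃, u₂₃, v₂₃, w₂₃⟩ : Tri susp) ∈ dist →
    (⟨X₁, X₃, Z₁₃, u₁₂ ≫ u₂₃, v₁₃, w₁₃⟩ : Tri susp) ∈ dist →
    ∃ (m₁ : Z₁₂ ⟶ Z₁₃) (m₃ : Z₁₃ ⟶ Z₂₃),
      v₁₂ ≫ m₁ = u₂₃ ≫ v₁₃ ∧ m₁ ≫ w₁₃ = w₁₂ ∧ v₁₃ ≫ m₃ = v₂₃ ∧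
        w₁₃ ≫ susp.map u₁₂ = m₃ ≫ w₂₃ ∧
        (⟨Z₁₂, Z₁₃, Z₂₃, m₁, m₃, w₂₃ ≫ susp.map v₁₂⟩ : Tri susp) ∈ dist

/-- `F` is a triangulated functor: it is additive and there is a natural isomorphism
`F Σ ≅ Σ' F` through which `F` sends distinguished triangles to distinguished triangles. -/
def IsTriangulatedFunctor {T : Type u} [Category.{v} T] [Preadditive T]
    {T' : Type u'} [Category.{v'} T'] [Preadditive T']
    {susp : T ⥤ T} (dist : Set (Tri susp)) {susp' : T' ⥤ T'} (dist' : Set (Tri susp'))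
    (F : T ⥤ T') : Prop :=
  F.Additive ∧ ∃ φ : susp ⋙ F ≅ F ⋙ susp', ∀ A ∈ dist,
    (⟨F.obj A.X₁, F.obj A.X₂, F.obj A.X₃, F.map A.f, F.map A.g,
      F.map A.h ≫ φ.hom.app A.X₁⟩ : Tri susp') ∈ dist'

end Triangulated

/-! ## The triangulation of the stable category of a Frobenius category -/

namespace IsFrobenius

variable {C : Type u} [Category.{v} C] [Preadditive C] {S : ObjectProperty (ShortComplex C)}
  (h : IsFrobenius S)

/-- The chosen injective object `I(X)`. -/
noncomputable def I (X : C) : C := (h.enoughInjectives X).choose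

/-- The chosen admissible monic `X ↣ I(X)`. -/
noncomputable def i (X : C) : X ⟶ h.I X := (h.enoughInjectives X).choose_spec.choose

theorem injective_I (X : C) : IsInjective S (h.I X) :=
  (h.enoughInjectives X).choose_spec.choose_spec.1

theorem admissibleMono_i (X : C) : AdmissibleMono S (h.i X) :=
  (h.enoughInjectives X).choose_spec.choose_spec.2

/-- The chosen cokernel `Σ X` of `X ↣ I(X)`. -/
noncomputable def suspObj (X : C) : C := (h.admissibleMono_i X).choose

/-- The chosen admissible epic `I(X) ↠ Σ X`. -/
noncomputable def q (X : C) : h.I X ⟶ h.suspObj X := (h.admissibleMono_i X).choose_spec.choose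

theorem i_q (X : C) : h.i X ≫ h.q X = 0 := (h.admissibleMono_i X).choose_spec.choose_spec.choose

theorem conflation (X : C) : S (ShortComplex.mk (h.i X) (h.q X) (h.i_q X)) :=
  (h.admissibleMono_i X).choose_spec.choose_spec.choose_spec

theorem exists_desc {X Y : C} (k : h.I X ⟶ Y) (hk : h.i X ≫ k = 0) :
    ∃ t : h.suspObj X ⟶ Y, h.q X ≫ t = k := by
  obtain ⟨hc⟩ := h.exact.cokernel _ (h.conflation X)
  exact ⟨hc.desc (CokernelCofork.ofπ k hk), hc.fac _ WalkingParallelPair.one⟩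

theorem q_cancel {X Y : C} {s t : h.suspObj X ⟶ Y} (hst : h.q X ≫ s = h.q X ≫ t) : s = t := by
  obtain ⟨hc⟩ := h.exact.cokernel _ (h.conflation X)
  exact Cofork.IsColimit.hom_ext hc hst

/-- `s : Σ X ⟶ Σ Y` is induced by `f` via some extension `I(X) ⟶ I(Y)` of `f`. -/
def Induces {X Y : C} (f : X ⟶ Y) (s : h.suspObj X ⟶ h.suspObj Y) : Prop :=
  ∃ k : h.I X ⟶ h.I Y, h.i X ≫ k = f ≫ h.i Y ∧ h.q X ≫ s = k ≫ h.q Y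

theorem exists_induces {X Y : C} (f : X ⟶ Y) : ∃ s, h.Induces f s := by
  obtain ⟨k, hk⟩ := h.injective_I Y (h.i X) (h.admissibleMono_i X) (f ≫ h.i Y)
  obtain ⟨s, hs⟩ := h.exists_desc (k ≫ h.q Y) (by
    rw [← Category.assoc, hk, Category.assoc, h.i_q, comp_zero])
  exact ⟨s, k, hk, hs⟩

variable {h}

theorem Induces.comp {X Y Z : C} {f : X ⟶ Y} {g : Y ⟶ Z} {s t} (hf : h.Induces f s)
    (hg : h.Induces g t) : h.Induces (f ≫ g) (s ≫ t) := by
  obtain ⟨k, hk, hk'⟩ := hf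
  obtain ⟨l, hl, hl'⟩ := hg
  refine ⟨k ≫ l, ?_, ?_⟩
  · rw [← Category.assoc, hk, Category.assoc, hl, Category.assoc]
  · rw [← Category.assoc, hk', Category.assoc, hl', Category.assoc]

theorem Induces.sub {X Y : C} {f g : X ⟶ Y} {s t} (hf : h.Induces f s)
    (hg : h.Induces g t) : h.Induces (f - g) (s - t) := by
  obtain ⟨k, hk, hk'⟩ := hf
  obtain ⟨l, hl, hl'⟩ := hg
  exact ⟨k - l, by simp [hk, hl], by simp [hk', hl']⟩

theorem Induces.add {X Y : C} {f g : X ⟶ Y} {s t} (hf : h.Induces f s)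
    (hg : h.Induces g t) : h.Induces (f + g) (s + t) := by
  obtain ⟨k, hk, hk'⟩ := hf
  obtain ⟨l, hl, hl'⟩ := hg
  exact ⟨k + l, by simp [hk, hl], by simp [hk', hl']⟩

theorem Induces.neg {X Y : C} {f : X ⟶ Y} {s} (hf : h.Induces f s) :
    h.Induces (-f) (-s) := by
  obtain ⟨k, hk, hk'⟩ := hf
  exact ⟨-k, by simp [hk], by simp [hk']⟩

theorem Induces.id (X : C) : h.Induces (𝟙 X) (𝟙 _) := ⟨𝟙 _, by simp, by simp⟩

theorem Induces.mem_of_zero {X Y : C} {s} (hs : h.Induces (0 : X ⟶ Y) s) :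
    s ∈ projIdeal S (h.suspObj X) (h.suspObj Y) := by
  obtain ⟨k, hk, hk'⟩ := hs
  obtain ⟨t, ht⟩ := h.exists_desc k (by simpa using hk)
  refine AddSubgroup.subset_closure
    ⟨h.I Y, t, h.q Y, (h.projective_iff_injective _).2 (h.injective_I Y), h.q_cancel ?_⟩
  rw [hk', ← Category.assoc, ht]

theorem exists_induces_mem {X Y : C} {f : X ⟶ Y} (hf : f ∈ projIdeal S X Y) :
    ∃ s, h.Induces f s ∧ s ∈ projIdeal S (h.suspObj X) (h.suspObj Y) := by
  refine AddSubgroup.closure_induction (p := fun f _ => ∃ s, h.Induces f s ∧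
    s ∈ projIdeal S (h.suspObj X) (h.suspObj Y)) ?_ ?_ ?_ ?_ hf
  · rintro _ ⟨P, a, b, hP, rfl⟩
    obtain ⟨a', ha'⟩ := (h.projective_iff_injective P).1 hP (h.i X) (h.admissibleMono_i X) a
    refine ⟨0, ⟨a' ≫ b ≫ h.i Y, ?_, ?_⟩, AddSubgroup.zero_mem _⟩
    · rw [← Category.assoc, ha', Category.assoc]
    · simp [h.i_q]
  · exact ⟨0, ⟨0, by simp, by simp⟩, AddSubgroup.zero_mem _⟩
  · rintro x y _ _ ⟨s, hs, hs'⟩ ⟨t, ht, ht'⟩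
    exact ⟨s + t, hs.add ht, AddSubgroup.add_mem _ hs' ht'⟩
  · rintro x _ ⟨s, hs, hs'⟩
    exact ⟨-s, hs.neg, AddSubgroup.neg_mem _ hs'⟩

theorem Induces.stable_eq {X Y : C} {f g : X ⟶ Y} {s t} (hf : h.Induces f s)
    (hg : h.Induces g t) (hfg : stableRel S f g) :
    (toStable S).map s = (toStable S).map t := by
  refine CategoryTheory.Quotient.sound _ ?_
  obtain ⟨r, hr, hr'⟩ := exists_induces_mem (h := h) hfg
  have h₀ : h.Induces (0 : X ⟶ Y) ((s - t) - r) := by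
    have := (hf.sub hg).sub hr
    rwa [sub_self] at this
  have := AddSubgroup.add_mem _ h₀.mem_of_zero hr'
  rwa [sub_add_cancel] at this

variable (h)

/-- The suspension functor of the stable category: `Σ X` is the cokernel of `X ↣ I(X)`, and a
morphism `f : X ⟶ Y` is sent to the class of any morphism `Σ X ⟶ Σ Y` induced by `f`. -/
noncomputable def susp : StableCategory S ⥤ StableCategory S :=
  CategoryTheory.Quotient.lift (stableRel S)
    { obj := fun X => (toStable S).obj (h.suspObj X)
      map := fun f => (toStable S).map (h.exists_induces f).choose
      map_id := fun X => by
        rw [← CategoryTheory.Functor.map_id]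
        exact (h.exists_induces (𝟙 X)).choose_spec.stable_eq (Induces.id X)
          ((inferInstance : Congruence (stableRel S)).equivalence.refl _)
      map_comp := fun f g => by
        rw [← CategoryTheory.Functor.map_comp]
        exact (h.exists_induces (f ≫ g)).choose_spec.stable_eq
          ((h.exists_induces f).choose_spec.comp (h.exists_induces g).choose_spec)
          ((inferInstance : Congruence (stableRel S)).equivalence.refl _) }
    (fun _ _ f g hfg =>
      (h.exists_induces f).choose_spec.stable_eq (h.exists_induces g).choose_spec hfg)

/-- The standard triangle `X ⟶ Y ⟶ C(f) ⟶ Σ X` attached to `f : X ⟶ Y`, a pushout `Z = C(f)` of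
`X ↣ I(X)` along `f`, and the induced morphism `r : C(f) ⟶ Σ X`. -/
noncomputable def stdTri {X Y Z : C} (f : X ⟶ Y) (g : Y ⟶ Z) (r : Z ⟶ h.suspObj X) :
    Tri h.susp where
  X₁ := (toStable S).obj X
  X₂ := (toStable S).obj Y
  X₃ := (toStable S).obj Z
  f := (toStable S).map f
  g := (toStable S).map g
  h := (toStable S).map r

/-- The distinguished triangles: candidate triangles isomorphic to standard triangles. -/
def dist : Set (Tri h.susp) :=
  {A | ∃ (X Y Z : C) (f : X ⟶ Y) (f' : h.I X ⟶ Z) (g : Y ⟶ Z) (r : Z ⟶ h.suspObj X),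
    IsPushout (h.i X) f f' g ∧ f' ≫ r = h.q X ∧ g ≫ r = 0 ∧
      (h.stdTri f g r).Isomorphic A}

end IsFrobenius

/-! ## `N`-complexes -/

section Complexes

variable {C : Type u} [Category.{v} C] [Preadditive C]

/-- A sequence over `C` is a functor `ℤ ⥤ C` from the path category of the infinite linear quiver,
that is, from the poset `ℤ`; the morphism `X.obj m ⟶ X.obj n` for `m ≤ n` is the composition of
`n - m` consecutive differentials. It is an `N`-complex if all `N`-fold compositions vanish. -/
def isNComplex (C : Type u) [Category.{v} C] [Preadditive C] (N : ℕ) : ObjectProperty (ℤ ⥤ C) :=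
  fun X => ∀ (m n : ℤ) (hmn : m ≤ n), n = m + N → X.map (homOfLE hmn) = 0

/-- The category `C_N(C)` of `N`-complexes over `C`. -/
abbrev NComplex (C : Type u) [Category.{v} C] [Preadditive C] (N : ℕ) :=
  (isNComplex C N).FullSubcategory

/-- The default (termsplit) exact structure on `C_N(C)`: the sequences which are split short exact
in each degree. -/
def termsplit (C : Type u) [Category.{v} C] [Preadditive C] (N : ℕ) :
    ObjectProperty (ShortComplex (NComplex C N)) :=
  fun T => ∀ n : ℤ, Nonempty (ShortComplex.mk (T.f.hom.app n) (T.g.hom.app n)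
    (congrArg (fun k => k.hom.app n) T.zero)).Splitting

/-- The functor `C_N(C) ⥤ C_N(D)` induced by an additive functor `C ⥤ D`. -/
noncomputable def mapNComplex {D : Type u'} [Category.{v'} D] [Preadditive D] (F : C ⥤ D) [F.Additive] (N : ℕ) :
    NComplex C N ⥤ NComplex D N :=
  (isNComplex D N).lift ((isNComplex C N).ι ⋙ (Functor.whiskeringRight ℤ C D).obj F)
    (fun X m n hmn hn => by
      change F.map (X.obj.map (homOfLE hmn)) = 0
      rw [X.property m n hmn hn, F.map_zero])

/-- The index in `X` of the object at position `k` of the contraction `γ^n_r(X)`. -/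
noncomputable def contractIndex (N : ℕ) (n : ℤ) (r : ℕ) (k : ℤ) : ℤ := n + (k - n) / 2 * N + (k - n) % 2 * r

theorem contractIndex_monotone (N : ℕ) (n : ℤ) (r : ℕ) (hr : r ≤ N) :
    Monotone (contractIndex N n r) := by
  refine monotone_int_of_le_succ fun k => ?_
  unfold contractIndex
  rcases Int.even_or_odd' (k - n) with ⟨a, ha | ha⟩
  · have h₁ : (k - n) / 2 = a := by omega
    have h₂ : (k - n) % 2 = 0 := by omega
    have h₃ : (k + 1 - n) / 2 = a := by omega
    have h₄ : (k + 1 - n) % 2 = 1 := by omega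
    rw [h₁, h₂, h₃, h₄]
    omega
  · have h₁ : (k - n) / 2 = a := by omega
    have h₂ : (k - n) % 2 = 1 := by omega
    have h₃ : (k + 1 - n) / 2 = a + 1 := by omega
    have h₄ : (k + 1 - n) % 2 = 0 := by omega
    have h₅ : (a + 1) * (N : ℤ) = a * N + N := by ring
    rw [h₁, h₂, h₃, h₄, h₅]
    omega

/-- The contraction `γ^n_r(X)`, that is, the sequence
`⋯ ⟶ X^{n-N} ⟶ X^{n-N+r} ⟶ X^n ⟶ X^{n+r} ⟶ X^{n+N} ⟶ ⋯` with `X^n` at position `n`. -/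
noncomputable def contraction {E : Type u} [Category.{v} E] (N : ℕ) (n : ℤ) (r : ℕ) (hr : r ≤ N) (X : ℤ ⥤ E) :
    ℤ ⥤ E :=
  (contractIndex_monotone N n r hr).functor ⋙ X

/-- A sequence is `2`-acyclic at position `n` if `X^{n-1} ⟶ X^n ⟶ X^{n+1}` is acyclic. -/
def TwoAcyclicAt (S : ObjectProperty (ShortComplex C)) (X : ℤ ⥤ C) (n : ℤ) : Prop :=
  IsAcyclicPair S (X.map (homOfLE (sub_le_self n zero_le_one) : n - 1 ⟶ n))
    (X.map (homOfLE (le_add_of_nonneg_right zero_le_one) : n ⟶ n + 1))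

/-- A sequence is `N`-acyclic at position `n` if `γ^n_r(X)` is `2`-acyclic at position `n` for
all `r ∈ {1, …, N - 1}`. -/
def NAcyclicAt (S : ObjectProperty (ShortComplex C)) (N : ℕ) (X : ℤ ⥤ C) (n : ℤ) : Prop :=
  ∀ (r : ℕ) (_ : 1 ≤ r) (hr : r < N), TwoAcyclicAt S (contraction N n r hr.le X) n

/-- The functor `ℤ ⥤ ℤᵒᵖ`, `n ↦ -n`. -/
noncomputable def negOp : ℤ ⥤ ℤᵒᵖ where
  obj n := Opposite.op (-n)
  map f := (homOfLE (neg_le_neg (leOfHom f))).op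

/-- The sequence `Hom(X, P)` of abelian groups, with `Hom(X, P)^n = Hom(X^{-n}, P)`. -/
noncomputable def homSeq (X : ℤ ⥤ C) (P : C) : ℤ ⥤ AddCommGrpCat.{v} :=
  negOp ⋙ X.op ⋙ preadditiveYoneda.obj P

/-- A sequence is totally `N`-acyclic at position `n` if it is `N`-acyclic at `n` and `Hom(X, P)`
is `N`-acyclic at `-n` for all projectives `P`. -/
def TotallyNAcyclicAt (S : ObjectProperty (ShortComplex C)) (N : ℕ) (X : ℤ ⥤ C) (n : ℤ) : Prop :=
  NAcyclicAt S N X n ∧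
    ∀ P : C, IsProjective S P → NAcyclicAt abExact N (homSeq X P) (-n)

end Complexes

/-! ## Verdier's notation -/

/-- The boundedness conditions `#`. -/
inductive Bound
  | inf | plus | minus | b

/-- The acyclicity conditions `♮`. -/
inductive Acyc
  | inf | plus | minus | b | empty | emptyStar

/-- `X^k = 0` for any `k`-range prescribed by `#`: no condition, all sufficiently small `k`, all
sufficiently large `k`, almost all `k`. -/
def SatisfiesBound {C : Type u} [Category.{v} C] (X : ℤ ⥤ C) : Bound → Prop
  | .inf => True
  | .plus => ∃ m : ℤ, ∀ k ≤ m, IsZero (X.obj k)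
  | .minus => ∃ m : ℤ, ∀ k ≥ m, IsZero (X.obj k)
  | .b => {k : ℤ | ¬ IsZero (X.obj k)}.Finite

/-- The acyclicity condition prescribed by `♮`: none, acyclic at all sufficiently small positions,
at all sufficiently large positions, at almost all positions, at all positions, and totally
acyclic (at all positions). -/
def SatisfiesAcyc {C : Type u} [Category.{v} C] [Preadditive C]
    (S : ObjectProperty (ShortComplex C)) (N : ℕ) (X : ℤ ⥤ C) : Acyc → Prop
  | .inf => True
  | .plus => ∃ m : ℤ, ∀ k ≤ m, NAcyclicAt S N X k
  | .minus => ∃ m : ℤ, ∀ k ≥ m, NAcyclicAt S N X k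
  | .b => {k : ℤ | ¬ NAcyclicAt S N X k}.Finite
  | .empty => ∀ k : ℤ, NAcyclicAt S N X k
  | .emptyStar => ∀ k : ℤ, TotallyNAcyclicAt S N X k

/-- The subcategory `C_N^{#,♮}(E)` of `C_N(E)`, for `a = (#, ♮)`. -/
def verdier {E : Type u} [Category.{v} E] [Preadditive E] (S : ObjectProperty (ShortComplex E))
    (N : ℕ) (a : Bound × Acyc) : ObjectProperty (NComplex E N) :=
  fun X => SatisfiesBound X.obj a.1 ∧ SatisfiesAcyc S N X.obj a.2

/-- For a full subcategory `A` of `E`, the subcategory `C_N^{#,♮_E}(A) = C_N(A) ∩ C_N^{#,♮}(E)`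
of `C_N(A)`, for `a = (#, ♮)`. -/
def verdierIn {E : Type u} [Category.{v} E] [Preadditive E] (S : ObjectProperty (ShortComplex E))
    (A : ObjectProperty E) (N : ℕ) (a : Bound × Acyc) :
    ObjectProperty (NComplex A.FullSubcategory N) :=
  (verdier S N a).inverseImage (mapNComplex A.ι N)

/-- The arrows of the two diagrams of stable categories; `K_N^#` stands for `K_N^{#,∞}`. -/
inductive Arrow : Bound × Acyc → Bound × Acyc → Prop
  -- first diagram, starting from the column on the left
  | b_empty_to_minus_empty : Arrow (.b, .empty) (.minus, .empty)
  | b_empty_to_plus_empty : Arrow (.b, .empty) (.plus, .empty)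
  | b_empty_to_b : Arrow (.b, .empty) (.b, .inf)
  | plus_empty_to_inf_empty : Arrow (.plus, .empty) (.inf, .empty)
  | plus_empty_to_plus_b : Arrow (.plus, .empty) (.plus, .b)
  | minus_empty_to_inf_empty : Arrow (.minus, .empty) (.inf, .empty)
  | minus_empty_to_minus_b : Arrow (.minus, .empty) (.minus, .b)
  | b_to_plus_b : Arrow (.b, .inf) (.plus, .b)
  | b_to_minus_b : Arrow (.b, .inf) (.minus, .b)
  | inf_empty_to_inf_b : Arrow (.inf, .empty) (.inf, .b)
  | plus_b_to_plus : Arrow (.plus, .b) (.plus, .inf)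
  | plus_b_to_inf_b : Arrow (.plus, .b) (.inf, .b)
  | minus_b_to_minus : Arrow (.minus, .b) (.minus, .inf)
  | minus_b_to_inf_b : Arrow (.minus, .b) (.inf, .b)
  | plus_to_inf_plus : Arrow (.plus, .inf) (.inf, .plus)
  | minus_to_inf_minus : Arrow (.minus, .inf) (.inf, .minus)
  | inf_b_to_inf_plus : Arrow (.inf, .b) (.inf, .plus)
  | inf_b_to_inf_minus : Arrow (.inf, .b) (.inf, .minus)
  | inf_plus_to_inf : Arrow (.inf, .plus) (.inf, .inf)
  | inf_minus_to_inf : Arrow (.inf, .minus) (.inf, .inf)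
  -- remaining arrows of the second diagram
  | b_star_to_plus_star : Arrow (.b, .emptyStar) (.plus, .emptyStar)
  | b_star_to_minus_star : Arrow (.b, .emptyStar) (.minus, .emptyStar)
  | b_star_to_b_empty : Arrow (.b, .emptyStar) (.b, .empty)
  | plus_star_to_inf_star : Arrow (.plus, .emptyStar) (.inf, .emptyStar)
  | plus_star_to_plus_empty : Arrow (.plus, .emptyStar) (.plus, .empty)
  | minus_star_to_inf_star : Arrow (.minus, .emptyStar) (.inf, .emptyStar)
  | minus_star_to_minus_empty : Arrow (.minus, .emptyStar) (.minus, .empty)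
  | inf_star_to_inf_empty : Arrow (.inf, .emptyStar) (.inf, .empty)

/-! ## Canonical functors between the stable categories of full subcategories -/

section Canonical

variable {C : Type u} [Category.{v} C] [Preadditive C]

instance {P Q : ObjectProperty C} (hPQ : P ≤ Q) : (ObjectProperty.ιOfLE hPQ).Additive where

instance {P : ObjectProperty C} : P.ι.Additive where

/-- An inclusion `P ⊆ Q` of full subcategories of `(C, S)` preserves projectives. -/
def InclPreservesProj (S : ObjectProperty (ShortComplex C)) {P Q : ObjectProperty C}
    (hPQ : P ≤ Q) : Prop :=
  ∀ X : P.FullSubcategory, IsProjective (induced S P) X →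
    IsProjective (induced S Q) ((ObjectProperty.ιOfLE hPQ).obj X)

/-- The canonical functor between the stable categories of full subcategories `P ⊆ Q`. -/
noncomputable abbrev stableIncl (S : ObjectProperty (ShortComplex C)) {P Q : ObjectProperty C}
    (hPQ : P ≤ Q) (hproj : InclPreservesProj S hPQ) :
    StableCategory (induced S P) ⥤ StableCategory (induced S Q) :=
  stableMap (induced S P) (induced S Q) (ObjectProperty.ιOfLE hPQ) hproj

/-- The inclusion of the full subcategory `P` into `(C, S)` preserves projectives. -/
def PreservesProj (S : ObjectProperty (ShortComplex C)) (P : ObjectProperty C) : Prop :=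
  ∀ X : P.FullSubcategory, IsProjective (induced S P) X → IsProjective S (P.ι.obj X)

/-- The canonical functor from the stable category of `P` to that of `(C, S)`. -/
noncomputable abbrev stableι (S : ObjectProperty (ShortComplex C)) (P : ObjectProperty C)
    (hproj : PreservesProj S P) : StableCategory (induced S P) ⥤ StableCategory S :=
  stableMap (induced S P) S P.ι hproj

/-- The stable categories of a family `P` of Frobenius subcategories of a Frobenius category
`(C, S)`, indexed by pairs `(#, ♮)`, form the two diagrams of canonical fully faithful triangulated
functors, with the triangulations from Frobenius categories. -/
structure IsStableDiagram (S : ObjectProperty (ShortComplex C)) (hS : IsFrobenius S)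
    (P : Bound × Acyc → ObjectProperty C) (hP : ∀ a, IsFrobenius (induced S (P a))) : Prop where
  triangulated : IsTriangulatedCategory hS.susp hS.dist
  triangulated_sub : ∀ a, IsTriangulatedCategory (hP a).susp (hP a).dist
  /-- Every arrow of the diagrams comes from an inclusion of subcategories. -/
  le_of_arrow : ∀ a b, Arrow a b → P a ≤ P b
  /-- Inclusions of subcategories induce fully faithful triangulated functors. -/
  incl : ∀ a b (hab : P a ≤ P b), ∃ hp : InclPreservesProj S hab,
    (stableIncl S hab hp).Full ∧ (stableIncl S hab hp).Faithful ∧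
      IsTriangulatedFunctor (hP a).dist (hP b).dist (stableIncl S hab hp)
  /-- All stable categories embed into the stable category of `(C, S)`. -/
  ι : ∀ a, ∃ hp : PreservesProj S (P a),
    (stableι S (P a) hp).Full ∧ (stableι S (P a) hp).Faithful ∧
      IsTriangulatedFunctor (hP a).dist hS.dist (stableι S (P a) hp)
  /-- The subcategory indexed by `(∞, ∞)` represents the whole stable category. -/
  ι_inf : ∀ hp : PreservesProj S (P (.inf, .inf)), (stableι S (P (.inf, .inf)) hp).IsEquivalence
  /-- The diagrams commute. -/
  comm : ∀ a b c (hab : P a ≤ P b) (hbc : P b ≤ P c) (h₁ : InclPreservesProj S hab)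
    (h₂ : InclPreservesProj S hbc) (h₃ : InclPreservesProj S (hab.trans hbc)),
    stableIncl S hab h₁ ⋙ stableIncl S hbc h₂ = stableIncl S (hab.trans hbc) h₃
  comm_ι : ∀ a b (hab : P a ≤ P b) (h₁ : InclPreservesProj S hab) (h₂ : PreservesProj S (P b))
    (h₃ : PreservesProj S (P a)),
    stableIncl S hab h₁ ⋙ stableι S (P b) h₂ = stableι S (P a) h₃

end Canonical

end NCplx

open NCplx

namespace NCplx

/-! ### Exact categories: conflations under pushout, pullback and composition. -/

section ExactLemmas

variable {C : Type u} [Category.{v} C] [Preadditive C] {S : ObjectProperty (ShortComplex C)}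

namespace IsExactCategory

/-! The stable category of a Frobenius category is triangulated (Happel), and a fully faithful exact
functor between Frobenius categories that preserves projectives induces a fully faithful
triangulated functor of stable categories. So (c) follows once each subcategory is known to be
sub-Frobenius: its projectives are then the ambient projectives lying in it
(`IsSubFrobenius.isProjective_iff`), and the diagrams commute because a functor out of a quotient
category is determined on the original category.

For Happel's theorem, `mem_dist_iff` replaces standard triangles by conflations with a connecting
morphism. Then the first morphism is an admissible monic, stably commutative squares can be
corrected to strictly commutative ones by extending maps into injectives, and the axioms become
statements about cokernels; the octahedron is the third isomorphism theorem.

For `N`-complexes, `cofree A N` is the direct sum of the complexes `A n = ⋯ = A n` with `N` terms.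
Morphisms into it and out of it correspond to arbitrary families of morphisms of objects, so it is
both injective and projective for the degreewise split structure. Every complex embeds into such a
complex (`hull`) and is a quotient of one (`cover`).

The heart is that each subcategory is closed under extensions and contains, with `X`, its hull, its
cover, the cokernel of the hull and the kernel of the cover. Acyclicity is a condition on the pairs
`X^{n-N+r} ⟶ X^n ⟶ X^{n+r}`. `PairProperty.IsStable` lists the formal properties of acyclic pairs
that are needed; exactness under `Hom(-, P)` has them too, and they pass to inverse images under
additive functors. Extensions are covered by `isAcyclicPair_biprod`. For the cokernel of the hull,
the pair at `n` with parameter `r` is, up to isomorphism and split pieces, the pair of `X` at `n +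
r` with parameter `N - r` (`of_cosyzygy`); for the kernel of the cover it is the pair of `X` at `n -
N + r` with parameter `N - r` (`of_syzygy`). Acyclicity is thus displaced by fewer than `N`
positions, which no condition `#` or `♮` notices.

All this is done for complexes over a category `C` with an additive functor `F : C ⥤ E`: splittings
live in `C`, acyclicity is tested in `E`. The identity of `E` and the inclusion of `A` give the two
halves of the theorem. -/

theorem mono_f (hS : IsExactCategory S) {X Y Z : C} {f : X ⟶ Y} {g : Y ⟶ Z} {w : f ≫ g = 0}
    (h : S (.mk f g w)) : Mono f := by
  obtain ⟨hk⟩ := hS.kernel _ h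
  exact mono_of_isLimit_fork hk

theorem epi_g (hS : IsExactCategory S) {X Y Z : C} {f : X ⟶ Y} {g : Y ⟶ Z} {w : f ≫ g = 0}
    (h : S (.mk f g w)) : Epi g := by
  obtain ⟨hk⟩ := hS.cokernel _ h
  exact epi_of_isColimit_cofork hk

theorem exists_desc (hS : IsExactCategory S) {X Y Z : C} {f : X ⟶ Y} {g : Y ⟶ Z} {w : f ≫ g = 0}
    (h : S (.mk f g w)) {W : C} (k : Y ⟶ W) (hk : f ≫ k = 0) : ∃ t, g ≫ t = k := by
  obtain ⟨hc⟩ := hS.cokernel _ h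
  exact ⟨hc.desc (CokernelCofork.ofπ k hk), hc.fac _ WalkingParallelPair.one⟩

theorem exists_lift (hS : IsExactCategory S) {X Y Z : C} {f : X ⟶ Y} {g : Y ⟶ Z} {w : f ≫ g = 0}
    (h : S (.mk f g w)) {W : C} (k : W ⟶ Y) (hk : k ≫ g = 0) : ∃ t, t ≫ f = k := by
  obtain ⟨hc⟩ := hS.kernel _ h
  exact ⟨hc.lift (KernelFork.ofι k hk), hc.fac _ WalkingParallelPair.zero⟩

theorem of_iso (hS : IsExactCategory S) {X Y Z X' Y' Z' : C} {f : X ⟶ Y} {g : Y ⟶ Z}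
    {w : f ≫ g = 0} {f' : X' ⟶ Y'} {g' : Y' ⟶ Z'} (w' : f' ≫ g' = 0) (h : S (.mk f g w))
    (a : X ≅ X') (b : Y ≅ Y') (c : Z ≅ Z') (h₁ : a.hom ≫ f' = f ≫ b.hom)
    (h₂ : b.hom ≫ g' = g ≫ c.hom) : S (.mk f' g' w') := by
  have := hS.closedUnderIso
  exact S.prop_of_iso (ShortComplex.isoMk a b c h₁ h₂) h

/-- Cokernels are unique up to isomorphism and conflations are closed under isomorphism. An
epimorphism with the factorization property is a cokernel, so no colimit cocone has to be packaged.
-/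
theorem conflation_of_cokernel (hS : IsExactCategory S) {X Y Z : C} {i : X ⟶ Y} {p : Y ⟶ Z}
    (hi : AdmissibleMono S i) (w : i ≫ p = 0) [Epi p]
    (hd : ∀ ⦃W : C⦄ (k : Y ⟶ W), i ≫ k = 0 → ∃ t, p ≫ t = k) : S (.mk i p w) := by
  obtain ⟨Z', p', w', h⟩ := hi
  have := hS.epi_g h
  obtain ⟨t, ht⟩ := hd p' w'
  obtain ⟨t', ht'⟩ := hS.exists_desc h p w
  refine hS.of_iso w h (Iso.refl _) (Iso.refl _) ⟨t', t, ?_, ?_⟩ (by simp) (by simp [ht'])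
  · rw [← cancel_epi p', ← Category.assoc, ht', ht, Category.comp_id]
  · rw [← cancel_epi p, ← Category.assoc, ht, ht', Category.comp_id]

theorem conflation_of_kernel (hS : IsExactCategory S) {X Y Z : C} {i : X ⟶ Y} {p : Y ⟶ Z}
    (hp : AdmissibleEpi S p) (w : i ≫ p = 0) [Mono i]
    (hd : ∀ ⦃W : C⦄ (k : W ⟶ Y), k ≫ p = 0 → ∃ t, t ≫ i = k) : S (.mk i p w) := by
  obtain ⟨X', i', w', h⟩ := hp
  have := hS.mono_f h
  obtain ⟨t, ht⟩ := hd i' w'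
  obtain ⟨t', ht'⟩ := hS.exists_lift h i w
  refine hS.of_iso w h ⟨t, t', ?_, ?_⟩ (Iso.refl _) (Iso.refl _) (by simp [ht]) (by simp)
  · rw [← cancel_mono i', Category.assoc, ht', ht, Category.id_comp]
  · rw [← cancel_mono i, Category.assoc, ht, ht', Category.id_comp]

/-- The pushout of a conflation. -/
theorem pushout_conflation (hS : IsExactCategory S) {X Y Z X' Y' : C} {i : X ⟶ Y} {p : Y ⟶ Z}
    {w : i ≫ p = 0} (h : S (.mk i p w)) {f : X ⟶ X'} {f' : Y ⟶ Y'} {i' : X' ⟶ Y'}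
    (sq : IsPushout i f f' i') {p' : Y' ⟶ Z} (h₁ : f' ≫ p' = p) (h₂ : i' ≫ p' = 0) :
    S (.mk i' p' h₂) := by
  have := hS.epi_g h
  have : Epi p' := epi_of_epi_fac h₁
  refine hS.conflation_of_cokernel (hS.pushout i f f' i' ⟨_, _, _, h⟩ sq) h₂ fun W k hk => ?_
  obtain ⟨t, ht⟩ := hS.exists_desc h (f' ≫ k) (by rw [← Category.assoc, sq.w, Category.assoc, hk,
    comp_zero])
  exact ⟨t, sq.hom_ext (by rw [← Category.assoc, h₁, ht]) (by
    rw [← Category.assoc, h₂, zero_comp, hk])⟩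

/-- The pullback of a conflation. -/
theorem pullback_conflation (hS : IsExactCategory S) {X Y Z Y' Z' : C} {i : X ⟶ Y} {p : Y ⟶ Z}
    {w : i ≫ p = 0} (h : S (.mk i p w)) {f : Z' ⟶ Z} {f' : Y' ⟶ Y} {p' : Y' ⟶ Z'}
    (sq : IsPullback f' p' p f) {i' : X ⟶ Y'} (h₁ : i' ≫ f' = i) (h₂ : i' ≫ p' = 0) :
    S (.mk i' p' h₂) := by
  have := hS.mono_f h
  have : Mono i' := mono_of_mono_fac h₁
  refine hS.conflation_of_kernel (hS.pullback f' p' p f ⟨_, _, _, h⟩ sq) h₂ fun W k hk => ?_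
  obtain ⟨t, ht⟩ := hS.exists_lift h (k ≫ f') (by rw [Category.assoc, sq.w, ← Category.assoc, hk,
    zero_comp])
  exact ⟨t, sq.hom_ext (by rw [Category.assoc, h₁, ht]) (by
    rw [Category.assoc, h₂, comp_zero, hk])⟩

theorem conflation_id_zero (hS : IsExactCategory S) (X : C) {Z : C} (hZ : IsZero Z) :
    S (.mk (𝟙 X) (0 : X ⟶ Z) (by simp)) := by
  have : Epi (0 : X ⟶ Z) := ⟨fun _ _ _ => hZ.eq_of_src _ _⟩
  exact hS.conflation_of_cokernel (hS.id_mono X) _ fun W k hk => ⟨0, by simpa using hk.symm⟩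

theorem conflation_zero_id (hS : IsExactCategory S) (X : C) {Z : C} (hZ : IsZero Z) :
    S (.mk (0 : Z ⟶ X) (𝟙 X) (by simp)) := by
  have : Mono (0 : Z ⟶ X) := ⟨fun _ _ _ => hZ.eq_of_tgt _ _⟩
  exact hS.conflation_of_kernel (hS.id_epi X) _ fun W k hk => ⟨0, by simpa using hk.symm⟩

theorem admissibleMono_iso (hS : IsExactCategory S) {X Y : C} (e : X ≅ Y) :
    AdmissibleMono S e.hom := by
  obtain ⟨O, hO⟩ := hS.hasZeroObject.zero
  exact ⟨O, 0, by simp, hS.of_iso _ (hS.conflation_id_zero X hO) (Iso.refl _) e (Iso.refl _)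
    (by simp) (by simp)⟩

theorem admissibleEpi_iso (hS : IsExactCategory S) {X Y : C} (e : X ≅ Y) :
    AdmissibleEpi S e.hom := by
  obtain ⟨O, hO⟩ := hS.hasZeroObject.zero
  exact ⟨O, 0, by simp, hS.of_iso _ (hS.conflation_zero_id X hO) (Iso.refl _) (Iso.refl _) e
    (by simp) (by simp)⟩

/-- Split sequences are conflations. -/
theorem of_splitting (hS : IsExactCategory S) {T : ShortComplex C} (s : T.Splitting) : S T := by
  obtain ⟨O, hO⟩ := hS.hasZeroObject.zero
  -- The splitting exhibits the middle term as a coproduct, that is, a pushout over zero; the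
  -- sequence is the pushout of the conflation `O ↣ T.X₃ ↠ T.X₃`.
  have sq : IsPushout (0 : O ⟶ T.X₃) (0 : O ⟶ T.X₁) s.s T.f := by
    refine ⟨⟨by simp⟩, ⟨PushoutCocone.IsColimit.mk _ (fun c => s.r ≫ c.inr + T.g ≫ c.inl)
      (fun c => ?_) (fun c => ?_) fun c m h₁ h₂ => ?_⟩⟩
    · simp
    · simp
    · rw [← Category.id_comp m, ← s.id, Preadditive.add_comp, Category.assoc, Category.assoc,
        h₁, h₂]
  exact hS.pushout_conflation (hS.conflation_zero_id T.X₃ hO) sq s.s_g T.zero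

/-- A pushout along an admissible monic gives a conflation `X ↣ Y ⊞ X' ↠ Y'`. -/
theorem conflation_of_isPushout (hS : IsExactCategory S) [HasBinaryBiproducts C] {X Y X' Y' : C}
    {i : X ⟶ Y} (hi : AdmissibleMono S i) {f : X ⟶ X'} {f' : Y ⟶ Y'} {i' : X' ⟶ Y'}
    (sq : IsPushout i f f' i') :
    S (.mk (biprod.lift i f) (biprod.desc (-f') i') (by simp [sq.w])) := by
  -- Factor `(i, f)` as the inclusion `X ⟶ X ⊞ X'`, a shear automorphism with off-diagonal entry
  -- `f`, and `i ⊞ 𝟙`, which is a pushout of `i`.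
  have hi' : AdmissibleMono S (biprod.lift i f) := by
    have h₁ : AdmissibleMono S (biprod.inl : X ⟶ X ⊞ X') :=
      ⟨X', biprod.snd, by simp, hS.of_splitting
        { r := biprod.fst, s := biprod.inr, id := by simp }⟩
    have h₂ := hS.admissibleMono_iso (C := C) (X := X ⊞ X') (Y := X ⊞ X')
      ⟨biprod.desc (biprod.lift (𝟙 _) f) biprod.inr, biprod.desc (biprod.lift (𝟙 _) (-f)) biprod.inr,
        by ext <;> simp, by ext <;> simp⟩
    have h₃ : AdmissibleMono S (biprod.map i (𝟙 X')) := by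
      refine hS.pushout i biprod.inl biprod.inl _ hi ⟨⟨by simp⟩, ⟨PushoutCocone.IsColimit.mk _
        (fun c => biprod.desc c.inl (biprod.inr ≫ c.inr)) (fun c => ?_) (fun c => ?_)
        fun c m h₁ h₂ => ?_⟩⟩
      · simp
      · ext
        · simp [c.condition]
        · simp
      · ext
        · simp [h₁]
        · simp [← h₂]
    have := hS.comp_mono _ _ h₁ (hS.comp_mono _ _ h₂ h₃)
    convert this using 1
    ext <;> simp
  have : Epi (biprod.desc (-f') i') := ⟨fun a b hab => by
    have h₁ := biprod.inl ≫= hab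
    have h₂ := biprod.inr ≫= hab
    simp only [biprod.inl_desc_assoc, Preadditive.neg_comp, neg_inj] at h₁
    simp only [biprod.inr_desc_assoc] at h₂
    exact sq.hom_ext h₁ h₂⟩
  refine hS.conflation_of_cokernel hi' _ fun W k hk => ?_
  have e : i ≫ (-(biprod.inl ≫ k)) = f ≫ (biprod.inr ≫ k) := by
    rw [biprod.lift_eq, Preadditive.add_comp, Category.assoc, Category.assoc] at hk
    rw [Preadditive.comp_neg]
    exact neg_eq_of_add_eq_zero_right hk
  exact ⟨sq.desc _ _ e, by ext <;> simp⟩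

/-- The third isomorphism theorem. -/
theorem conflation_of_comp (hS : IsExactCategory S) {X Y Z A B D : C} {i : X ⟶ Y} {j : Y ⟶ Z}
    {p : Y ⟶ A} {q : Z ⟶ B} {r : Z ⟶ D} {w₁ : i ≫ p = 0} {w₂ : j ≫ q = 0}
    {w₃ : (i ≫ j) ≫ r = 0} (h₁ : S (.mk i p w₁)) (h₂ : S (.mk j q w₂))
    (h₃ : S (.mk (i ≫ j) r w₃)) {a : A ⟶ D} {b : D ⟶ B} (ha : p ≫ a = j ≫ r)
    (hb : r ≫ b = q) : ∃ w, S (.mk a b w) := by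
  have e₁ := hS.epi_g h₁
  have e₃ := hS.epi_g h₃
  -- The square formed by `j`, `p`, `r`, `a` is a pushout: a cocone on it vanishes on `i ≫ j`, hence
  -- factors through `r`. Pushing out the conflation of `j` along `p` gives the claim.
  have hex : ∀ c : PushoutCocone j p, ∃ t, r ≫ t = c.inl := fun c =>
    hS.exists_desc h₃ _ (by rw [Category.assoc, c.condition, ← Category.assoc, w₁, zero_comp])
  choose t ht using hex
  have sq : IsPushout j p r a := ⟨⟨ha.symm⟩, ⟨PushoutCocone.IsColimit.mk _ t ht (fun c => by
    rw [← cancel_epi p, ← Category.assoc, ha, Category.assoc, ht, c.condition])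
    fun c m h _ => by rw [← cancel_epi r, h, ht]⟩⟩
  have w : a ≫ b = 0 := by
    rw [← cancel_epi p, ← Category.assoc, ha, Category.assoc, hb, w₂, comp_zero]
  exact ⟨w, hS.pushout_conflation h₂ sq hb w⟩

end IsExactCategory

end ExactLemmas

/-! ### Equality of morphisms in the stable category. -/

section StableLemmas

variable {C : Type u} [Category.{v} C] [Preadditive C] {S : ObjectProperty (ShortComplex C)}

theorem toStable_map_eq_iff {X Y : C} (f g : X ⟶ Y) :
    (toStable S).map f = (toStable S).map g ↔ f - g ∈ projIdeal S X Y :=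
  CategoryTheory.Quotient.functor_map_eq_iff _ f g

theorem toStable_map_eq_of_factor {X Y P : C} {f g : X ⟶ Y} (hP : IsProjective S P) (a : X ⟶ P)
    (b : P ⟶ Y) (e : f - g = a ≫ b) : (toStable S).map f = (toStable S).map g :=
  (toStable_map_eq_iff f g).2 (AddSubgroup.subset_closure ⟨P, a, b, hP, e⟩)

instance : (toStable S).Additive where

theorem exists_factor (hS : IsExactCategory S) {X Y : C} {f g : X ⟶ Y}
    (e : (toStable S).map f = (toStable S).map g) :
    ∃ (P : C) (a : X ⟶ P) (b : P ⟶ Y), IsProjective S P ∧ f - g = a ≫ b :=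
  (mem_projIdeal_iff hS _).1 ((toStable_map_eq_iff f g).1 e)

theorem exists_toStable_map_eq {X Y : C} (f : (toStable S).obj X ⟶ (toStable S).obj Y) :
    ∃ f₀ : X ⟶ Y, (toStable S).map f₀ = f :=
  (toStable S).map_surjective f

end StableLemmas

/-! ### Candidate triangles and transport along isomorphisms. -/

section Tri

variable {T : Type u} [Category.{v} T] {susp : T ⥤ T}

theorem Tri.Isomorphic.symm {A B : Tri susp} (h : A.Isomorphic B) : B.Isomorphic A := by
  obtain ⟨a, b, c, h₁, h₂, h₃⟩ := h
  refine ⟨a.symm, b.symm, c.symm, ?_, ?_, ?_⟩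
  · simp [Iso.eq_inv_comp, ← reassoc_of% h₁]
  · simp [Iso.eq_inv_comp, ← reassoc_of% h₂]
  · rw [Iso.symm_hom, Iso.symm_hom, Iso.eq_inv_comp, ← reassoc_of% h₃, ← Functor.map_comp,
      Iso.hom_inv_id, CategoryTheory.Functor.map_id, Category.comp_id]

theorem Tri.Isomorphic.trans {A B D : Tri susp} (h : A.Isomorphic B) (h' : B.Isomorphic D) :
    A.Isomorphic D := by
  obtain ⟨a, b, c, h₁, h₂, h₃⟩ := h
  obtain ⟨a', b', c', h₁', h₂', h₃'⟩ := h'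
  refine ⟨a ≪≫ a', b ≪≫ b', c ≪≫ c', ?_, ?_, ?_⟩
  · simp [reassoc_of% h₁, h₁']
  · simp [reassoc_of% h₂, h₂']
  · simp [reassoc_of% h₃, h₃']

theorem Tri.Isomorphic.refl (A : Tri susp) : A.Isomorphic A :=
  ⟨Iso.refl _, Iso.refl _, Iso.refl _, by simp, by simp, by simp⟩

/-- The rotation of a candidate triangle. -/
abbrev Tri.rotate [Preadditive T] (A : Tri susp) : Tri susp :=
  ⟨A.X₂, A.X₃, susp.obj A.X₁, A.g, A.h, -susp.map A.f⟩

theorem Tri.Isomorphic.rotate [Preadditive T] {A B : Tri susp} (h : A.Isomorphic B) :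
    A.rotate.Isomorphic B.rotate := by
  obtain ⟨a, b, c, h₁, h₂, h₃⟩ := h
  refine ⟨b, c, susp.mapIso a, h₂, h₃, ?_⟩
  simp only [Preadditive.neg_comp, Functor.mapIso_hom, Preadditive.comp_neg,
    ← Functor.map_comp, h₁]

/-- Every morphism between the first morphisms of `A` and `B` extends to a morphism of candidate
triangles. -/
def Tri.Completes (A B : Tri susp) : Prop :=
  ∀ (a : A.X₁ ⟶ B.X₁) (b : A.X₂ ⟶ B.X₂), A.f ≫ b = a ≫ B.f →
    ∃ c : A.X₃ ⟶ B.X₃, A.g ≫ c = b ≫ B.g ∧ A.h ≫ susp.map a = c ≫ B.h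

theorem Tri.Completes.of_isomorphic {A B A' B' : Tri susp} (H : A.Completes B)
    (hA : A.Isomorphic A') (hB : B.Isomorphic B') : A'.Completes B' := by
  intro a' b' hab
  obtain ⟨a₁, b₁, c₁, h₁, h₂, h₃⟩ := hA.symm
  obtain ⟨a, b, c, h₁', h₂', h₃'⟩ := hA
  obtain ⟨a₂, b₂, c₂, k₁, k₂, k₃⟩ := hB
  clear h₁ h₂ h₃ c₁ b₁ a₁
  obtain ⟨d, hd, hd'⟩ := H (a.hom ≫ a' ≫ a₂.inv) (b.hom ≫ b' ≫ b₂.inv) (by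
    have : B'.f ≫ b₂.inv = a₂.inv ≫ B.f := by
      rw [Iso.comp_inv_eq, Category.assoc, k₁, Iso.inv_hom_id_assoc]
    rw [reassoc_of% h₁', reassoc_of% hab, this]
    simp)
  refine ⟨c.inv ≫ d ≫ c₂.hom, ?_, ?_⟩
  · rw [← cancel_epi b.hom, ← reassoc_of% h₂', Iso.hom_inv_id_assoc, reassoc_of% hd, k₂]
    simp
  · rw [← cancel_epi c.hom, ← reassoc_of% h₃', Category.assoc, Category.assoc, ← k₃,
      Iso.hom_inv_id_assoc, ← reassoc_of% hd', ← Functor.map_comp, ← Functor.map_comp]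
    simp

/-- The second morphism of a candidate triangle is a weak cokernel of the first. -/
def Tri.HasDesc [Preadditive T] (A : Tri susp) : Prop :=
  ∀ ⦃W : T⦄ (φ : A.X₂ ⟶ W), A.f ≫ φ = 0 → ∃ t, A.g ≫ t = φ

theorem Tri.HasDesc.of_isomorphic [Preadditive T] {A A' : Tri susp} (H : A.HasDesc)
    (hA : A.Isomorphic A') : A'.HasDesc := by
  intro W φ hφ
  obtain ⟨a, b, c, h₁, h₂, -⟩ := hA
  obtain ⟨t, ht⟩ := H (b.hom ≫ φ) (by rw [reassoc_of% h₁, hφ, comp_zero])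
  exact ⟨c.inv ≫ t, by rw [← cancel_epi b.hom, ← reassoc_of% h₂, Iso.hom_inv_id_assoc, ht]⟩

end Tri

/-! ### Distinguished triangles from conflations: rotation, completion, uniqueness of cones. -/

namespace IsFrobenius

variable {C : Type u} [Category.{v} C] [Preadditive C] {S : ObjectProperty (ShortComplex C)}
  (h : IsFrobenius S)

theorem projective_I (X : C) : IsProjective S (h.I X) :=
  (h.projective_iff_injective _).2 (h.injective_I X)

instance susp_additive : h.susp.Additive where
  map_add {X Y f g} := by
    obtain ⟨f, rfl⟩ := (toStable S).map_surjective (X := X.as) (Y := Y.as) f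
    obtain ⟨g, rfl⟩ := (toStable S).map_surjective (X := X.as) (Y := Y.as) g
    rw [← Functor.map_add]
    exact ((h.exists_induces (f + g)).choose_spec.stable_eq
      ((h.exists_induces f).choose_spec.add (h.exists_induces g).choose_spec)
      ((inferInstance : Congruence (stableRel S)).equivalence.refl _)).trans
      ((toStable S).map_add)

/-- The class of a morphism to `Σ X` in the stable category. -/
noncomputable def conn {X Z : C} (r : Z ⟶ h.suspObj X) :
    (toStable S).obj Z ⟶ h.susp.obj ((toStable S).obj X) := (toStable S).map r

theorem conn_comp {X Z W : C} (c : W ⟶ Z) (r : Z ⟶ h.suspObj X) :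
    h.conn (c ≫ r) = (toStable S).map c ≫ h.conn r := (toStable S).map_comp c r

theorem conn_neg {X Z : C} (r : Z ⟶ h.suspObj X) : h.conn (-r) = -h.conn r :=
  (toStable S).map_neg

theorem conn_eq_of_factor {X Z P : C} {r r' : Z ⟶ h.suspObj X} (hP : IsProjective S P)
    (a : Z ⟶ P) (b : P ⟶ h.suspObj X) (e : r - r' = a ≫ b) : h.conn r = h.conn r' :=
  toStable_map_eq_of_factor hP a b e

variable {h} in
-- The suspension is defined by choosing an induced morphism, but all induced morphisms have the
-- same stable class. Computations may therefore use whichever extension to injective hulls is at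
-- hand.
theorem Induces.conn_comp_map {X Y Z : C} {f : X ⟶ Y} {s} (hs : h.Induces f s)
    (r : Z ⟶ h.suspObj X) :
    h.conn r ≫ h.susp.map ((toStable S).map f) = h.conn (r ≫ s) := by
  have e : h.susp.map ((toStable S).map f) = (toStable S).map s :=
    (h.exists_induces f).choose_spec.stable_eq hs
      ((inferInstance : Congruence (stableRel S)).equivalence.refl _)
  rw [e]
  exact ((toStable S).map_comp r s).symm

variable {h} in
theorem Induces.map_eq_conn {X Y : C} {f : X ⟶ Y} {s} (hs : h.Induces f s) :
    h.susp.map ((toStable S).map f) = h.conn s :=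
  (h.exists_induces f).choose_spec.stable_eq hs
      ((inferInstance : Congruence (stableRel S)).equivalence.refl _)

/-- The candidate triangle given by morphisms `X ⟶ Y ⟶ Z ⟶ Σ X`. -/
noncomputable abbrev connTri {X Y Z : C} (f : X ⟶ Y) (g : Y ⟶ Z) (r : Z ⟶ h.suspObj X) :
    Tri h.susp :=
  ⟨(toStable S).obj X, (toStable S).obj Y, (toStable S).obj Z, (toStable S).map f,
    (toStable S).map g, h.conn r⟩

/-- `r : Z ⟶ Σ X` is a connecting morphism of the conflation `X ↣ Y ↠ Z`. -/
def Connecting {X Y Z : C} (f : X ⟶ Y) (g : Y ⟶ Z) (r : Z ⟶ h.suspObj X) : Prop :=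
  (∃ w, S (.mk f g w)) ∧ ∃ k : Y ⟶ h.I X, f ≫ k = h.i X ∧ g ≫ r = -(k ≫ h.q X)

theorem exists_connecting {X Y Z : C} {f : X ⟶ Y} {g : Y ⟶ Z} {w : f ≫ g = 0}
    (hfg : S (.mk f g w)) : ∃ r, h.Connecting f g r := by
  obtain ⟨k, hk⟩ := h.injective_I X f ⟨_, _, _, hfg⟩ (h.i X)
  obtain ⟨r, hr⟩ := h.exact.exists_desc hfg (-(k ≫ h.q X)) (by
    rw [Preadditive.comp_neg, ← Category.assoc, hk, h.i_q, neg_zero])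
  exact ⟨r, ⟨w, hfg⟩, k, hk, hr⟩

/-- Adding `h.I X` to `Y` turns `f` into an admissible monic without changing its stable class, and
the pushout becomes its cokernel. The extension of `h.i X` is `biprod.fst`; the component `-f'` of
the cokernel map accounts for the minus sign in `Connecting`. -/
theorem connTri_isomorphic [HasBinaryBiproducts C] {X Y Z : C} {f : X ⟶ Y} {f' : h.I X ⟶ Z}
    {g : Y ⟶ Z} {r : Z ⟶ h.suspObj X} (sq : IsPushout (h.i X) f f' g) (h₁ : f' ≫ r = h.q X)
    (h₂ : g ≫ r = 0) :
    h.Connecting (biprod.lift (h.i X) f) (biprod.desc (-f') g) r ∧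
      (h.connTri (biprod.lift (h.i X) f) (biprod.desc (-f') g) r).Isomorphic (h.connTri f g r) := by
  have hS := h.exact.conflation_of_isPushout (h.admissibleMono_i X) sq
  refine ⟨⟨⟨_, hS⟩, biprod.fst, by simp, by ext <;> simp [h₁, h₂]⟩, Iso.refl _,
    ⟨(toStable S).map biprod.snd, (toStable S).map biprod.inr, ?_, ?_⟩, Iso.refl _, ?_, ?_, ?_⟩
  · dsimp only
    rw [← Functor.map_comp, ← CategoryTheory.Functor.map_id]
    exact toStable_map_eq_of_factor (h.projective_I X) (-biprod.fst) biprod.inl (by ext <;> simp)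
  · dsimp only
    rw [← Functor.map_comp, ← CategoryTheory.Functor.map_id, biprod.inr_snd]
  · simp only [Iso.refl_hom, Category.id_comp, ← Functor.map_comp, biprod.lift_snd]
  · simp only [Iso.refl_hom, Category.comp_id, ← Functor.map_comp]
    exact toStable_map_eq_of_factor (h.projective_I X) biprod.fst (-f') (by ext <;> simp)
  · simp

variable {h} in
-- The standard cone `W` maps to the cokernel `Z` by a morphism `c` that kills `h.I X`. Since `g' -
-- k ≫ f'` vanishes on `f`, it induces `t : Z ⟶ W` with `t ≫ c = 𝟙`, while `𝟙 - c ≫ t` equals `m ≫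
-- f'` and so factors through `h.I X`.
theorem Connecting.mem_dist {X Y Z : C} {f : X ⟶ Y} {g : Y ⟶ Z} {r : Z ⟶ h.suspObj X}
    (hr : h.Connecting f g r) : h.connTri f g r ∈ h.dist := by
  obtain ⟨⟨w, hfg⟩, k, hk, hkr⟩ := hr
  have := h.exact.hasPushout (h.i X) f (h.admissibleMono_i X)
  have sq := IsPushout.of_hasPushout (h.i X) f
  generalize pushout.inl (h.i X) f = f' at sq
  generalize pushout.inr (h.i X) f = g' at sq
  generalize pushout (h.i X) f = W at f' g' sq
  obtain ⟨r', h₁, h₂⟩ : ∃ r' : W ⟶ h.suspObj X, f' ≫ r' = h.q X ∧ g' ≫ r' = 0 :=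
    ⟨sq.desc (h.q X) 0 (by simp [h.i_q]), by simp, by simp⟩
  obtain ⟨c, hc₁, hc₂⟩ : ∃ c : W ⟶ Z, f' ≫ c = 0 ∧ g' ≫ c = g :=
    ⟨sq.desc 0 g (by simp [w]), by simp, by simp⟩
  obtain ⟨m, hm₁, hm₂⟩ : ∃ m : W ⟶ h.I X, f' ≫ m = 𝟙 _ ∧ g' ≫ m = k :=
    ⟨sq.desc (𝟙 _) k (by simp [hk]), by simp, by simp⟩
  obtain ⟨t, ht⟩ := h.exact.exists_desc hfg (g' - k ≫ f') (by
    rw [Preadditive.comp_sub, ← sq.w, ← Category.assoc, hk, sub_self])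
  have := h.exact.epi_g hfg
  have hiso : (h.connTri f g' r').Isomorphic (h.connTri f g r) := by
    refine ⟨Iso.refl _, Iso.refl _, ⟨(toStable S).map c, (toStable S).map t, ?_, ?_⟩, ?_, ?_, ?_⟩
    · dsimp only
      rw [← Functor.map_comp, ← CategoryTheory.Functor.map_id]
      refine toStable_map_eq_of_factor (h.projective_I X) (-m) f' (sq.hom_ext ?_ ?_)
      · simp [reassoc_of% hc₁, reassoc_of% hm₁]
      · simp [reassoc_of% hc₂, reassoc_of% hm₂, ht]
    · dsimp only
      rw [← Functor.map_comp, ← CategoryTheory.Functor.map_id]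
      congr 1
      rw [← cancel_epi g, reassoc_of% ht]
      simp [hc₁, hc₂]
    · simp
    · simp only [Iso.refl_hom, Category.id_comp, ← Functor.map_comp, hc₂]
    · simp only [Iso.refl_hom, CategoryTheory.Functor.map_id, Category.comp_id, ← conn_comp]
      refine h.conn_eq_of_factor (h.projective_I X) m (h.q X) (sq.hom_ext ?_ ?_)
      · simp [reassoc_of% hc₁, reassoc_of% hm₁, h₁]
      · simp [reassoc_of% hc₂, reassoc_of% hm₂, h₂, hkr]
  exact ⟨X, Y, W, f, f', g', r', sq, h₁, h₂, hiso⟩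

theorem mem_dist_iff (A : Tri h.susp) : A ∈ h.dist ↔
    ∃ (X Y Z : C) (f : X ⟶ Y) (g : Y ⟶ Z) (r : Z ⟶ h.suspObj X),
      h.Connecting f g r ∧ (h.connTri f g r).Isomorphic A := by
  constructor
  · rintro ⟨X, Y, Z, f, f', g, r, sq, h₁, h₂, hA⟩
    have := h.exact.hasBinaryBiproducts
    have h₀ := h.connTri_isomorphic sq h₁ h₂
    exact ⟨_, _, _, _, _, _, h₀.1, h₀.2.trans hA⟩
  · rintro ⟨X, Y, Z, f, g, r, hr, hA⟩
    obtain ⟨X, Y, Z, f, f', g, r, sq, h₁, h₂, hA'⟩ := hr.mem_dist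
    exact ⟨X, Y, Z, f, f', g, r, sq, h₁, h₂, hA'.trans hA⟩

theorem dist_of_isomorphic {A B : Tri h.susp} (hA : A ∈ h.dist) (hAB : A.Isomorphic B) :
    B ∈ h.dist := by
  obtain ⟨X, Y, Z, f, f', g, r, sq, h₁, h₂, hA'⟩ := hA
  exact ⟨X, Y, Z, f, f', g, r, sq, h₁, h₂, hA'.trans hAB⟩

theorem exists_isPushout {X Y : C} (f : X ⟶ Y) : ∃ (Z : C) (f' : h.I X ⟶ Z) (g : Y ⟶ Z)
    (r : Z ⟶ h.suspObj X), IsPushout (h.i X) f f' g ∧ f' ≫ r = h.q X ∧ g ≫ r = 0 := by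
  have := h.exact.hasPushout (h.i X) f (h.admissibleMono_i X)
  exact ⟨pushout (h.i X) f, pushout.inl _ _, pushout.inr _ _,
    pushout.desc (h.q X) 0 (by simp [h.i_q]), IsPushout.of_hasPushout _ _,
    pushout.inl_desc _ _ _, pushout.inr_desc _ _ _⟩

theorem exists_triangle {X Y : StableCategory S} (f : X ⟶ Y) :
    ∃ (Z : StableCategory S) (g : Y ⟶ Z) (r : Z ⟶ h.susp.obj X),
      (⟨X, Y, Z, f, g, r⟩ : Tri h.susp) ∈ h.dist := by
  obtain ⟨f, rfl⟩ := (toStable S).map_surjective (X := X.as) (Y := Y.as) f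
  obtain ⟨Z, f', g, r, sq, h₁, h₂⟩ := h.exists_isPushout f
  exact ⟨(toStable S).obj Z, (toStable S).map g, (toStable S).map r, X.as, Y.as, Z, f, f', g, r,
    sq, h₁, h₂, Tri.Isomorphic.refl _⟩

/-- The pushout of `X ↣ I(X) ↠ Σ X` along `f` is a conflation `Y ↣ Z ↠ Σ X`. If `k` extends `h.i Y`
to `Z`, then `f' ≫ k` extends `f` to the injective hulls, so the connecting morphism is minus a
morphism induced by `f`. -/
theorem rotate_mem_dist {A : Tri h.susp} (hA : A ∈ h.dist) : A.rotate ∈ h.dist := by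
  obtain ⟨X, Y, Z, f, f', g, r, sq, h₁, h₂, hA⟩ := hA
  refine h.dist_of_isomorphic ?_ hA.rotate
  have hgr := h.exact.pushout_conflation (h.conflation X) sq h₁ h₂
  have := h.exact.epi_g hgr
  obtain ⟨k, hk⟩ := h.injective_I Y g ⟨_, _, _, hgr⟩ (h.i Y)
  obtain ⟨s, hs⟩ := h.exact.exists_desc hgr (k ≫ h.q Y) (by
    rw [← Category.assoc, hk, h.i_q])
  have hfs : h.Induces f s := ⟨f' ≫ k, by rw [sq.w_assoc, hk], by rw [← h₁, Category.assoc, hs,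
    Category.assoc]⟩
  have hc : h.Connecting g r (-s) := ⟨⟨_, hgr⟩, k, hk, by simp [hs]⟩
  have e := hfs.map_eq_conn
  have := hc.mem_dist
  simp only [connTri, conn_neg, ← e] at this
  exact this

variable {h} in
theorem Connecting.completes {X Y Z X' Y' Z' : C} {f : X ⟶ Y} {g : Y ⟶ Z} {r : Z ⟶ h.suspObj X}
    (hr : h.Connecting f g r) {f' : X' ⟶ Y'} {g' : Y' ⟶ Z'} {r' : Z' ⟶ h.suspObj X'}
    (hr' : h.Connecting f' g' r') : (h.connTri f g r).Completes (h.connTri f' g' r') := by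
  obtain ⟨⟨w, hfg⟩, k, hk, hkr⟩ := hr
  obtain ⟨⟨w', hfg'⟩, k', hk', hkr'⟩ := hr'
  have := h.exact.epi_g hfg
  intro a b hab
  obtain ⟨a₀, rfl⟩ := exists_toStable_map_eq a
  obtain ⟨b₁, rfl⟩ := exists_toStable_map_eq b
  dsimp only at hab
  rw [← Functor.map_comp, ← Functor.map_comp] at hab
  obtain ⟨P, u, v, hP, huv⟩ := exists_factor h.exact hab
  obtain ⟨u', hu'⟩ := (h.projective_iff_injective P).1 hP f ⟨_, _, _, hfg⟩ u
  -- The defect of the square factors through `P`; as `P` is injective, it extends along `f` and can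
  -- be subtracted from `b₁`. The square then commutes strictly and induces a map of cokernels.
  obtain ⟨b₀, hb₀, hb₀'⟩ : ∃ b₀ : Y ⟶ Y', f ≫ b₀ = a₀ ≫ f' ∧
      (toStable S).map b₀ = (toStable S).map b₁ := by
    refine ⟨b₁ - u' ≫ v, ?_, ?_⟩
    · rw [Preadditive.comp_sub, ← Category.assoc, hu', ← huv, sub_sub_cancel]
    · exact toStable_map_eq_of_factor hP (-u') v (by simp)
  obtain ⟨c₀, hc₀⟩ := h.exact.exists_desc hfg (b₀ ≫ g') (by
    rw [← Category.assoc, hb₀, Category.assoc, w', comp_zero])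
  obtain ⟨s, l, hl, hs⟩ := h.exists_induces a₀
  -- `k ≫ l` and `b₀ ≫ k'` agree on `X`, so their difference descends to `m : Z ⟶ I(X')`, through
  -- which the defect of the last square factors.
  obtain ⟨m, hm⟩ := h.exact.exists_desc hfg (k ≫ l - b₀ ≫ k') (by
    rw [Preadditive.comp_sub, reassoc_of% hk, reassoc_of% hb₀, hk', hl, sub_self])
  refine ⟨(toStable S).map c₀, ?_, ?_⟩
  · dsimp only
    rw [← hb₀', ← Functor.map_comp, ← Functor.map_comp, hc₀]
  · dsimp only
    rw [Induces.conn_comp_map (h := h) ⟨l, hl, hs⟩, ← conn_comp]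
    refine h.conn_eq_of_factor (h.projective_I X') (-m) (h.q X') ?_
    rw [← cancel_epi g, Preadditive.comp_sub, reassoc_of% hkr, reassoc_of% hc₀, hkr',
      Preadditive.neg_comp, Preadditive.comp_neg, Preadditive.neg_comp, Preadditive.comp_neg,
      reassoc_of% hm, Category.assoc, hs]
    simp only [Category.assoc, sub_neg_eq_add, Preadditive.sub_comp]
    abel

theorem complete {A B : Tri h.susp} (hA : A ∈ h.dist) (hB : B ∈ h.dist) : A.Completes B := by
  obtain ⟨X, Y, Z, f, g, r, hr, hA⟩ := (h.mem_dist_iff A).1 hA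
  obtain ⟨X', Y', Z', f', g', r', hr', hB⟩ := (h.mem_dist_iff B).1 hB
  exact (hr.completes hr').of_isomorphic hA hB

theorem hasDesc {A : Tri h.susp} (hA : A ∈ h.dist) : A.HasDesc := by
  obtain ⟨X, Y, Z, f, g, r, ⟨⟨w, hfg⟩, -⟩, hA⟩ := (h.mem_dist_iff A).1 hA
  refine Tri.HasDesc.of_isomorphic (fun W φ hφ => ?_) hA
  obtain ⟨φ, rfl⟩ := exists_toStable_map_eq (S := S) (X := Y) (Y := W.as) φ
  have hsq : (toStable S).map (f ≫ φ) = (toStable S).map 0 := by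
    rw [Functor.map_comp, Functor.map_zero]
    exact hφ
  obtain ⟨P, u, v, hP, huv⟩ := exists_factor h.exact hsq
  obtain ⟨u', hu'⟩ := (h.projective_iff_injective P).1 hP f ⟨_, _, _, hfg⟩ u
  obtain ⟨t, ht⟩ := h.exact.exists_desc hfg (φ - u' ≫ v) (by
    rw [Preadditive.comp_sub, ← Category.assoc, hu', ← huv, sub_zero, sub_self])
  refine ⟨(toStable S).map t, ?_⟩
  dsimp only
  refine ((toStable S).map_comp g t).symm.trans ?_
  rw [ht]
  exact toStable_map_eq_of_factor hP (-u') v (by simp)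

/-- As `φ` vanishes on `A.g`, it factors as `A.h ≫ t`, and then `φ ≫ φ = (φ ≫ A.h) ≫ t`. -/
theorem eq_zero_sq {A : Tri h.susp} (hA : A ∈ h.dist) (φ : A.X₃ ⟶ A.X₃) (h₁ : A.g ≫ φ = 0)
    (h₂ : φ ≫ A.h = 0) : φ ≫ φ = 0 := by
  obtain ⟨t, ht⟩ := h.hasDesc (h.rotate_mem_dist hA) φ h₁
  dsimp only at t ht
  nth_rw 2 [← ht]
  rw [reassoc_of% h₂, zero_comp]

theorem isIso_of_endo {A : Tri h.susp} (hA : A ∈ h.dist) (φ : A.X₃ ⟶ A.X₃) (h₁ : A.g ≫ φ = A.g)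
    (h₂ : φ ≫ A.h = A.h) : IsIso φ := by
  have hz := h.eq_zero_sq hA (φ - 𝟙 _) (by simp [h₁]) (by simp [h₂])
  have hz' : φ ≫ φ = φ + φ - 𝟙 _ := by
    simp only [Preadditive.comp_sub, Preadditive.sub_comp, Category.comp_id, Category.id_comp] at hz
    rw [← sub_eq_zero, ← hz]
    abel
  exact ⟨𝟙 _ + 𝟙 _ - φ, by simp [hz'], by simp [hz']⟩

/-- This takes the place of the five lemma and needs no long exact sequences. The completions of the
pair and of its inverse compose to endomorphisms that differ from the identity by a square-zero map
(`isIso_of_endo`), hence are invertible. -/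
theorem exists_iso {A B : Tri h.susp} (hA : A ∈ h.dist) (hB : B ∈ h.dist) (a : A.X₁ ≅ B.X₁)
    (b : A.X₂ ≅ B.X₂) (hab : A.f ≫ b.hom = a.hom ≫ B.f) :
    ∃ c : A.X₃ ≅ B.X₃, A.g ≫ c.hom = b.hom ≫ B.g ∧ A.h ≫ h.susp.map a.hom = c.hom ≫ B.h := by
  obtain ⟨c, h₁, h₂⟩ := h.complete hA hB a.hom b.hom hab
  obtain ⟨d, h₁', h₂'⟩ := h.complete hB hA a.inv b.inv (by
    rw [Iso.comp_inv_eq, Category.assoc, Iso.eq_inv_comp, hab])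
  have i₁ : IsIso (c ≫ d) := h.isIso_of_endo hA _ (by rw [reassoc_of% h₁, h₁',
    Iso.hom_inv_id_assoc]) (by
      rw [Category.assoc, ← h₂', ← reassoc_of% h₂, ← Functor.map_comp, Iso.hom_inv_id,
        CategoryTheory.Functor.map_id, Category.comp_id])
  have i₂ : IsIso (d ≫ c) := h.isIso_of_endo hB _ (by rw [reassoc_of% h₁', h₁,
    Iso.inv_hom_id_assoc]) (by
      rw [Category.assoc, ← h₂, ← reassoc_of% h₂', ← Functor.map_comp, Iso.inv_hom_id,
        CategoryTheory.Functor.map_id, Category.comp_id])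
  have : IsIso c := by
    have : IsSplitMono c := IsSplitMono.mk' ⟨d ≫ inv (c ≫ d), by
      rw [← Category.assoc, IsIso.hom_inv_id]⟩
    have : Epi c := by
      have : Epi (d ≫ c) := inferInstance
      exact epi_of_epi d c
    exact isIso_of_epi_of_isSplitMono c
  exact ⟨asIso c, h₁, h₂⟩

end IsFrobenius

/-! ### The octahedral axiom and Happel's theorem. -/

section Octahedron

variable {T : Type u} [Category.{v} T] {susp : T ⥤ T} {dist : Set (Tri susp)}

/-- The conclusion of the octahedral axiom. -/
def HasOctahedron (dist : Set (Tri susp)) {X₁ X₂ X₃ Z₁₂ Z₂₃ Z₁₃ : T} (u₁₂ : X₁ ⟶ X₂)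
    (u₂₃ : X₂ ⟶ X₃) (v₁₂ : X₂ ⟶ Z₁₂) (w₁₂ : Z₁₂ ⟶ susp.obj X₁) (v₂₃ : X₃ ⟶ Z₂₃)
    (w₂₃ : Z₂₃ ⟶ susp.obj X₂) (v₁₃ : X₃ ⟶ Z₁₃) (w₁₃ : Z₁₃ ⟶ susp.obj X₁) : Prop :=
  ∃ (m₁ : Z₁₂ ⟶ Z₁₃) (m₃ : Z₁₃ ⟶ Z₂₃),
    v₁₂ ≫ m₁ = u₂₃ ≫ v₁₃ ∧ m₁ ≫ w₁₃ = w₁₂ ∧ v₁₃ ≫ m₃ = v₂₃ ∧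
      w₁₃ ≫ susp.map u₁₂ = m₃ ≫ w₂₃ ∧
      (⟨Z₁₂, Z₁₃, Z₂₃, m₁, m₃, w₂₃ ≫ susp.map v₁₂⟩ : Tri susp) ∈ dist

/-- Lets the axiom be checked on convenient representatives, namely compositions of admissible
monics. -/
theorem HasOctahedron.of_iso (hd : ∀ A B : Tri susp, A ∈ dist → A.Isomorphic B → B ∈ dist)
    {X₁ X₂ X₃ Z₁₂ Z₂₃ Z₁₃ : T} {u₁₂ : X₁ ⟶ X₂}
    {u₂₃ : X₂ ⟶ X₃} {v₁₂ : X₂ ⟶ Z₁₂} {w₁₂ : Z₁₂ ⟶ susp.obj X₁} {v₂₃ : X₃ ⟶ Z₂₃}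
    {w₂₃ : Z₂₃ ⟶ susp.obj X₂} {v₁₃ : X₃ ⟶ Z₁₃} {w₁₃ : Z₁₃ ⟶ susp.obj X₁}
    (H : HasOctahedron dist u₁₂ u₂₃ v₁₂ w₁₂ v₂₃ w₂₃ v₁₃ w₁₃)
    {X₁' X₂' X₃' Z₁₂' Z₂₃' Z₁₃' : T} {u₁₂' : X₁' ⟶ X₂'}
    {u₂₃' : X₂' ⟶ X₃'} {v₁₂' : X₂' ⟶ Z₁₂'} {w₁₂' : Z₁₂' ⟶ susp.obj X₁'} {v₂₃' : X₃' ⟶ Z₂₃'}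
    {w₂₃' : Z₂₃' ⟶ susp.obj X₂'} {v₁₃' : X₃' ⟶ Z₁₃'} {w₁₃' : Z₁₃' ⟶ susp.obj X₁'}
    (e₁ : X₁ ≅ X₁') (e₂ : X₂ ≅ X₂') (e₃ : X₃ ≅ X₃') (c₁₂ : Z₁₂ ≅ Z₁₂') (c₂₃ : Z₂₃ ≅ Z₂₃')
    (c₁₃ : Z₁₃ ≅ Z₁₃') (h₁₂ : u₁₂ ≫ e₂.hom = e₁.hom ≫ u₁₂')
    (h₂₃ : u₂₃ ≫ e₃.hom = e₂.hom ≫ u₂₃') (k₁₂ : v₁₂ ≫ c₁₂.hom = e₂.hom ≫ v₁₂')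
    (l₁₂ : w₁₂ ≫ susp.map e₁.hom = c₁₂.hom ≫ w₁₂')
    (k₂₃ : v₂₃ ≫ c₂₃.hom = e₃.hom ≫ v₂₃')
    (l₂₃ : w₂₃ ≫ susp.map e₂.hom = c₂₃.hom ≫ w₂₃')
    (k₁₃ : v₁₃ ≫ c₁₃.hom = e₃.hom ≫ v₁₃')
    (l₁₃ : w₁₃ ≫ susp.map e₁.hom = c₁₃.hom ≫ w₁₃') :
    HasOctahedron dist u₁₂' u₂₃' v₁₂' w₁₂' v₂₃' w₂₃' v₁₃' w₁₃' := by
  obtain ⟨m₁, m₃, H₁, H₂, H₃, H₄, H₅⟩ := H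
  refine ⟨c₁₂.inv ≫ m₁ ≫ c₁₃.hom, c₁₃.inv ≫ m₃ ≫ c₂₃.hom, ?_, ?_, ?_, ?_, hd _ _ H₅
    ⟨c₁₂, c₁₃, c₂₃, by simp, by simp, ?_⟩⟩
  · rw [← cancel_epi e₂.hom, ← reassoc_of% k₁₂, Iso.hom_inv_id_assoc, reassoc_of% H₁, k₁₃,
      ← reassoc_of% h₂₃]
  · rw [← cancel_epi c₁₂.hom, ← l₁₂]
    simp only [Category.assoc, Iso.hom_inv_id_assoc]
    rw [← l₁₃, reassoc_of% H₂]
  · rw [← cancel_epi e₃.hom, ← reassoc_of% k₁₃, Iso.hom_inv_id_assoc, reassoc_of% H₃, k₂₃]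
  · rw [← cancel_epi c₁₃.hom, ← reassoc_of% l₁₃]
    simp only [Category.assoc, Iso.hom_inv_id_assoc]
    rw [← l₂₃, ← reassoc_of% H₄, ← Functor.map_comp, ← Functor.map_comp, h₁₂]
  · simp only [Category.assoc]
    rw [← reassoc_of% l₂₃, ← Functor.map_comp, ← Functor.map_comp, k₁₂]

end Octahedron

namespace IsFrobenius

variable {C : Type u} [Category.{v} C] [Preadditive C] {S : ObjectProperty (ShortComplex C)}

/-- Comparison of the cokernels of two admissible monics into projective objects. -/
theorem cosyzygy_comp_eq_id (h : IsFrobenius S) {K P Z P' Z' : C} {i : K ⟶ P} {p : P ⟶ Z} {w : i ≫ p = 0}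
    (hip : S (.mk i p w)) {i' : K ⟶ P'} {p' : P' ⟶ Z'} (hP : IsProjective S P)
    {k : P ⟶ P'} {l : P' ⟶ P} (hk : i ≫ k = i') (hl : i' ≫ l = i) {s : Z ⟶ Z'} {t : Z' ⟶ Z}
    (hs : p ≫ s = k ≫ p') (ht : p' ≫ t = l ≫ p) :
    (toStable S).map s ≫ (toStable S).map t = 𝟙 _ := by
  have := h.exact.epi_g hip
  obtain ⟨m, hm⟩ := h.exact.exists_desc hip (k ≫ l - 𝟙 _) (by simp [reassoc_of% hk, hl])
  rw [← Functor.map_comp, ← CategoryTheory.Functor.map_id]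
  refine toStable_map_eq_of_factor hP m p ?_
  rw [← cancel_epi p, reassoc_of% hm, Preadditive.comp_sub, reassoc_of% hs, ht]
  simp

/-- The stable form of Schanuel's lemma. It yields both the essential surjectivity of the suspension
and its compatibility with exact functors. -/
theorem exists_cosyzygy_iso (h : IsFrobenius S) {K P Z P' Z' : C} {i : K ⟶ P} {p : P ⟶ Z} {w : i ≫ p = 0}
    (hip : S (.mk i p w)) {i' : K ⟶ P'} {p' : P' ⟶ Z'} {w' : i' ≫ p' = 0}
    (hip' : S (.mk i' p' w')) (hP : IsProjective S P) (hP' : IsProjective S P') :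
    ∃ (k : P ⟶ P') (s : Z ⟶ Z') (e : (toStable S).obj Z ≅ (toStable S).obj Z'),
      i ≫ k = i' ∧ p ≫ s = k ≫ p' ∧ e.hom = (toStable S).map s := by
  obtain ⟨k, hk⟩ := (h.projective_iff_injective _).1 hP' i ⟨_, _, _, hip⟩ i'
  obtain ⟨l, hl⟩ := (h.projective_iff_injective _).1 hP i' ⟨_, _, _, hip'⟩ i
  obtain ⟨s, hs⟩ := h.exact.exists_desc hip (k ≫ p') (by rw [← Category.assoc, hk, w'])
  obtain ⟨t, ht⟩ := h.exact.exists_desc hip' (l ≫ p) (by rw [← Category.assoc, hl, w])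
  exact ⟨k, s, ⟨(toStable S).map s, (toStable S).map t,
    h.cosyzygy_comp_eq_id hip hP hk hl hs ht, h.cosyzygy_comp_eq_id hip' hP' hl hk ht hs⟩,
    hk, hs, rfl⟩

/-- Faithfulness of the suspension. If `s = a ≫ b` through a projective, lift `b` to `b'` along `h.q
Y`; then `k - h.q X ≫ a ≫ b'` lands in `Y` and extends `f` to `I(X)`. -/
theorem Induces.mem_projIdeal {h : IsFrobenius S} {X Y : C} {f : X ⟶ Y} {s} (hf : h.Induces f s)
    (hs : s ∈ projIdeal S (h.suspObj X) (h.suspObj Y)) : f ∈ projIdeal S X Y := by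
  obtain ⟨P, a, b, hP, rfl⟩ := (mem_projIdeal_iff h.exact _).1 hs
  obtain ⟨k, hk, hk'⟩ := hf
  obtain ⟨b', hb'⟩ := hP (h.q Y) ⟨_, _, _, h.conflation Y⟩ b
  obtain ⟨l, hl⟩ := h.exact.exists_lift (h.conflation Y) (k - h.q X ≫ a ≫ b') (by simp [hb', hk'])
  have := h.exact.mono_f (h.conflation Y)
  refine AddSubgroup.subset_closure ⟨h.I X, h.i X, l, h.projective_I X, ?_⟩
  rw [← cancel_mono (h.i Y), Category.assoc, hl, Preadditive.comp_sub, hk, reassoc_of% h.i_q X]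
  simp

theorem susp_isEquivalence (h : IsFrobenius S) : h.susp.IsEquivalence where
  faithful := ⟨fun {X Y f g} hfg => by
    obtain ⟨f, rfl⟩ := (toStable S).map_surjective (X := X.as) (Y := Y.as) f
    obtain ⟨g, rfl⟩ := (toStable S).map_surjective (X := X.as) (Y := Y.as) g
    obtain ⟨s, hs⟩ := h.exists_induces f
    obtain ⟨t, ht⟩ := h.exists_induces g
    rw [hs.map_eq_conn, ht.map_eq_conn] at hfg
    exact (toStable_map_eq_iff _ _).2 ((hs.sub ht).mem_projIdeal ((toStable_map_eq_iff _ _).1 hfg))⟩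
  full := ⟨fun {X Y} φ => by
    obtain ⟨s, hs⟩ := (toStable S).map_surjective (X := h.suspObj X.as) (Y := h.suspObj Y.as) φ
    obtain ⟨k, hk⟩ := h.projective_I X.as (h.q Y.as) ⟨_, _, _, h.conflation Y.as⟩ (h.q X.as ≫ s)
    obtain ⟨f, hf⟩ := h.exact.exists_lift (h.conflation Y.as) (h.i X.as ≫ k) (by
      rw [Category.assoc, hk, ← Category.assoc, h.i_q, zero_comp])
    exact ⟨(toStable S).map f, (Induces.map_eq_conn (h := h) ⟨k, hf.symm, hk.symm⟩).trans hs⟩⟩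
  essSurj := ⟨fun Z => by
    -- The kernel `K` of a projective cover of `Z` is a desuspension of `Z`, since `P` is also
    -- injective.
    obtain ⟨P, p, hP, K, i, w, hip⟩ := h.enoughProjectives Z.as
    obtain ⟨-, -, e, -, -, -⟩ := h.exists_cosyzygy_iso (h.conflation K) hip (h.projective_I K) hP
    exact ⟨(toStable S).obj K, ⟨e⟩⟩⟩

/-- Complete `A.f` to a distinguished triangle. Its threefold rotation and that of `A` are both
distinguished and begin with the same morphism `-Σ A.f`, so `exists_iso` compares their third
objects; full faithfulness of the suspension brings the comparison back. -/
theorem mem_dist_of_rotate (h : IsFrobenius S) {A : Tri h.susp} (hA : A.rotate ∈ h.dist) : A ∈ h.dist := by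
  have := h.susp_isEquivalence
  obtain ⟨Z, g, r, hT⟩ := h.exists_triangle A.f
  have h₁ := h.rotate_mem_dist (h.rotate_mem_dist (h.rotate_mem_dist hT))
  have h₂ := h.rotate_mem_dist (h.rotate_mem_dist hA)
  obtain ⟨c, hc, hc'⟩ := h.exists_iso h₁ h₂ (Iso.refl _) (Iso.refl _) (by simp)
  refine h.dist_of_isomorphic hT ⟨Iso.refl _, Iso.refl _, h.susp.preimageIso c, ?_, ?_, ?_⟩
  · simp
  · apply h.susp.map_injective
    simpa using hc
  · apply h.susp.map_injective
    simpa using hc'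

/-- In the stable category, adding an injective object changes nothing. -/
theorem exists_iso_of_injective_biprod (h : IsFrobenius S) [HasBinaryBiproducts C] {J : C} (hJ : IsInjective S J)
    (X : C) : ∃ e : (toStable S).obj (J ⊞ X) ≅ (toStable S).obj X,
      e.hom = (toStable S).map biprod.snd := by
  refine ⟨⟨(toStable S).map biprod.snd, (toStable S).map biprod.inr, ?_, ?_⟩, rfl⟩
  · rw [← Functor.map_comp, ← CategoryTheory.Functor.map_id]
    exact toStable_map_eq_of_factor ((h.projective_iff_injective _).2 hJ) (-biprod.fst) biprod.inl
      (by ext <;> simp)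
  · rw [← Functor.map_comp, biprod.inr_snd, CategoryTheory.Functor.map_id]

/-- The octahedron of a composition of admissible monics. -/
theorem exists_octahedron_of_mono (h : IsFrobenius S) {X₁ X₂ X₃ : C} {i : X₁ ⟶ X₂} {j : X₂ ⟶ X₃}
    (hi : AdmissibleMono S i) (hj : AdmissibleMono S j) :
    ∃ (A B D : C) (p : X₂ ⟶ A) (q : X₃ ⟶ B) (r : X₃ ⟶ D) (w₁₂ : A ⟶ h.suspObj X₁)
      (w₂₃ : B ⟶ h.suspObj X₂) (w₁₃ : D ⟶ h.suspObj X₁),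
      h.Connecting i p w₁₂ ∧ h.Connecting j q w₂₃ ∧ h.Connecting (i ≫ j) r w₁₃ ∧
        HasOctahedron h.dist ((toStable S).map i) ((toStable S).map j) ((toStable S).map p)
          (h.conn w₁₂) ((toStable S).map q) (h.conn w₂₃) ((toStable S).map r) (h.conn w₁₃) := by
  obtain ⟨A, p, wp, hp⟩ := hi
  obtain ⟨B, q, wq, hq⟩ := hj
  obtain ⟨D, r, wr, hr⟩ := h.exact.comp_mono i j ⟨_, _, _, hp⟩ ⟨_, _, _, hq⟩
  have := h.exact.epi_g hp
  have := h.exact.epi_g hr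
  obtain ⟨a, ha⟩ := h.exact.exists_desc hp (j ≫ r) (by rw [← Category.assoc, wr])
  obtain ⟨b, hb⟩ := h.exact.exists_desc hr q (by rw [Category.assoc, wq, comp_zero])
  obtain ⟨wab, hab⟩ := h.exact.conflation_of_comp hp hq hr ha hb
  obtain ⟨w₁₃, ⟨-, k₁₃, hk₁₃, hw₁₃⟩⟩ := h.exists_connecting hr
  obtain ⟨w₂₃, ⟨-, k₂₃, hk₂₃, hw₂₃⟩⟩ := h.exists_connecting hq
  obtain ⟨s, l, hl, hs⟩ := h.exists_induces i
  obtain ⟨t, l', hl', ht⟩ := h.exists_induces p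
  -- `m` witnesses that the square with the two connecting morphisms commutes stably, while the `k`
  -- obtained next extends `h.i A` along `a` and identifies the connecting morphism of `A ↣ D ↠ B`.
  obtain ⟨m, hm⟩ := h.exact.exists_desc hr (k₁₃ ≫ l - k₂₃) (by
    rw [Preadditive.comp_sub, ← Category.assoc, hk₁₃, hl, Category.assoc, hk₂₃, sub_self])
  obtain ⟨k, hk⟩ := h.exact.exists_desc hr (k₂₃ ≫ l') (by
    rw [Category.assoc, reassoc_of% hk₂₃, hl', reassoc_of% wp, zero_comp])
  refine ⟨A, B, D, p, q, r, a ≫ w₁₃, w₂₃, w₁₃, ⟨⟨_, hp⟩, j ≫ k₁₃, by simpa using hk₁₃, ?_⟩,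
    ⟨⟨_, hq⟩, k₂₃, hk₂₃, hw₂₃⟩, ⟨⟨_, hr⟩, k₁₃, hk₁₃, hw₁₃⟩, (toStable S).map a,
    (toStable S).map b, ?_, ?_, ?_, ?_, ?_⟩
  · rw [reassoc_of% ha, hw₁₃]
    simp
  · rw [← Functor.map_comp, ← Functor.map_comp, ha]
  · rw [← conn_comp]
  · rw [← Functor.map_comp, hb]
  · rw [Induces.conn_comp_map (h := h) ⟨l, hl, hs⟩, ← conn_comp]
    refine h.conn_eq_of_factor (h.projective_I X₂) (-m) (h.q X₂) ?_
    rw [← cancel_epi r, Preadditive.comp_sub, reassoc_of% hw₁₃, reassoc_of% hb, hw₂₃,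
      Preadditive.neg_comp, Preadditive.neg_comp, Preadditive.comp_neg, reassoc_of% hm,
      Category.assoc, hs]
    simp only [sub_neg_eq_add, Preadditive.sub_comp, Category.assoc]
    abel
  · rw [Induces.conn_comp_map (h := h) ⟨l', hl', ht⟩]
    refine Connecting.mem_dist (h := h) ⟨⟨wab, hab⟩, k, ?_, ?_⟩
    · rw [← cancel_epi p, reassoc_of% ha, hk, reassoc_of% hk₂₃, hl']
    · rw [← cancel_epi r, reassoc_of% hb, reassoc_of% hw₂₃, Preadditive.comp_neg,
        reassoc_of% hk, ← ht]
      simp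

theorem octahedral (h : IsFrobenius S) ⦃X₁ X₂ X₃ Z₁₂ Z₂₃ Z₁₃ : StableCategory S⦄ (u₁₂ : X₁ ⟶ X₂) (u₂₃ : X₂ ⟶ X₃)
    (v₁₂ : X₂ ⟶ Z₁₂) (w₁₂ : Z₁₂ ⟶ h.susp.obj X₁) (v₂₃ : X₃ ⟶ Z₂₃) (w₂₃ : Z₂₃ ⟶ h.susp.obj X₂)
    (v₁₃ : X₃ ⟶ Z₁₃) (w₁₃ : Z₁₃ ⟶ h.susp.obj X₁)
    (h₁₂ : (⟨X₁, X₂, Z₁₂, u₁₂, v₁₂, w₁₂⟩ : Tri h.susp) ∈ h.dist)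
    (h₂₃ : (⟨X₂, X₃, Z₂₃, u₂₃, v₂₃, w₂₃⟩ : Tri h.susp) ∈ h.dist)
    (h₁₃ : (⟨X₁, X₃, Z₁₃, u₁₂ ≫ u₂₃, v₁₃, w₁₃⟩ : Tri h.susp) ∈ h.dist) :
    HasOctahedron h.dist u₁₂ u₂₃ v₁₂ w₁₂ v₂₃ w₂₃ v₁₃ w₁₃ := by
  have := h.exact.hasBinaryBiproducts
  obtain ⟨f, rfl⟩ := (toStable S).map_surjective (X := X₁.as) (Y := X₂.as) u₁₂
  obtain ⟨g, rfl⟩ := (toStable S).map_surjective (X := X₂.as) (Y := X₃.as) u₂₃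
  have key : ∀ {X Y : C} (f : X ⟶ Y), AdmissibleMono S (biprod.lift (h.i X) f) := fun f => by
    obtain ⟨Z, f', g, r, sq, -, -⟩ := h.exists_isPushout f
    exact ⟨_, _, _, h.exact.conflation_of_isPushout (h.admissibleMono_i _) sq⟩
  -- Both morphisms are replaced by admissible monics. The second must start at `I(X₁) ⊞ X₂`, hence
  -- the precomposition of `g` with `biprod.snd`.
  obtain ⟨A, B, D, p, q, r, w₁₂', w₂₃', w₁₃', H₁₂, H₂₃, H₁₃, H⟩ :=
    h.exists_octahedron_of_mono (key f) (key (biprod.snd (X := h.I X₁.as) ≫ g))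
  obtain ⟨e₂, he₂⟩ := h.exists_iso_of_injective_biprod (h.injective_I X₁.as) X₂.as
  obtain ⟨e₃, he₃⟩ := h.exists_iso_of_injective_biprod
    (h.injective_I (h.I X₁.as ⊞ X₂.as)) X₃.as
  have c₁ : (toStable S).map (biprod.lift (h.i X₁.as) f) ≫ e₂.hom = (toStable S).map f := by
    rw [he₂, ← Functor.map_comp, biprod.lift_snd]
  have c₂ : (toStable S).map (biprod.lift (h.i (h.I X₁.as ⊞ X₂.as)) (biprod.snd ≫ g)) ≫ e₃.hom =
      e₂.hom ≫ (toStable S).map g := by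
    rw [he₂, he₃, ← Functor.map_comp, ← Functor.map_comp, biprod.lift_snd]
  obtain ⟨c₁₂, k₁₂, l₁₂⟩ := h.exists_iso H₁₂.mem_dist h₁₂ (Iso.refl _) e₂ (by simpa using c₁)
  obtain ⟨c₂₃, k₂₃, l₂₃⟩ := h.exists_iso H₂₃.mem_dist h₂₃ e₂ e₃ c₂
  obtain ⟨c₁₃, k₁₃, l₁₃⟩ := h.exists_iso H₁₃.mem_dist h₁₃ (Iso.refl _) e₃ (by
    dsimp only
    rw [Functor.map_comp, Category.assoc, c₂, reassoc_of% c₁]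
    exact (Category.id_comp _).symm)
  exact H.of_iso (fun A B hA hAB => h.dist_of_isomorphic hA hAB) (Iso.refl _) e₂ e₃ c₁₂ c₂₃ c₁₃
    (by rw [c₁]; exact (Category.id_comp _).symm) c₂ k₁₂ l₁₂ k₂₃ l₂₃ k₁₃ l₁₃

theorem hasBinaryBiproducts_stableCategory [HasBinaryBiproducts C] :
    HasBinaryBiproducts (StableCategory S) where
  has_binary_biproduct X Y := by
    have := preservesBinaryBiproducts_of_preservesBiproducts (toStable S)
    have : HasBinaryBiproduct ((toStable S).obj X.as) ((toStable S).obj Y.as) :=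
      HasBinaryBiproduct.mk ⟨(toStable S).mapBinaryBicone (BinaryBiproduct.bicone X.as Y.as),
        isBinaryBilimitOfPreserves (toStable S) (BinaryBiproduct.isBilimit X.as Y.as)⟩
    exact this

theorem hasZeroObject_stableCategory [HasZeroObject C] : HasZeroObject (StableCategory S) :=
  ⟨(toStable S).obj (HasZeroObject.zero' C).zero, (toStable S).map_isZero (isZero_zero C)⟩

/-- Happel's theorem: the stable category of a Frobenius category is triangulated. -/
theorem isTriangulatedCategory (h : IsFrobenius S) : IsTriangulatedCategory h.susp h.dist where
  hasZeroObject := by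
    have := h.exact.hasZeroObject
    exact hasZeroObject_stableCategory
  hasBinaryBiproducts := by
    have := h.exact.hasBinaryBiproducts
    exact hasBinaryBiproducts_stableCategory
  additive := inferInstance
  isEquivalence := h.susp_isEquivalence
  isomorphic A B := h.dist_of_isomorphic
  contractible X Z hZ := by
    obtain ⟨O, hO⟩ := h.exact.hasZeroObject.zero
    obtain ⟨r, hr⟩ := h.exists_connecting (h.exact.conflation_id_zero X.as hO)
    have hO' : IsZero ((toStable S).obj O) := (toStable S).map_isZero hO
    refine h.dist_of_isomorphic hr.mem_dist ⟨Iso.refl _, Iso.refl _, hO'.iso hZ, ?_, ?_, ?_⟩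
    · simp only [CategoryTheory.Functor.map_id, Iso.refl_hom]
      rfl
    · exact hZ.eq_of_tgt _ _
    · exact hO'.eq_of_src _ _
  exists_triangle X Y f := h.exists_triangle f
  rotate_iff A := ⟨h.rotate_mem_dist, h.mem_dist_of_rotate⟩
  complete A B hA hB := h.complete hA hB
  octahedral := h.octahedral

end IsFrobenius

/-! ### Extension-closed and sub-Frobenius subcategories. -/

section FullSubcategories

variable {C : Type u} [Category.{v} C] [Preadditive C] {S : ObjectProperty (ShortComplex C)}

theorem nonempty_isLimit_kernelFork {X Y Z : C} {f : X ⟶ Y} {g : Y ⟶ Z} (w : f ≫ g = 0) [Mono f]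
    (hl : ∀ ⦃W : C⦄ (k : W ⟶ Y), k ≫ g = 0 → ∃ t, t ≫ f = k) :
    Nonempty (IsLimit (KernelFork.ofι f w)) := by
  choose l hl using hl
  exact ⟨KernelFork.IsLimit.ofι f w (fun k hk => l k hk) (fun k hk => hl k hk)
    fun k hk m hm => by rw [← cancel_mono f, hm, hl]⟩

theorem nonempty_isColimit_cokernelCofork {X Y Z : C} {f : X ⟶ Y} {g : Y ⟶ Z} (w : f ≫ g = 0)
    [Epi g] (hl : ∀ ⦃W : C⦄ (k : Y ⟶ W), f ≫ k = 0 → ∃ t, g ≫ t = k) :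
    Nonempty (IsColimit (CokernelCofork.ofπ g w)) := by
  choose l hl using hl
  exact ⟨CokernelCofork.IsColimit.ofπ g w (fun k hk => l k hk) (fun k hk => hl k hk)
    fun k hk m hm => by rw [← cancel_epi g, hm, hl]⟩

variable {P : ObjectProperty C}

theorem AdmissibleMono.of_induced {X Y : P.FullSubcategory} {i : X ⟶ Y}
    (hi : AdmissibleMono (induced S P) i) : AdmissibleMono S i.hom := by
  obtain ⟨Z, p, w, h⟩ := hi
  exact ⟨Z.obj, p.hom, _, h⟩

theorem AdmissibleEpi.of_induced {X Y : P.FullSubcategory} {i : X ⟶ Y}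
    (hi : AdmissibleEpi (induced S P) i) : AdmissibleEpi S i.hom := by
  obtain ⟨Z, p, w, h⟩ := hi
  exact ⟨Z.obj, p.hom, _, h⟩

theorem IsExtensionClosed.prop_biprod (hS : IsExactCategory S) (hP : IsExtensionClosed S P)
    [HasBinaryBiproducts C] {X Y : C} (hX : P X) (hY : P Y) : P (X ⊞ Y) :=
  hP (.mk biprod.inl biprod.snd (by simp)) (hS.of_splitting
    { r := biprod.fst, s := biprod.inr }) hX hY

/-- An extension-closed full subcategory containing a zero object is an exact category. -/
theorem IsExtensionClosed.isExactCategory (hS : IsExactCategory S) (hP : IsExtensionClosed S P)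
    (hP₀ : ∃ Z, IsZero Z ∧ P Z) : IsExactCategory (induced S P) := by
  have := hS.hasBinaryBiproducts
  obtain ⟨O, hO, hPO⟩ := hP₀
  have hO' : IsZero (⟨O, hPO⟩ : P.FullSubcategory) :=
    IsZero.of_full_of_faithful_of_isZero P.ι _ hO
  have hiso : ∀ T T' : ShortComplex P.FullSubcategory, (T ≅ T') → induced S P T →
      induced S P T' := fun T T' e hT => by
    have := hS.closedUnderIso
    exact S.prop_of_iso (P.ι.mapShortComplex.mapIso e) hT
  refine
    { hasZeroObject := ⟨_, hO'⟩
      hasBinaryBiproducts := ⟨fun X Y => ?_⟩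
      closedUnderIso := ⟨fun {T T'} e hT => hiso T T' e hT⟩
      kernel := fun T hT => ?_
      cokernel := fun T hT => ?_
      id_mono := fun X => ⟨⟨O, hPO⟩, 0, by simp, hS.conflation_id_zero X.obj hO⟩
      id_epi := fun X => ⟨⟨O, hPO⟩, 0, by simp, hS.conflation_zero_id X.obj hO⟩
      comp_mono := ?_
      comp_epi := ?_
      hasPushout := ?_
      pushout := ?_
      hasPullback := ?_
      pullback := ?_ }
  · exact HasBinaryBiproduct.mk ⟨{
      pt := ⟨X.obj ⊞ Y.obj, hP.prop_biprod hS X.property Y.property⟩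
      inl := ObjectProperty.homMk biprod.inl
      inr := ObjectProperty.homMk biprod.inr
      fst := ObjectProperty.homMk biprod.fst
      snd := ObjectProperty.homMk biprod.snd }, isBinaryBilimitOfTotal _
        (ObjectProperty.hom_ext _ biprod.total)⟩
  · have : Mono T.f.hom := hS.mono_f hT
    have : Mono T.f := P.ι.mono_of_mono_map this
    refine nonempty_isLimit_kernelFork T.zero fun W k hk => ?_
    obtain ⟨t, ht⟩ := hS.exists_lift hT k.hom (congrArg (fun k => k.hom) hk)
    exact ⟨ObjectProperty.homMk t, by ext; exact ht⟩
  · have : Epi T.g.hom := hS.epi_g hT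
    have : Epi T.g := P.ι.epi_of_epi_map this
    refine nonempty_isColimit_cokernelCofork T.zero fun W k hk => ?_
    obtain ⟨t, ht⟩ := hS.exists_desc hT k.hom (congrArg (fun k => k.hom) hk)
    exact ⟨ObjectProperty.homMk t, by ext; exact ht⟩
  · rintro X Y Z i j ⟨A, p, wp, hp⟩ ⟨B, q, wq, hq⟩
    obtain ⟨D, r, wr, hr⟩ := hS.comp_mono i.hom j.hom ⟨_, _, _, hp⟩ ⟨_, _, _, hq⟩
    obtain ⟨a, ha⟩ := hS.exists_desc hp (j.hom ≫ r) (by rw [← Category.assoc, wr])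
    have wq' : j.hom ≫ q.hom = 0 := congrArg (fun k => k.hom) wq
    obtain ⟨b, hb⟩ := hS.exists_desc hr q.hom (by rw [Category.assoc, wq', comp_zero])
    -- The cokernel of the composition is an extension of the two cokernels, so it lies in `P`.
    obtain ⟨wab, hab⟩ := hS.conflation_of_comp hp hq hr ha hb
    exact ⟨⟨D, hP _ hab A.property B.property⟩, ObjectProperty.homMk r, by ext; exact wr, hr⟩
  · rintro X Y Z p q ⟨A, i, wi, hi⟩ ⟨B, j, wj, hj⟩
    obtain ⟨D, k, wk, hk⟩ := hS.comp_epi p.hom q.hom ⟨_, _, _, hi⟩ ⟨_, _, _, hj⟩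
    have wi' : i.hom ≫ p.hom = 0 := congrArg (fun k => k.hom) wi
    have wj' : j.hom ≫ q.hom = 0 := congrArg (fun k => k.hom) wj
    have mi : Mono i.hom := hS.mono_f hi
    have mj : Mono j.hom := hS.mono_f hj
    have mk : Mono k := hS.mono_f hk
    obtain ⟨b, hb⟩ := hS.exists_lift hj (k ≫ p.hom) (by rw [Category.assoc, wk])
    obtain ⟨a, ha⟩ := hS.exists_lift hk i.hom (by rw [← Category.assoc, wi', zero_comp])
    have hex : ∀ c : PullbackCone p.hom j.hom, ∃ t, t ≫ k = c.fst := fun c =>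
      hS.exists_lift hk _ (by rw [← Category.assoc, c.condition, Category.assoc, wj', comp_zero])
    choose t ht using hex
    -- The kernel of `p ≫ q` is the preimage under `p` of the kernel of `q`; pulling back the
    -- conflation of `p` makes it an extension of the two kernels.
    have sq : IsPullback k b p.hom j.hom := ⟨⟨hb.symm⟩, ⟨PullbackCone.IsLimit.mk _ t ht (fun c => by
      rw [← cancel_mono j.hom, Category.assoc, hb, ← Category.assoc, ht, c.condition])
      fun c m h _ => by rw [← cancel_mono k, h, ht]⟩⟩
    have hab := hS.pullback_conflation hi sq ha (by
      rw [← cancel_mono j.hom, Category.assoc, hb, ← Category.assoc, ha, wi', zero_comp])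
    exact ⟨⟨D, hP _ hab A.property B.property⟩, ObjectProperty.homMk k, by ext; exact wk, hk⟩
  all_goals
    -- A pushout keeps the cokernel `Q`, so the pushout object is an extension of `Q` by `Z` and
    -- stays in `P`; dually for pullbacks.
    have push : ∀ ⦃X Y Z : P.FullSubcategory⦄ (i : X ⟶ Y) (f : X ⟶ Z),
        AdmissibleMono (induced S P) i → ∃ (W : P.FullSubcategory) (f' : Y ⟶ W) (i' : Z ⟶ W),
          IsPushout i f f' i' ∧ AdmissibleMono (induced S P) i' := by
      rintro X Y Z i f ⟨Q, p, w, hip⟩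
      have w' : i.hom ≫ p.hom = 0 := congrArg (fun k => k.hom) w
      have := hS.hasPushout i.hom f.hom ⟨_, _, _, hip⟩
      have sq := IsPushout.of_hasPushout i.hom f.hom
      have hp := hS.pushout_conflation hip sq (p' := pushout.desc p.hom 0 (by rw [w', comp_zero]))
        (pushout.inl_desc _ _ _) (pushout.inr_desc _ _ _)
      have sq' : IsPushout i f (ObjectProperty.homMk (pushout.inl i.hom f.hom) :
          Y ⟶ ⟨_, hP _ hp Z.property Q.property⟩) (ObjectProperty.homMk (pushout.inr i.hom f.hom)) :=
        IsPushout.of_map P.ι (by ext; exact sq.w) sq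
      exact ⟨_, _, _, sq', Q, ObjectProperty.homMk (pushout.desc p.hom 0 (by rw [w', comp_zero])),
        by ext; exact pushout.inr_desc _ _ _, hp⟩
    have pull : ∀ ⦃X Y Z : P.FullSubcategory⦄ (p : X ⟶ Z) (f : Y ⟶ Z),
        AdmissibleEpi (induced S P) p → ∃ (W : P.FullSubcategory) (f' : W ⟶ X) (p' : W ⟶ Y),
          IsPullback f' p' p f ∧ AdmissibleEpi (induced S P) p' := by
      rintro X Y Z p f ⟨K, i, w, hip⟩
      have w' : i.hom ≫ p.hom = 0 := congrArg (fun k => k.hom) w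
      have := hS.hasPullback p.hom f.hom ⟨_, _, _, hip⟩
      have sq := IsPullback.of_hasPullback p.hom f.hom
      have hp := hS.pullback_conflation hip sq
        (i' := pullback.lift i.hom 0 (by rw [w', zero_comp]))
        (pullback.lift_fst _ _ _) (pullback.lift_snd _ _ _)
      have sq' : IsPullback (ObjectProperty.homMk (pullback.fst p.hom f.hom) :
          (⟨_, hP _ hp K.property Y.property⟩ : P.FullSubcategory) ⟶ X)
          (ObjectProperty.homMk (pullback.snd p.hom f.hom)) p f :=
        IsPullback.of_map P.ι (by ext; exact sq.w) sq
      exact ⟨_, _, _, sq', K, ObjectProperty.homMk (pullback.lift i.hom 0 (by rw [w', zero_comp])),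
        by ext; exact pullback.lift_snd _ _ _, hp⟩
  · intro X Y Z i f hi
    obtain ⟨W, f', i', sq, -⟩ := push i f hi
    exact sq.hasPushout
  · intro X Y Z W i f f' i' hi sq
    obtain ⟨W', f'', i'', sq', Q, p, w, h⟩ := push i f hi
    have w' : i' ≫ (sq.isoIsPushout _ _ sq').hom ≫ p = 0 := by simp [w]
    refine ⟨Q, (sq.isoIsPushout _ _ sq').hom ≫ p, w', hiso (.mk i'' p w) (.mk i' _ w')
      (ShortComplex.isoMk (Iso.refl _) (sq.isoIsPushout _ _ sq').symm (Iso.refl _) ?_ ?_) h⟩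
    · simp
    · simp
  · intro X Y Z p f hp
    obtain ⟨W, f', i', sq, -⟩ := pull p f hp
    exact sq.hasPullback
  · intro W X Y Z f' p' p f hp sq
    obtain ⟨W', f'', p'', sq', K, i, w, h⟩ := pull p f hp
    have w' : (i ≫ (sq.isoIsPullback _ _ sq').inv) ≫ p' = 0 := by simp [w]
    refine ⟨K, i ≫ (sq.isoIsPullback _ _ sq').inv, w', hiso (.mk i p'' w) (.mk _ p' w')
      (ShortComplex.isoMk (Iso.refl _) (sq.isoIsPullback _ _ sq').symm (Iso.refl _) ?_ ?_) h⟩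
    · simp
    · simp

theorem IsProjective.of_retract {X Q : C} (hQ : IsProjective S Q) (s : X ⟶ Q) (p : Q ⟶ X)
    (hsp : s ≫ p = 𝟙 X) : IsProjective S X := fun A B q hq f => by
  obtain ⟨g, hg⟩ := hQ q hq (p ≫ f)
  exact ⟨s ≫ g, by rw [Category.assoc, hg, ← Category.assoc, hsp, Category.id_comp]⟩

theorem IsInjective.of_retract {X Q : C} (hQ : IsInjective S Q) (s : X ⟶ Q) (p : Q ⟶ X)
    (hsp : s ≫ p = 𝟙 X) : IsInjective S X := fun A B q hq f => by
  obtain ⟨g, hg⟩ := hQ q hq (f ≫ s)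
  exact ⟨g ≫ p, by rw [← Category.assoc, hg, Category.assoc, hsp, Category.comp_id]⟩

theorem IsProjective.induced {X : P.FullSubcategory} (hX : IsProjective S X.obj) :
    IsProjective (induced S P) X := fun A B q hq f => by
  obtain ⟨g, hg⟩ := hX q.hom hq.of_induced f.hom
  exact ⟨ObjectProperty.homMk g, by ext; exact hg⟩

theorem IsInjective.induced {X : P.FullSubcategory} (hX : IsInjective S X.obj) :
    IsInjective (induced S P) X := fun A B q hq f => by
  obtain ⟨g, hg⟩ := hX q.hom hq.of_induced f.hom
  exact ⟨ObjectProperty.homMk g, by ext; exact hg⟩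

/-- A projective of the subcategory splits off an ambient projective mapping onto it. This is why
inclusions preserve projectives and why the stable categories embed. -/
theorem IsSubFrobenius.isProjective_iff (h : IsSubFrobenius S P) (X : P.FullSubcategory) :
    IsProjective (induced S P) X ↔ IsProjective S X.obj := by
  refine ⟨fun hX => ?_, fun hX => hX.induced⟩
  obtain ⟨Q, p, hQ, hp⟩ := h.enoughProjectives X
  obtain ⟨s, hs⟩ := hX p hp (𝟙 X)
  exact hQ.of_retract s.hom p.hom (congrArg (fun k => k.hom) hs)

theorem IsSubFrobenius.isInjective_iff (h : IsSubFrobenius S P) (X : P.FullSubcategory) :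
    IsInjective (NCplx.induced S P) X ↔ IsInjective S X.obj := by
  refine ⟨fun hX => ?_, fun hX => hX.induced⟩
  obtain ⟨Q, i, hQ, hi⟩ := h.enoughInjectives X
  obtain ⟨p, hp⟩ := hX i hi (𝟙 X)
  exact hQ.of_retract i.hom p.hom (congrArg (fun k => k.hom) hp)

theorem IsSubFrobenius.isFrobenius (h : IsSubFrobenius S P) : IsFrobenius (induced S P) where
  exact := h.exact
  enoughInjectives X := by
    obtain ⟨I, i, hI, hi⟩ := h.enoughInjectives X
    exact ⟨I, i, hI.induced, hi⟩
  enoughProjectives X := by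
    obtain ⟨I, i, hI, hi⟩ := h.enoughProjectives X
    exact ⟨I, i, hI.induced, hi⟩
  projective_iff_injective X := by
    rw [h.isProjective_iff, h.isInjective_iff, h.frobenius.projective_iff_injective]

end FullSubcategories

/-! ### Functors induced on stable categories. -/

section TriangulatedFunctors

variable {T : Type u} [Category.{v} T] {susp : T ⥤ T} {T' : Type u'} [Category.{v'} T']
  {susp' : T' ⥤ T'}

/-- The image of a candidate triangle. -/
abbrev Tri.map (A : Tri susp) (F : T ⥤ T') (φ : susp ⋙ F ≅ F ⋙ susp') : Tri susp' :=
  ⟨F.obj A.X₁, F.obj A.X₂, F.obj A.X₃, F.map A.f, F.map A.g, F.map A.h ≫ φ.hom.app A.X₁⟩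

theorem Tri.Isomorphic.map {A B : Tri susp} (h : A.Isomorphic B) (F : T ⥤ T')
    (φ : susp ⋙ F ≅ F ⋙ susp') : (A.map F φ).Isomorphic (B.map F φ) := by
  obtain ⟨a, b, c, h₁, h₂, h₃⟩ := h
  refine ⟨F.mapIso a, F.mapIso b, F.mapIso c, ?_, ?_, ?_⟩
  · simp only [Functor.mapIso_hom, ← Functor.map_comp, h₁]
  · simp only [Functor.mapIso_hom, ← Functor.map_comp, h₂]
  · have := φ.hom.naturality a.hom
    simp only [Functor.comp_map] at this
    simp only [Functor.mapIso_hom, Category.assoc, ← this]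
    rw [← Functor.map_comp_assoc, h₃, Functor.map_comp_assoc]

variable {C : Type u} [Category.{v} C] [Preadditive C] {S : ObjectProperty (ShortComplex C)}
  {D : Type u'} [Category.{v'} D] [Preadditive D] {S' : ObjectProperty (ShortComplex D)}
  (F : C ⥤ D) [F.Additive]

/-- `F` sends conflations to conflations. -/
def IsExactFunctor (S : ObjectProperty (ShortComplex C)) (S' : ObjectProperty (ShortComplex D))
    (F : C ⥤ D) [F.Additive] : Prop :=
  ∀ ⦃X Y Z : C⦄ (f : X ⟶ Y) (g : Y ⟶ Z) (w : f ≫ g = 0), S (.mk f g w) →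
    S' (.mk (F.map f) (F.map g) (by rw [← F.map_comp, w, F.map_zero]))

variable {F} (hF : ∀ P : C, IsProjective S P → IsProjective S' (F.obj P))

instance : (stableMap S S' F hF).Additive where
  map_add {X Y f g} := by
    obtain ⟨f, rfl⟩ := (toStable S).map_surjective (X := X.as) (Y := Y.as) f
    obtain ⟨g, rfl⟩ := (toStable S).map_surjective (X := X.as) (Y := Y.as) g
    rw [← Functor.map_add]
    exact ((toStable S').congr_map F.map_add).trans (toStable S').map_add

theorem stableMap_full [F.Full] : (stableMap S S' F hF).Full where
  map_surjective {X Y} f := by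
    obtain ⟨f, rfl⟩ := (toStable S').map_surjective (X := F.obj X.as) (Y := F.obj Y.as) f
    obtain ⟨f, rfl⟩ := F.map_surjective f
    exact ⟨(toStable S).map f, rfl⟩

/-- A map from `F X` to a projective-injective object extends along `F X ↣ F (I X)`. Hence a
difference that factors through any projective of the target factors through `F (I X)`, and this
factorization comes from the source category by fullness. -/
theorem stableMap_faithful (h : IsFrobenius S) (h' : IsFrobenius S')
    (hex : IsExactFunctor S S' F) [F.Full] [F.Faithful] : (stableMap S S' F hF).Faithful where
  map_injective {X Y f g} hfg := by
    obtain ⟨f, rfl⟩ := (toStable S).map_surjective (X := X.as) (Y := Y.as) f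
    obtain ⟨g, rfl⟩ := (toStable S).map_surjective (X := X.as) (Y := Y.as) g
    obtain ⟨P, a, b, hP, hab⟩ := exists_factor h'.exact hfg
    obtain ⟨a', ha'⟩ := (h'.projective_iff_injective _).1 hP (F.map (h.i X.as))
      ⟨_, _, _, hex _ _ _ (h.conflation X.as)⟩ a
    obtain ⟨c, hc⟩ := F.map_surjective (a' ≫ b)
    refine toStable_map_eq_of_factor (h.projective_I X.as) (h.i X.as) c (F.map_injective ?_)
    rw [F.map_sub, hab, F.map_comp, hc, ← ha', Category.assoc]

theorem exists_susp_comparison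
    (hF : ∀ P : C, IsProjective S P → IsProjective S' (F.obj P)) (h : IsFrobenius S) (h' : IsFrobenius S')
    (hex : IsExactFunctor S S' F) (X : C) :
    ∃ (k : F.obj (h.I X) ⟶ h'.I (F.obj X)) (s : F.obj (h.suspObj X) ⟶ h'.suspObj (F.obj X))
      (e : (toStable S').obj (F.obj (h.suspObj X)) ≅ h'.susp.obj ((toStable S').obj (F.obj X))),
      F.map (h.i X) ≫ k = h'.i (F.obj X) ∧ F.map (h.q X) ≫ s = k ≫ h'.q (F.obj X) ∧
        e.hom = h'.conn s :=
  h'.exists_cosyzygy_iso (hex _ _ _ (h.conflation X)) (h'.conflation (F.obj X))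
    (hF _ (h.projective_I X)) (h'.projective_I _)

/-- A fully faithful exact functor between Frobenius categories that preserves projective objects
induces a triangulated functor. -/
theorem stableMap_isTriangulatedFunctor (h : IsFrobenius S) (h' : IsFrobenius S')
    (hex : IsExactFunctor S S' F) :
    IsTriangulatedFunctor h.dist h'.dist (stableMap S S' F hF) := by
  refine ⟨inferInstance, ?_⟩
  choose k s e hk hs he using exists_susp_comparison hF h h' hex
  have hnat : ∀ {X Y : C} (f : X ⟶ Y), (stableMap S S' F hF).map (h.susp.map ((toStable S).map f)) ≫
      (e Y).hom = (e X).hom ≫ h'.susp.map ((toStable S').map (F.map f)) := fun {X Y} f => by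
    obtain ⟨t, l, hl, ht⟩ := h.exists_induces f
    obtain ⟨t', l', hl', ht'⟩ := h'.exists_induces (F.map f)
    have e₁ : (stableMap S S' F hF).map (h.susp.map ((toStable S).map f)) =
        (toStable S').map (F.map t) := by
      rw [IsFrobenius.Induces.map_eq_conn (h := h) ⟨l, hl, ht⟩]
      rfl
    rw [e₁, he, he, IsFrobenius.Induces.conn_comp_map (h := h') ⟨l', hl', ht'⟩]
    refine (h'.conn_comp _ _).symm.trans ?_
    have hc := hex _ _ _ (h.conflation X)
    have := h'.exact.epi_g hc
    -- Both terms restrict to the same morphism on `F X`. Their difference descends to `F (Σ X)`, so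
    -- the two sides of the naturality square differ by a map through `I(F Y)`.
    obtain ⟨m, hm⟩ := h'.exact.exists_desc hc (F.map l ≫ k Y - k X ≫ l') (by
      rw [Preadditive.comp_sub, ← Category.assoc, ← F.map_comp, hl, F.map_comp, Category.assoc, hk,
        reassoc_of% (hk X), hl', sub_self])
    refine h'.conn_eq_of_factor (h'.projective_I _) m (h'.q _) ?_
    rw [← cancel_epi (F.map (h.q X)), reassoc_of% hm, Preadditive.comp_sub, ← Category.assoc,
      ← F.map_comp, ht, F.map_comp, Category.assoc, hs, reassoc_of% (hs X), ht']
    simp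
  refine ⟨NatIso.ofComponents (fun X => e X.as) (fun {X Y} f => ?_), fun A hA => ?_⟩
  · obtain ⟨f, rfl⟩ := (toStable S).map_surjective (X := X.as) (Y := Y.as) f
    exact hnat f
  · obtain ⟨X, Y, Z, f, g, r, ⟨⟨w, hfg⟩, m, hm, hr⟩, hA⟩ := (h.mem_dist_iff A).1 hA
    refine h'.dist_of_isomorphic ?_ (hA.map _ _)
    have hc : h'.Connecting (F.map f) (F.map g) (F.map r ≫ s X) := by
      refine ⟨⟨_, hex _ _ _ hfg⟩, F.map m ≫ k X, ?_, ?_⟩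
      · rw [← Category.assoc, ← F.map_comp, hm, hk]
      · rw [← Category.assoc, ← F.map_comp, hr, F.map_neg, F.map_comp, Preadditive.neg_comp,
          Category.assoc, hs, Category.assoc]
    have := hc.mem_dist
    simp only [IsFrobenius.connTri, IsFrobenius.conn_comp, ← he] at this
    exact this

end TriangulatedFunctors

/-! ### The formal passage from sub-Frobenius subcategories to the diagrams. -/

section StableDiagram

variable {C : Type u} [Category.{v} C] [Preadditive C] {S : ObjectProperty (ShortComplex C)}

theorem isExactFunctor_ιOfLE {P Q : ObjectProperty C} (hPQ : P ≤ Q) :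
    IsExactFunctor (induced S P) (induced S Q) (ObjectProperty.ιOfLE hPQ) :=
  fun _ _ _ _ _ _ h => h

theorem isExactFunctor_ι (P : ObjectProperty C) : IsExactFunctor (induced S P) S P.ι :=
  fun _ _ _ _ _ _ h => h

theorem isStableDiagram (hS : IsFrobenius S) (P : Bound × Acyc → ObjectProperty C)
    (hP : ∀ a, IsSubFrobenius S (P a)) (hle : ∀ a b, Arrow a b → P a ≤ P b)
    (hinf : ∀ X, P (.inf, .inf) X) :
    IsStableDiagram S hS P (fun a => (hP a).isFrobenius) where
  triangulated := hS.isTriangulatedCategory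
  triangulated_sub a := (hP a).isFrobenius.isTriangulatedCategory
  le_of_arrow := hle
  incl a b hab := by
    have hp : InclPreservesProj S hab := fun X hX =>
      ((hP b).isProjective_iff _).2 (((hP a).isProjective_iff X).1 hX)
    exact ⟨hp, stableMap_full hp, stableMap_faithful hp (hP a).isFrobenius (hP b).isFrobenius
      (isExactFunctor_ιOfLE hab), stableMap_isTriangulatedFunctor hp _ _ (isExactFunctor_ιOfLE hab)⟩
  ι a := by
    have hp : PreservesProj S (P a) := fun X hX => ((hP a).isProjective_iff X).1 hX
    exact ⟨hp, stableMap_full hp, stableMap_faithful hp (hP a).isFrobenius hS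
      (isExactFunctor_ι _), stableMap_isTriangulatedFunctor hp _ _ (isExactFunctor_ι _)⟩
  ι_inf hp :=
    { full := stableMap_full hp
      faithful := stableMap_faithful hp (hP _).isFrobenius hS (isExactFunctor_ι _)
      essSurj := ⟨fun X => ⟨(toStable _).obj ⟨X.as, hinf _⟩, ⟨Iso.refl _⟩⟩⟩ }
  comm a b c hab hbc h₁ h₂ h₃ := CategoryTheory.Quotient.lift_unique' _ _ _ rfl
  comm_ι a b hab h₁ h₂ h₃ := CategoryTheory.Quotient.lift_unique' _ _ _ rfl

end StableDiagram

/-! ### Degreewise split sequences of `N`-complexes. -/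

section Termsplit

variable {C : Type u} [Category.{v} C] [Preadditive C] {N : ℕ}

/-- The `N`-complex morphism with given components. -/
noncomputable abbrev NComplex.mkHom {X Y : NComplex C N} (f : ∀ n, X.obj.obj n ⟶ Y.obj.obj n)
    (hf : ∀ ⦃m n : ℤ⦄ (φ : m ⟶ n), X.obj.map φ ≫ f n = f m ≫ Y.obj.map φ) : X ⟶ Y :=
  ObjectProperty.homMk { app := f, naturality := hf }

theorem NComplex.hom_ext {X Y : NComplex C N} {f g : X ⟶ Y}
    (h : ∀ n, f.hom.app n = g.hom.app n) : f = g :=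
  ObjectProperty.hom_ext _ (NatTrans.ext (funext h))

theorem NComplex.comp_app_eq {X Y Z : NComplex C N} {f : X ⟶ Y} {g : Y ⟶ Z} {k : X ⟶ Z}
    (w : f ≫ g = k) (n : ℤ) : f.hom.app n ≫ g.hom.app n = k.hom.app n :=
  congrArg (fun k => k.hom.app n) w

theorem NComplex.naturality {X Y : NComplex C N} (f : X ⟶ Y) {m n : ℤ} (φ : m ⟶ n) :
    X.obj.map φ ≫ f.hom.app n = f.hom.app m ≫ Y.obj.map φ := f.hom.naturality φ

theorem NComplex.naturality_assoc {X Y : NComplex C N} (f : X ⟶ Y) {m n : ℤ} (φ : m ⟶ n) {W : C}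
    (k : Y.obj.obj n ⟶ W) : X.obj.map φ ≫ f.hom.app n ≫ k = f.hom.app m ≫ Y.obj.map φ ≫ k :=
  f.hom.naturality_assoc φ k

/-- Splittings of a sequence of `N`-complexes in each degree. -/
structure DegreewiseSplitting {X Y Z : NComplex C N} (f : X ⟶ Y) (g : Y ⟶ Z) where
  /-- the retractions -/
  r : ∀ n, Y.obj.obj n ⟶ X.obj.obj n
  /-- the sections -/
  s : ∀ n, Z.obj.obj n ⟶ Y.obj.obj n
  f_r : ∀ n, f.hom.app n ≫ r n = 𝟙 _
  s_g : ∀ n, s n ≫ g.hom.app n = 𝟙 _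
  id : ∀ n, r n ≫ f.hom.app n + g.hom.app n ≫ s n = 𝟙 _

namespace DegreewiseSplitting

variable {X Y Z : NComplex C N} {f : X ⟶ Y} {g : Y ⟶ Z}

theorem mono_app (σ : DegreewiseSplitting f g) (n : ℤ) : Mono (f.hom.app n) :=
  (⟨σ.r n, σ.f_r n⟩ : SplitMono (f.hom.app n)).mono

theorem epi_app (σ : DegreewiseSplitting f g) (n : ℤ) : Epi (g.hom.app n) :=
  (⟨σ.s n, σ.s_g n⟩ : SplitEpi (g.hom.app n)).epi

theorem g_s (σ : DegreewiseSplitting f g) (n : ℤ) : g.hom.app n ≫ σ.s n = 𝟙 _ - σ.r n ≫ f.hom.app n := by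
  rw [← σ.id n, add_sub_cancel_left]

theorem r_f (σ : DegreewiseSplitting f g) (n : ℤ) : σ.r n ≫ f.hom.app n = 𝟙 _ - g.hom.app n ≫ σ.s n := by
  rw [← σ.id n, add_sub_cancel_right]

theorem mono (σ : DegreewiseSplitting f g) : Mono f where
  right_cancellation a b hab := NComplex.hom_ext fun n => by
    have := σ.mono_app n
    rw [← cancel_mono (f.hom.app n), NComplex.comp_app_eq hab]
    rfl

theorem epi (σ : DegreewiseSplitting f g) : Epi g where
  left_cancellation a b hab := NComplex.hom_ext fun n => by
    have := σ.epi_app n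
    rw [← cancel_epi (g.hom.app n), NComplex.comp_app_eq hab]
    rfl

theorem exists_desc (σ : DegreewiseSplitting f g) {W : NComplex C N} (k : Y ⟶ W) (hk : f ≫ k = 0) : ∃ t, g ≫ t = k := by
  have e : ∀ n, g.hom.app n ≫ σ.s n ≫ k.hom.app n = k.hom.app n := fun n => by
    have := NComplex.comp_app_eq hk n
    rw [← Category.assoc, σ.g_s, Preadditive.sub_comp, Category.assoc, this]
    exact (congrArg₂ _ (Category.id_comp _) comp_zero).trans (sub_zero _)
  refine ⟨NComplex.mkHom (fun n => σ.s n ≫ k.hom.app n) fun m n φ => ?_, NComplex.hom_ext e⟩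
  have := σ.epi_app m
  rw [← cancel_epi (g.hom.app m), ← NComplex.naturality_assoc, e, Category.assoc,
    reassoc_of% (e m), NComplex.naturality]

theorem exists_lift (σ : DegreewiseSplitting f g) {W : NComplex C N} (k : W ⟶ Y) (hk : k ≫ g = 0) : ∃ t, t ≫ f = k := by
  have e : ∀ n, (k.hom.app n ≫ σ.r n) ≫ f.hom.app n = k.hom.app n := fun n => by
    have := NComplex.comp_app_eq hk n
    rw [Category.assoc, σ.r_f, Preadditive.comp_sub, reassoc_of% this]
    exact (congrArg₂ _ (Category.comp_id _) zero_comp).trans (sub_zero _)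
  refine ⟨NComplex.mkHom (fun n => k.hom.app n ≫ σ.r n) fun m n φ => ?_, NComplex.hom_ext e⟩
  have := σ.mono_app n
  rw [← cancel_mono (f.hom.app n), Category.assoc, e, NComplex.naturality, Category.assoc,
    NComplex.naturality, ← Category.assoc, e]

end DegreewiseSplitting

theorem termsplit_mk_iff {X Y Z : NComplex C N} (f : X ⟶ Y) (g : Y ⟶ Z) (w : f ≫ g = 0) :
    termsplit C N (.mk f g w) ↔ Nonempty (DegreewiseSplitting f g) := by
  constructor
  · intro h
    exact ⟨⟨fun n => (h n).some.r, fun n => (h n).some.s, fun n => (h n).some.f_r,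
      fun n => (h n).some.s_g, fun n => (h n).some.id⟩⟩
  · rintro ⟨σ⟩ n
    exact ⟨⟨σ.r n, σ.s n, σ.f_r n, σ.s_g n, σ.id n⟩⟩

/-- Split monics with a complement. -/
def SplitMonic {X Y : C} (i : X ⟶ Y) : Prop :=
  ∃ (Z : C) (p : Y ⟶ Z) (r : Y ⟶ X) (s : Z ⟶ Y), i ≫ r = 𝟙 _ ∧ s ≫ p = 𝟙 _ ∧ i ≫ p = 0 ∧
    r ≫ i + p ≫ s = 𝟙 _

/-- Split epics with a complement. -/
def SplitEpic {Y Z : C} (p : Y ⟶ Z) : Prop :=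
  ∃ (X : C) (i : X ⟶ Y) (r : Y ⟶ X) (s : Z ⟶ Y), i ≫ r = 𝟙 _ ∧ s ≫ p = 𝟙 _ ∧ i ≫ p = 0 ∧
    r ≫ i + p ≫ s = 𝟙 _

theorem SplitMonic.of_iso [HasZeroObject C] {X Y : C} (e : X ≅ Y) : SplitMonic e.hom :=
  ⟨(HasZeroObject.zero' C).zero, 0, e.inv, 0, e.hom_inv_id, (isZero_zero C).eq_of_src _ _,
    comp_zero, by simp⟩

theorem SplitEpic.of_iso [HasZeroObject C] {X Y : C} (e : X ≅ Y) : SplitEpic e.hom :=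
  ⟨(HasZeroObject.zero' C).zero, 0, 0, e.inv, (isZero_zero C).eq_of_src _ _, e.inv_hom_id,
    zero_comp, by simp⟩

theorem SplitMonic.comp [HasBinaryBiproducts C] {X Y Z : C} {i : X ⟶ Y} {j : Y ⟶ Z}
    (hi : SplitMonic i) (hj : SplitMonic j) : SplitMonic (i ≫ j) := by
  obtain ⟨A, p, r, s, h₁, h₂, h₃, h₄⟩ := hi
  obtain ⟨B, q, r', s', h₁', h₂', h₃', h₄'⟩ := hj
  have h₅ : s' ≫ r' = 0 := by
    have := s' ≫= h₄' =≫ r'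
    simpa [h₁', reassoc_of% h₂'] using this
  refine ⟨A ⊞ B, biprod.lift (r' ≫ p) q, r' ≫ r, biprod.desc (s ≫ j) s', ?_, ?_, ?_, ?_⟩
  · rw [Category.assoc, reassoc_of% h₁', h₁]
  · ext <;> simp [reassoc_of% h₁', h₂, h₂', h₃', reassoc_of% h₅]
  · ext <;> simp [reassoc_of% h₁', h₃, h₃']
  · rw [biprod.lift_desc, ← add_assoc, ← h₄']
    have := r' ≫= h₄ =≫ j
    simp only [Preadditive.comp_add, Preadditive.add_comp, Category.assoc,
      Category.id_comp] at this ⊢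
    rw [this]

theorem SplitEpic.comp [HasBinaryBiproducts C] {X Y Z : C} {p : X ⟶ Y} {q : Y ⟶ Z}
    (hp : SplitEpic p) (hq : SplitEpic q) : SplitEpic (p ≫ q) := by
  obtain ⟨A, i, r, s, h₁, h₂, h₃, h₄⟩ := hp
  obtain ⟨B, j, r', s', h₁', h₂', h₃', h₄'⟩ := hq
  have h₅ : s ≫ r = 0 := by
    have := s ≫= h₄ =≫ r
    simpa [h₁, reassoc_of% h₂] using this
  refine ⟨A ⊞ B, biprod.desc i (j ≫ s), biprod.lift r (p ≫ r'), s' ≫ s, ?_, ?_, ?_, ?_⟩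
  · ext <;> simp [h₁, reassoc_of% h₂, h₁', reassoc_of% h₃, h₅]
  · rw [Category.assoc, reassoc_of% h₂, h₂']
  · ext <;> simp [reassoc_of% h₂, h₃', reassoc_of% h₃]
  · rw [biprod.lift_desc, add_assoc, ← h₄]
    have := p ≫= h₄' =≫ s
    simp only [Preadditive.comp_add, Preadditive.add_comp, Category.assoc,
      Category.id_comp] at this ⊢
    rw [this]

/-- A morphism of `N`-complexes is an admissible monic if it is so in each degree. -/
theorem admissibleMono_termsplit_iff {X Y : NComplex C N} (f : X ⟶ Y) :
    AdmissibleMono (termsplit C N) f ↔ ∀ n, SplitMonic (f.hom.app n) := by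
  constructor
  · rintro ⟨Z, g, w, h⟩ n
    obtain ⟨σ⟩ := (termsplit_mk_iff _ _ _).1 h
    exact ⟨_, g.hom.app n, σ.r n, σ.s n, σ.f_r n, σ.s_g n, NComplex.comp_app_eq w n, σ.id n⟩
  · intro h
    choose Z p r s h₁ h₂ h₃ h₄ using h
    -- The complements carry the differential `s ≫ d ≫ p`. It is functorial because `p ≫ s` differs
    -- from the identity by `r ≫ f`, and `f ≫ d ≫ p = d ≫ f ≫ p = 0`.
    have e : ∀ {l m n : ℤ} (φ : l ⟶ m) (ψ : m ⟶ n) , s l ≫ Y.obj.map φ ≫ p m ≫ s m ≫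
        Y.obj.map ψ ≫ p n = s l ≫ Y.obj.map (φ ≫ ψ) ≫ p n := fun {l m n} φ ψ => by
      have : p m ≫ s m = 𝟙 _ - r m ≫ f.hom.app m := by rw [← h₄ m, add_sub_cancel_left]
      rw [reassoc_of% this, Preadditive.sub_comp]
      simp [← NComplex.naturality_assoc, h₃]
    have e' : ∀ {m n : ℤ} (φ : m ⟶ n), p m ≫ s m ≫ Y.obj.map φ ≫ p n = Y.obj.map φ ≫ p n :=
        fun {m n} φ => by
      have : p m ≫ s m = 𝟙 _ - r m ≫ f.hom.app m := by rw [← h₄ m, add_sub_cancel_left]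
      rw [reassoc_of% this, Preadditive.sub_comp]
      simp [← NComplex.naturality_assoc, h₃]
    let Q : NComplex C N :=
      ⟨{ obj := Z
         map := fun {m n} φ => s m ≫ Y.obj.map φ ≫ p n
         map_id := fun n => by simp [h₂]
         map_comp := fun φ ψ => by simpa using (e φ ψ).symm }, fun m n hmn hn => by
        change s m ≫ Y.obj.map _ ≫ p n = 0
        rw [Y.property m n hmn hn, zero_comp, comp_zero]⟩
    refine ⟨Q, NComplex.mkHom p fun m n φ => (e' φ).symm, NComplex.hom_ext h₃,
      (termsplit_mk_iff _ _ _).2 ⟨⟨r, s, h₁, h₂, h₄⟩⟩⟩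

/-- A morphism of `N`-complexes is an admissible epic if it is so in each degree. -/
theorem admissibleEpi_termsplit_iff {Y Z : NComplex C N} (g : Y ⟶ Z) :
    AdmissibleEpi (termsplit C N) g ↔ ∀ n, SplitEpic (g.hom.app n) := by
  constructor
  · rintro ⟨X, f, w, h⟩ n
    obtain ⟨σ⟩ := (termsplit_mk_iff _ _ _).1 h
    exact ⟨_, f.hom.app n, σ.r n, σ.s n, σ.f_r n, σ.s_g n, NComplex.comp_app_eq w n, σ.id n⟩
  · intro h
    choose X i r s h₁ h₂ h₃ h₄ using h
    have e' : ∀ {m n : ℤ} (φ : m ⟶ n), i m ≫ Y.obj.map φ ≫ r n ≫ i n = i m ≫ Y.obj.map φ :=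
        fun {m n} φ => by
      have : r n ≫ i n = 𝟙 _ - g.hom.app n ≫ s n := by rw [← h₄ n, add_sub_cancel_right]
      rw [this]
      simp [reassoc_of% (h₃ m)]
    let Q : NComplex C N :=
      ⟨{ obj := X
         map := fun {m n} φ => i m ≫ Y.obj.map φ ≫ r n
         map_id := fun n => by simp [h₁]
         map_comp := fun φ ψ => by simp [reassoc_of% (e' φ)] }, fun m n hmn hn => by
        change i m ≫ Y.obj.map _ ≫ r n = 0
        rw [Y.property m n hmn hn, zero_comp, comp_zero]⟩
    refine ⟨Q, NComplex.mkHom i fun m n φ => ?_, NComplex.hom_ext h₃,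
      (termsplit_mk_iff _ _ _).2 ⟨⟨r, s, h₁, h₂, h₄⟩⟩⟩
    change (i m ≫ Y.obj.map φ ≫ r n) ≫ i n = i m ≫ Y.obj.map φ
    simpa using e' φ

section Twist

variable [HasBinaryBiproducts C]

/-- The extension of `B` by `A` with twisting cocycle `θ`. -/
noncomputable def twist (A B : NComplex C N)
    (θ : ∀ {m n : ℤ}, (m ⟶ n) → (B.obj.obj m ⟶ A.obj.obj n)) (h₀ : ∀ n, θ (𝟙 n) = 0)
    (h₁ : ∀ {l m n : ℤ} (φ : l ⟶ m) (ψ : m ⟶ n),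
      θ (φ ≫ ψ) = θ φ ≫ A.obj.map ψ + B.obj.map φ ≫ θ ψ)
    (h₂ : ∀ (m n : ℤ) (hmn : m ≤ n), n = m + N → θ (homOfLE hmn) = 0) : NComplex C N :=
  ⟨{ obj := fun n => A.obj.obj n ⊞ B.obj.obj n
     map := fun {m n} φ => biprod.desc (A.obj.map φ ≫ biprod.inl)
       (biprod.lift (θ φ) (B.obj.map φ))
     map_id := fun n => by ext <;> simp [h₀]
     map_comp := fun φ ψ => by ext <;> simp [h₁] }, fun m n hmn hn => by
    change biprod.desc _ _ = 0
    ext <;> simp [A.property m n hmn hn, B.property m n hmn hn, h₂ m n hmn hn]⟩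

variable {A B : NComplex C N}
    {θ : ∀ {m n : ℤ}, (m ⟶ n) → (B.obj.obj m ⟶ A.obj.obj n)} {h₀ : ∀ n, θ (𝟙 n) = 0}
    {h₁ : ∀ {l m n : ℤ} (φ : l ⟶ m) (ψ : m ⟶ n),
      θ (φ ≫ ψ) = θ φ ≫ A.obj.map ψ + B.obj.map φ ≫ θ ψ}
    {h₂ : ∀ (m n : ℤ) (hmn : m ≤ n), n = m + N → θ (homOfLE hmn) = 0}

theorem twist_map {m n : ℤ} (φ : m ⟶ n) : (twist A B θ h₀ h₁ h₂).obj.map φ =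
    biprod.desc (A.obj.map φ ≫ biprod.inl) (biprod.lift (θ φ) (B.obj.map φ)) := rfl

/-- The inclusion of `A` into an extension of `B` by `A`. -/
noncomputable def twistInl : A ⟶ twist A B θ h₀ h₁ h₂ :=
  NComplex.mkHom (fun _ => biprod.inl) fun _ _ _ => (biprod.inl_desc _ _).symm

/-- The projection of an extension of `B` by `A` to `B`. -/
noncomputable def twistSnd : twist A B θ h₀ h₁ h₂ ⟶ B :=
  NComplex.mkHom (fun n => biprod.snd) fun m n φ => by
    have : biprod.desc (A.obj.map φ ≫ biprod.inl) (biprod.lift (θ φ) (B.obj.map φ)) ≫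
      biprod.snd = biprod.snd ≫ B.obj.map φ := by ext <;> simp
    exact this

theorem twistInl_twistSnd : (twistInl : A ⟶ twist A B θ h₀ h₁ h₂) ≫ twistSnd = 0 :=
  NComplex.hom_ext fun _ => biprod.inl_snd

theorem termsplit_twist : termsplit C N
    (.mk (twistInl : A ⟶ twist A B θ h₀ h₁ h₂) twistSnd twistInl_twistSnd) :=
  (termsplit_mk_iff _ _ _).2 ⟨⟨fun _ => biprod.fst, fun _ => biprod.inr, fun _ => biprod.inl_fst,
    fun _ => biprod.inr_snd, fun _ => biprod.total⟩⟩

end Twist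

end Termsplit

/-! ### The degreewise split exact structure. -/

section TermsplitExact

variable {C : Type u} [Category.{v} C] [Preadditive C] {N : ℕ}

/-- Pushouts of degreewise split monics. -/
theorem exists_isPushout_termsplit [HasBinaryBiproducts C] {X Y Q Z : NComplex C N} {i : X ⟶ Y}
    {p : Y ⟶ Q} (w : i ≫ p = 0) (σ : DegreewiseSplitting i p) (f : X ⟶ Z) :
    ∃ (W : NComplex C N) (f' : Y ⟶ W) (i' : Z ⟶ W), IsPushout i f f' i' ∧
      AdmissibleMono (termsplit C N) i' := by
  have hw := NComplex.comp_app_eq w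
  have hsr : ∀ n, σ.s n ≫ σ.r n = 0 := fun n => by
    have := σ.mono_app n
    rw [← cancel_mono (i.hom.app n), Category.assoc, σ.r_f, zero_comp, Preadditive.comp_sub,
      reassoc_of% (σ.s_g n), Category.comp_id, sub_self]
  have hpY : ∀ {m n : ℤ} (φ : m ⟶ n), Q.obj.map φ = σ.s m ≫ Y.obj.map φ ≫ p.hom.app n :=
    fun {m n} φ => by rw [NComplex.naturality, reassoc_of% (σ.s_g m)]
  -- In the coordinates of the splitting, `s ≫ d ≫ r` is the off-diagonal part of the differential
  -- of `Y`. The pushout is the extension whose cocycle is its composite with `f`.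
  let θ : ∀ {m n : ℤ}, (m ⟶ n) → (Q.obj.obj m ⟶ Z.obj.obj n) := fun {m n} φ =>
    σ.s m ≫ Y.obj.map φ ≫ σ.r n ≫ f.hom.app n
  have h₀ : ∀ n, θ (𝟙 n) = 0 := fun n => by simp [θ, reassoc_of% (hsr n)]
  have h₁ : ∀ {l m n : ℤ} (φ : l ⟶ m) (ψ : m ⟶ n),
      θ (φ ≫ ψ) = θ φ ≫ Z.obj.map ψ + Q.obj.map φ ≫ θ ψ := fun {l m n} φ ψ => by
    simp only [θ, hpY, Category.assoc]
    rw [reassoc_of% (σ.g_s m), ← NComplex.naturality]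
    simp only [Preadditive.sub_comp, Preadditive.comp_sub, Category.id_comp, Category.assoc]
    rw [← NComplex.naturality_assoc, reassoc_of% (σ.f_r n), Functor.map_comp, Category.assoc]
    abel
  have h₂ : ∀ (m n : ℤ) (hmn : m ≤ n), n = m + N → θ (homOfLE hmn) = 0 := fun m n hmn hn => by
    simp only [θ]
    rw [Y.property m n hmn hn, zero_comp, comp_zero]
  let f' : Y ⟶ twist Z Q θ h₀ h₁ h₂ :=
    NComplex.mkHom (fun n => biprod.lift (σ.r n ≫ f.hom.app n) (p.hom.app n)) fun m n φ => by
      rw [twist_map]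
      have : Y.obj.map φ ≫ biprod.lift (σ.r n ≫ f.hom.app n) (p.hom.app n) =
          biprod.lift (σ.r m ≫ f.hom.app m) (p.hom.app m) ≫
            biprod.desc (Z.obj.map φ ≫ biprod.inl) (biprod.lift (θ φ) (Q.obj.map φ)) := by
        ext
        · simp only [θ, Category.assoc, biprod.lift_fst, biprod.lift_desc, Preadditive.add_comp,
            biprod.inl_fst, Category.comp_id]
          rw [reassoc_of% (σ.g_s m), ← NComplex.naturality]
          simp only [Preadditive.sub_comp, Category.id_comp, Category.assoc]
          rw [← NComplex.naturality_assoc, reassoc_of% (σ.f_r n)]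
          abel
        · simp
      exact this
  have sq : i ≫ f' = f ≫ twistInl := NComplex.hom_ext fun n => by
    change i.hom.app n ≫ biprod.lift (σ.r n ≫ f.hom.app n) (p.hom.app n) =
      f.hom.app n ≫ biprod.inl
    ext
    · simp [reassoc_of% (σ.f_r n)]
    · simpa using hw n
  have hdesc : ∀ s : PushoutCocone i f, ∃ t : twist Z Q θ h₀ h₁ h₂ ⟶ s.pt,
      f' ≫ t = s.inl ∧ twistInl ≫ t = s.inr := fun s => by
    have hs := fun n => NComplex.comp_app_eq s.condition n
    refine ⟨NComplex.mkHom (fun n => biprod.desc (s.inr.hom.app n) (σ.s n ≫ s.inl.hom.app n))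
      fun m n φ => ?_, NComplex.hom_ext fun n => ?_, NComplex.hom_ext fun n => biprod.inl_desc _ _⟩
    · have : biprod.desc (Z.obj.map φ ≫ biprod.inl) (biprod.lift (θ φ) (Q.obj.map φ)) ≫
          biprod.desc (s.inr.hom.app n) (σ.s n ≫ s.inl.hom.app n) =
          biprod.desc (s.inr.hom.app m) (σ.s m ≫ s.inl.hom.app m) ≫ s.pt.obj.map φ := by
        ext
        · simp
        · simp only [θ, hpY, biprod.inr_desc_assoc, biprod.lift_desc, Category.assoc, ← NComplex.naturality]
          have e : f.hom.app n ≫ s.inr.hom.app n = i.hom.app n ≫ s.inl.hom.app n := (hs n).symm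
          rw [e, ← Preadditive.comp_add, ← Preadditive.comp_add, ← Category.assoc (σ.r n),
            ← Category.assoc (p.hom.app n), ← Preadditive.add_comp, σ.id, Category.id_comp]
      exact this
    · change biprod.lift (σ.r n ≫ f.hom.app n) (p.hom.app n) ≫
        biprod.desc (s.inr.hom.app n) (σ.s n ≫ s.inl.hom.app n) = s.inl.hom.app n
      have e : f.hom.app n ≫ s.inr.hom.app n = i.hom.app n ≫ s.inl.hom.app n := (hs n).symm
      rw [biprod.lift_desc, Category.assoc, e, ← Category.assoc (σ.r n),
        ← Category.assoc (p.hom.app n), ← Preadditive.add_comp, σ.id, Category.id_comp]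
  choose t ht ht' using hdesc
  refine ⟨twist Z Q θ h₀ h₁ h₂, f', twistInl, ⟨⟨sq⟩, ⟨PushoutCocone.IsColimit.mk _ t ht ht'
    fun s m hm hm' => NComplex.hom_ext fun n => ?_⟩⟩, _, _, _, termsplit_twist⟩
  have key : ∀ {V : C} (a b : Z.obj.obj n ⊞ Q.obj.obj n ⟶ V),
      biprod.lift (σ.r n ≫ f.hom.app n) (p.hom.app n) ≫ a =
        biprod.lift (σ.r n ≫ f.hom.app n) (p.hom.app n) ≫ b →
      biprod.inl ≫ a = biprod.inl ≫ b → a = b := fun a b h h' => by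
    have e := σ.s n ≫= h
    simp only [biprod.lift_eq, Preadditive.add_comp, Preadditive.comp_add, Category.assoc,
      reassoc_of% (hsr n), zero_comp, zero_add, reassoc_of% (σ.s_g n)] at e
    exact biprod.hom_ext' _ _ h' e
  exact key _ _ (NComplex.comp_app_eq (hm.trans (ht s).symm) n)
    (NComplex.comp_app_eq (hm'.trans (ht' s).symm) n)

/-- Pullbacks of degreewise split epics. -/
theorem exists_isPullback_termsplit [HasBinaryBiproducts C] {X Y Q Z : NComplex C N} {i : X ⟶ Y}
    {p : Y ⟶ Q} (w : i ≫ p = 0) (σ : DegreewiseSplitting i p) (f : Z ⟶ Q) :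
    ∃ (W : NComplex C N) (f' : W ⟶ Y) (p' : W ⟶ Z), IsPullback f' p' p f ∧
      AdmissibleEpi (termsplit C N) p' := by
  have hw : ∀ n, i.hom.app n ≫ p.hom.app n = 0 := NComplex.comp_app_eq w
  have hsr : ∀ n, σ.s n ≫ σ.r n = 0 := fun n => by
    have := σ.mono_app n
    rw [← cancel_mono (i.hom.app n), Category.assoc, σ.r_f, zero_comp, Preadditive.comp_sub,
      reassoc_of% (σ.s_g n), Category.comp_id, sub_self]
  have hpY : ∀ {m n : ℤ} (φ : m ⟶ n), X.obj.map φ = i.hom.app m ≫ Y.obj.map φ ≫ σ.r n :=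
    fun {m n} φ => by rw [← NComplex.naturality_assoc, σ.f_r n, Category.comp_id]
  -- Dually, the cocycle of `Y` precomposed with `f`.
  let θ : ∀ {m n : ℤ}, (m ⟶ n) → (Z.obj.obj m ⟶ X.obj.obj n) := fun {m n} φ =>
    f.hom.app m ≫ σ.s m ≫ Y.obj.map φ ≫ σ.r n
  have hθ : ∀ {m n : ℤ} (φ : m ⟶ n), θ φ ≫ i.hom.app n + Z.obj.map φ ≫ f.hom.app n ≫ σ.s n =
      f.hom.app m ≫ σ.s m ≫ Y.obj.map φ := fun {m n} φ => by
    simp only [θ, Category.assoc, σ.r_f, Preadditive.comp_sub, Category.comp_id]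
    rw [NComplex.naturality_assoc p, reassoc_of% (σ.s_g m), NComplex.naturality_assoc]
    abel
  have h₀ : ∀ n, θ (𝟙 n) = 0 := fun n => by simp [θ, hsr n]
  have h₁ : ∀ {l m n : ℤ} (φ : l ⟶ m) (ψ : m ⟶ n),
      θ (φ ≫ ψ) = θ φ ≫ X.obj.map ψ + Z.obj.map φ ≫ θ ψ := fun {l m n} φ ψ => by
    have := hθ φ =≫ (Y.obj.map ψ ≫ σ.r n)
    simp only [Preadditive.add_comp, Category.assoc] at this
    rw [hpY ψ]
    refine Eq.trans ?_ this.symm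
    simp [θ]
  have h₂ : ∀ (m n : ℤ) (hmn : m ≤ n), n = m + N → θ (homOfLE hmn) = 0 := fun m n hmn hn => by
    simp only [θ]
    rw [Y.property m n hmn hn, zero_comp, comp_zero, comp_zero]
  let f' : twist X Z θ h₀ h₁ h₂ ⟶ Y :=
    NComplex.mkHom (fun n => biprod.desc (i.hom.app n) (f.hom.app n ≫ σ.s n)) fun m n φ => by
      have : biprod.desc (X.obj.map φ ≫ biprod.inl) (biprod.lift (θ φ) (Z.obj.map φ)) ≫
          biprod.desc (i.hom.app n) (f.hom.app n ≫ σ.s n) =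
          biprod.desc (i.hom.app m) (f.hom.app m ≫ σ.s m) ≫ Y.obj.map φ := by
        ext
        · simp
        · simpa using hθ φ
      exact this
  have sq : f' ≫ p = twistSnd ≫ f := NComplex.hom_ext fun n => by
    change biprod.desc (i.hom.app n) (f.hom.app n ≫ σ.s n) ≫ p.hom.app n =
      biprod.snd ≫ f.hom.app n
    ext
    · simp [hw n]
    · simp [σ.s_g n]
  have hlift : ∀ s : PullbackCone p f, ∃ t : s.pt ⟶ twist X Z θ h₀ h₁ h₂,
      t ≫ f' = s.fst ∧ t ≫ twistSnd = s.snd := fun s => by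
    have hs : ∀ n, s.fst.hom.app n ≫ p.hom.app n = s.snd.hom.app n ≫ f.hom.app n :=
      fun n => NComplex.comp_app_eq s.condition n
    refine ⟨NComplex.mkHom (fun n => biprod.lift (s.fst.hom.app n ≫ σ.r n) (s.snd.hom.app n))
      fun m n φ => ?_, NComplex.hom_ext fun n => ?_, NComplex.hom_ext fun n => biprod.lift_snd _ _⟩
    · have : s.pt.obj.map φ ≫ biprod.lift (s.fst.hom.app n ≫ σ.r n) (s.snd.hom.app n) =
          biprod.lift (s.fst.hom.app m ≫ σ.r m) (s.snd.hom.app m) ≫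
          biprod.desc (X.obj.map φ ≫ biprod.inl) (biprod.lift (θ φ) (Z.obj.map φ)) := by
        ext
        · simp only [θ, hpY, biprod.lift_desc, Category.assoc, biprod.lift_fst,
            Preadditive.add_comp, biprod.inl_fst, Category.comp_id]
          rw [← reassoc_of% (hs m), NComplex.naturality_assoc, ← Preadditive.comp_add,
            ← Category.assoc (σ.r m), ← Category.assoc (p.hom.app m), ← Preadditive.add_comp,
            σ.id, Category.id_comp]
        · simp
      exact this
    · change biprod.lift (s.fst.hom.app n ≫ σ.r n) (s.snd.hom.app n) ≫
        biprod.desc (i.hom.app n) (f.hom.app n ≫ σ.s n) = s.fst.hom.app n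
      rw [biprod.lift_desc, ← reassoc_of% (hs n), Category.assoc, ← Preadditive.comp_add, σ.id,
        Category.comp_id]
  choose t ht ht' using hlift
  refine ⟨twist X Z θ h₀ h₁ h₂, f', twistSnd, ⟨⟨sq⟩, ⟨PullbackCone.IsLimit.mk _ t ht ht'
    fun s m hm hm' => NComplex.hom_ext fun n => ?_⟩⟩, _, _, _, termsplit_twist⟩
  have key : ∀ {V : C} (a b : V ⟶ X.obj.obj n ⊞ Z.obj.obj n),
      a ≫ biprod.desc (i.hom.app n) (f.hom.app n ≫ σ.s n) =
        b ≫ biprod.desc (i.hom.app n) (f.hom.app n ≫ σ.s n) →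
      a ≫ biprod.snd = b ≫ biprod.snd → a = b := fun a b h h' => by
    have e := h =≫ σ.r n
    simp only [biprod.desc_eq, Preadditive.add_comp, Preadditive.comp_add, Category.assoc,
      hsr n, comp_zero, add_zero, σ.f_r n, Category.comp_id] at e
    exact biprod.hom_ext _ _ e h'
  exact key _ _ (NComplex.comp_app_eq (hm.trans (ht s).symm) n)
    (NComplex.comp_app_eq (hm'.trans (ht' s).symm) n)

variable (C N) in
/-- The zero complex. -/
theorem exists_isZero_nComplex [HasZeroObject C] : ∃ Z : NComplex C N, IsZero Z := by
  refine ⟨⟨(Functor.const ℤ).obj (HasZeroObject.zero' C).zero, fun m n hmn _ =>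
    (isZero_zero C).eq_of_src _ _⟩, (IsZero.iff_id_eq_zero _).2 (NComplex.hom_ext fun n =>
    (isZero_zero C).eq_of_src _ _)⟩

variable (C N) in
-- Admissibility is a degreewise condition, so composition closure is inherited from split monics
-- and epics in `C`; only the existence of pushouts and pullbacks needs complexes to be built, as
-- twisted direct sums.
theorem isExactCategory_termsplit [HasZeroObject C] [HasBinaryBiproducts C] :
    IsExactCategory (termsplit C N) where
  hasZeroObject := ⟨exists_isZero_nComplex C N⟩
  hasBinaryBiproducts := ⟨fun X Y => by
    have h := termsplit_twist (A := X) (B := Y) (θ := fun _ => 0) (h₀ := fun _ => rfl)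
      (h₁ := fun _ _ => by simp) (h₂ := fun _ _ _ _ => rfl)
    let fst : twist X Y (fun _ => 0) (fun _ => rfl) (fun _ _ => by simp) (fun _ _ _ _ => rfl) ⟶ X :=
      NComplex.mkHom (fun n => biprod.fst) fun m n φ => by
        have : biprod.desc (X.obj.map φ ≫ biprod.inl) (biprod.lift 0 (Y.obj.map φ)) ≫ biprod.fst =
          biprod.fst ≫ X.obj.map φ := by ext <;> simp
        exact this
    let inr : Y ⟶ twist X Y (fun _ => 0) (fun _ => rfl) (fun _ _ => by simp) (fun _ _ _ _ => rfl) :=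
      NComplex.mkHom (fun n => biprod.inr) fun m n φ => by
        have : Y.obj.map φ ≫ biprod.inr = biprod.inr ≫
          biprod.desc (X.obj.map φ ≫ biprod.inl) (biprod.lift 0 (Y.obj.map φ)) := by ext <;> simp
        exact this
    exact HasBinaryBiproduct.mk ⟨{
      pt := _
      inl := twistInl
      inr := inr
      fst := fst
      snd := twistSnd
      inl_fst := NComplex.hom_ext fun n => biprod.inl_fst
      inl_snd := twistInl_twistSnd
      inr_fst := NComplex.hom_ext fun n => biprod.inr_fst
      inr_snd := NComplex.hom_ext fun n => biprod.inr_snd },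
      isBinaryBilimitOfTotal _ (NComplex.hom_ext fun n => biprod.total)⟩⟩
  closedUnderIso := ⟨fun {T T'} e hT n => by
    obtain ⟨s⟩ := hT n
    refine ⟨s.ofIso (ShortComplex.isoMk ((evaluation _ _).obj n |>.mapIso
      ((isNComplex C N).ι.mapIso (ShortComplex.π₁.mapIso e)))
      ((evaluation _ _).obj n |>.mapIso ((isNComplex C N).ι.mapIso (ShortComplex.π₂.mapIso e)))
      ((evaluation _ _).obj n |>.mapIso ((isNComplex C N).ι.mapIso (ShortComplex.π₃.mapIso e)))
      ?_ ?_)⟩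
    · exact congrArg (fun k => k.hom.app n) e.hom.comm₁₂
    · exact congrArg (fun k => k.hom.app n) e.hom.comm₂₃⟩
  kernel T hT := by
    obtain ⟨σ⟩ := (termsplit_mk_iff _ _ T.zero).1 hT
    have := σ.mono
    exact nonempty_isLimit_kernelFork T.zero fun W k hk => σ.exists_lift k hk
  cokernel T hT := by
    obtain ⟨σ⟩ := (termsplit_mk_iff _ _ T.zero).1 hT
    have := σ.epi
    exact nonempty_isColimit_cokernelCofork T.zero fun W k hk => σ.exists_desc k hk
  id_mono X := (admissibleMono_termsplit_iff _).2 fun n => SplitMonic.of_iso (Iso.refl _)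
  id_epi X := (admissibleEpi_termsplit_iff _).2 fun n => SplitEpic.of_iso (Iso.refl _)
  comp_mono X Y Z i j hi hj := (admissibleMono_termsplit_iff _).2 fun n =>
    ((admissibleMono_termsplit_iff _).1 hi n).comp ((admissibleMono_termsplit_iff _).1 hj n)
  comp_epi X Y Z i j hi hj := (admissibleEpi_termsplit_iff _).2 fun n =>
    ((admissibleEpi_termsplit_iff _).1 hi n).comp ((admissibleEpi_termsplit_iff _).1 hj n)
  hasPushout X Y Z i f := by
    rintro ⟨Q, p, w, h⟩
    obtain ⟨σ⟩ := (termsplit_mk_iff _ _ _).1 h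
    obtain ⟨W, f', i', sq, -⟩ := exists_isPushout_termsplit w σ f
    exact sq.hasPushout
  pushout X Y Z W i f f' i' := by
    rintro ⟨Q, p, w, h⟩ sq
    obtain ⟨σ⟩ := (termsplit_mk_iff _ _ _).1 h
    obtain ⟨W', f'', i'', sq', hi⟩ := exists_isPushout_termsplit w σ f
    have e : i'' ≫ (sq.isoIsPushout _ _ sq').inv = i' := by simp
    rw [← e]
    exact (admissibleMono_termsplit_iff _).2 fun n =>
      ((admissibleMono_termsplit_iff _).1 hi n).comp (SplitMonic.of_iso
        (((evaluation _ _).obj n).mapIso ((isNComplex C N).ι.mapIso (sq.isoIsPushout _ _ sq').symm)))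
  hasPullback X Y Z p f := by
    rintro ⟨K, i, w, h⟩
    obtain ⟨σ⟩ := (termsplit_mk_iff _ _ _).1 h
    obtain ⟨W, f', i', sq, -⟩ := exists_isPullback_termsplit w σ f
    exact sq.hasPullback
  pullback W X Y Z f' p' p f := by
    rintro ⟨K, i, w, h⟩ sq
    obtain ⟨σ⟩ := (termsplit_mk_iff _ _ _).1 h
    obtain ⟨W', f'', i'', sq', hi⟩ := exists_isPullback_termsplit w σ f
    have e : (sq.isoIsPullback _ _ sq').hom ≫ i'' = p' := by simp
    rw [← e]
    exact (admissibleEpi_termsplit_iff _).2 fun n => (SplitEpic.of_iso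
      (((evaluation _ _).obj n).mapIso ((isNComplex C N).ι.mapIso (sq.isoIsPullback _ _ sq')))).comp
        ((admissibleEpi_termsplit_iff _).1 hi n)

end TermsplitExact

/-! ### Split monics and epics with complements, and split acyclic pairs. -/

section SplitLemmas

variable {C : Type u} [Category.{v} C] [Preadditive C]

/-- The kernel of `q` is a complement for every section of `q`, not only for the given one.
Idempotents need not split in `C`, so a complement has to be exhibited. -/
theorem SplitMonic.of_section {X Y : C} {i : X ⟶ Y} {q : Y ⟶ X} (hq : SplitEpic q)
    (hi : i ≫ q = 𝟙 X) : SplitMonic i := by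
  obtain ⟨K, κ, ρ, s, h₁, h₂, h₃, h₄⟩ := hq
  have e : ρ ≫ κ = 𝟙 _ - q ≫ s := by rw [← h₄, add_sub_cancel_right]
  refine ⟨K, ρ - q ≫ i ≫ ρ, q, κ, hi, ?_, ?_, ?_⟩
  · simp [h₁, reassoc_of% h₃]
  · simp [reassoc_of% hi]
  · simp [e, reassoc_of% hi]

theorem SplitEpic.of_retraction {X Y : C} {i : X ⟶ Y} {q : Y ⟶ X} (hi : SplitMonic i)
    (hq : i ≫ q = 𝟙 X) : SplitEpic q := by
  obtain ⟨K, p, r, s, h₁, h₂, h₃, h₄⟩ := hi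
  have e : p ≫ s = 𝟙 _ - r ≫ i := by rw [← h₄, add_sub_cancel_left]
  refine ⟨K, s - s ≫ q ≫ i, p, i, ?_, hq, ?_, ?_⟩
  · simp [h₂, h₃]
  · simp [hq]
  · simp [e, reassoc_of% e, reassoc_of% hq]

/-- Acyclic pairs for the split exact structure. -/
def SplitAcyclicPair {X' X X'' : C} (f : X' ⟶ X) (g : X ⟶ X'') : Prop :=
  ∃ (Z W : C) (e : X' ⟶ Z) (m : Z ⟶ X) (e' : X ⟶ W) (m' : W ⟶ X''),
    f = e ≫ m ∧ g = e' ≫ m' ∧ SplitEpic e ∧ SplitMonic m' ∧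
      ∃ w : m ≫ e' = 0, Nonempty (ShortComplex.mk m e' w).Splitting

end SplitLemmas

theorem NComplex.map_eq_zero {C : Type u} [Category.{v} C] [Preadditive C] {N : ℕ}
    (X : NComplex C N) {m n : ℤ} (φ : m ⟶ n) (h : m + N ≤ n) : X.obj.map φ = 0 := by
  have e : φ = homOfLE (by omega : m ≤ m + N) ≫ homOfLE h := Subsingleton.elim _ _
  rw [e, Functor.map_comp, X.property m (m + N) _ rfl, zero_comp]

/-! ### Projective-injective `N`-complexes and the Frobenius structure. -/

section Cofree

variable {C : Type u} [Category.{v} C] [Preadditive C] [HasFiniteBiproducts C] (A : ℤ → C)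

/-- The biproduct of the objects `A j` with `j ∈ s`. -/
noncomputable abbrev sumOver (s : Finset ℤ) : C := ⨁ fun j : s => A j

/-- The canonical morphism between two partial biproducts: the identity on common summands. -/
noncomputable def transfer (s t : Finset ℤ) : sumOver A s ⟶ sumOver A t :=
  biproduct.desc fun j => if h : j.1 ∈ t then biproduct.ι (fun j : t => A j) ⟨j, h⟩ else 0

variable {A}

theorem ι_transfer_of_mem {s t : Finset ℤ} (j : s) (h : j.1 ∈ t) :
    biproduct.ι (fun j : s => A j) j ≫ transfer A s t = biproduct.ι (fun j : t => A j) ⟨j, h⟩ := by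
  simp [transfer, h]

theorem ι_transfer_of_notMem {s t : Finset ℤ} (j : s) (h : j.1 ∉ t) :
    biproduct.ι (fun j : s => A j) j ≫ transfer A s t = 0 := by
  simp [transfer, h]

theorem transfer_π_of_mem {s t : Finset ℤ} (j : t) (h : j.1 ∈ s) :
    transfer A s t ≫ biproduct.π (fun j : t => A j) j = biproduct.π (fun j : s => A j) ⟨j, h⟩ := by
  ext i
  by_cases hi : i.1 ∈ t
  · rw [← Category.assoc, ι_transfer_of_mem i hi, biproduct.ι_π, biproduct.ι_π]
    rcases i with ⟨i, hi'⟩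
    rcases j with ⟨j, hj⟩
    by_cases hij : i = j
    · subst hij; simp
    · simp [hij]
  · rw [← Category.assoc, ι_transfer_of_notMem i hi, biproduct.ι_π_ne, zero_comp]
    rintro rfl
    exact hi j.2

theorem transfer_π_of_notMem {s t : Finset ℤ} (j : t) (h : j.1 ∉ s) :
    transfer A s t ≫ biproduct.π (fun j : t => A j) j = 0 := by
  ext i
  by_cases hi : i.1 ∈ t
  · rw [← Category.assoc, ι_transfer_of_mem i hi, biproduct.ι_π_ne, comp_zero]
    rintro rfl
    exact h i.2
  · rw [← Category.assoc, ι_transfer_of_notMem i hi, zero_comp, comp_zero]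

theorem transfer_self (s : Finset ℤ) : transfer A s s = 𝟙 _ := by
  refine biproduct.hom_ext' _ _ fun i => ?_
  rw [ι_transfer_of_mem i i.2, Category.comp_id]

/-- A summand survives both steps when its index lies in all three sets; the hypothesis says that no
common index of `s` and `r` is lost in `t`. For intervals this is a linear inequality. -/
theorem transfer_comp {s t r : Finset ℤ} (h : ∀ j ∈ s, j ∈ r → j ∈ t) :
    transfer A s t ≫ transfer A t r = transfer A s r := by
  refine biproduct.hom_ext' _ _ fun i => ?_
  by_cases hi : i.1 ∈ r
  · rw [← Category.assoc, ι_transfer_of_mem i (h i i.2 hi),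
      ι_transfer_of_mem (⟨i, h i i.2 hi⟩ : t) hi,
      ι_transfer_of_mem i hi]
  · rw [ι_transfer_of_notMem i hi, ← Category.assoc]
    by_cases hi' : i.1 ∈ t
    · rw [ι_transfer_of_mem i hi', ι_transfer_of_notMem (⟨i, hi'⟩ : t) hi]
    · rw [ι_transfer_of_notMem i hi', zero_comp]

theorem transfer_eq_zero {s t : Finset ℤ} (h : ∀ j ∈ s, j ∉ t) : transfer A s t = 0 := by
  refine biproduct.hom_ext' _ _ fun i => ?_
  rw [ι_transfer_of_notMem i (h i i.2), comp_zero]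

theorem transfer_total {s t r : Finset ℤ} (hs : s ⊆ t) (hr : r ⊆ t) (hd : ∀ j ∈ s, j ∉ r)
    (hc : ∀ j ∈ t, j ∈ s ∨ j ∈ r) :
    transfer A t s ≫ transfer A s t + transfer A t r ≫ transfer A r t = 𝟙 _ := by
  refine biproduct.hom_ext' _ _ fun i => ?_
  rw [Preadditive.comp_add, Category.comp_id]
  rcases hc i i.2 with hi | hi
  · rw [← Category.assoc, ι_transfer_of_mem i hi,
      ι_transfer_of_mem (⟨i, hi⟩ : s) (hs hi), ← Category.assoc,
      ι_transfer_of_notMem i (hd _ hi), zero_comp, add_zero]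
  · rw [← Category.assoc, ι_transfer_of_notMem i (fun h => hd _ h hi), zero_comp, zero_add,
      ← Category.assoc, ι_transfer_of_mem i hi,
      ι_transfer_of_mem (⟨i, hi⟩ : r) (hr hi)]

/-- The split exact sequence of partial biproducts given by a partition. -/
noncomputable def transferSplitting {s t r : Finset ℤ} (hs : s ⊆ t) (hr : r ⊆ t)
    (hd : ∀ j ∈ s, j ∉ r) (hc : ∀ j ∈ t, j ∈ s ∨ j ∈ r) : (ShortComplex.mk (transfer A s t)
      (transfer A t r) (by rw [transfer_comp (fun j hj _ => hs hj), transfer_eq_zero hd])).Splitting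
    where
  r := transfer A t s
  s := transfer A r t
  f_r := (transfer_comp fun _ hj _ => hs hj).trans (transfer_self _)
  s_g := (transfer_comp fun _ hj _ => hr hj).trans (transfer_self _)
  id := transfer_total hs hr hd hc

theorem splitEpic_transfer {t r : Finset ℤ} (hr : r ⊆ t) : SplitEpic (transfer A t r) := by
  let σ := transferSplitting (A := A) (s := t \ r) Finset.sdiff_subset hr
    (fun _ hj => (Finset.mem_sdiff.1 hj).2) (fun j hj => by
      by_cases h : j ∈ r
      · exact Or.inr h
      · exact Or.inl (Finset.mem_sdiff.2 ⟨hj, h⟩))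
  exact ⟨_, _, σ.r, σ.s, σ.f_r, σ.s_g, ShortComplex.zero _, σ.id⟩

theorem splitMonic_transfer {t s : Finset ℤ} (hs : s ⊆ t) : SplitMonic (transfer A s t) :=
  SplitMonic.of_section (splitEpic_transfer hs) (by
    rw [transfer_comp (fun j hj _ => hs hj), transfer_self])

theorem splitEpic_π {s : Finset ℤ} (j : s) : SplitEpic (biproduct.π (fun j : s => A j) j) := by
  have hj : ∀ i : s, i ≠ j → i.1 ∈ s.erase j := fun i hi =>
    Finset.mem_erase.2 ⟨fun h => hi (Subtype.ext h), i.2⟩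
  refine ⟨sumOver A (s.erase j), transfer A _ _, transfer A _ _,
    biproduct.ι (fun j : s => A j) j,
    (transfer_comp fun i hi _ => Finset.mem_of_mem_erase hi).trans (transfer_self _),
    biproduct.ι_π_self _ _, transfer_π_of_notMem _ (Finset.notMem_erase _ _), ?_⟩
  refine biproduct.hom_ext' _ _ fun i => ?_
  rw [Preadditive.comp_add, Category.comp_id]
  by_cases hi : i = j
  · subst hi
    rw [← Category.assoc, ι_transfer_of_notMem i (Finset.notMem_erase _ _), zero_comp, zero_add,
      ← Category.assoc, biproduct.ι_π_self, Category.id_comp]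
  · rw [← Category.assoc, ι_transfer_of_mem i (hj i hi),
      ι_transfer_of_mem (⟨i, hj i hi⟩ : ↥(s.erase j.1)) i.2, ← Category.assoc,
      biproduct.ι_π_ne _ hi, zero_comp, add_zero]

theorem splitMonic_ι {s : Finset ℤ} (j : s) : SplitMonic (biproduct.ι (fun j : s => A j) j) :=
  SplitMonic.of_section (splitEpic_π j) (biproduct.ι_π_self _ _)

variable (A) in
/-- The complex with `A n ⊞ ⋯ ⊞ A (n + N - 1)` in degree `n`. It is the direct sum of
the contractible complexes `A n = ⋯ = A n`. -/
noncomputable def cofree (N : ℕ) : NComplex C N :=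
  ⟨{ obj := fun n => sumOver A (Finset.Ico n (n + N))
     map := fun {m n} _ => transfer A _ _
     map_id := fun n => transfer_self _
     map_comp := fun {l m n} φ ψ => (transfer_comp fun j hj hj' => by
      have := leOfHom φ
      have := leOfHom ψ
      simp only [Finset.mem_Ico] at hj hj' ⊢
      omega).symm }, fun m n hmn hn => transfer_eq_zero fun j hj hj' => by
      simp only [Finset.mem_Ico] at hj hj'
      omega⟩

variable {N : ℕ}

/-- Morphisms into `cofree A N` are families of morphisms to the `A n`. -/
noncomputable def toCofree {X : NComplex C N} (φ : ∀ n, X.obj.obj n ⟶ A n) : X ⟶ cofree A N :=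
  NComplex.mkHom (fun n => biproduct.lift fun j : Finset.Ico n (n + N) =>
    X.obj.map (homOfLE (Finset.mem_Ico.1 j.2).1) ≫ φ j) fun m n α => by
    have : X.obj.map α ≫ (biproduct.lift fun j : Finset.Ico n (n + N) =>
        X.obj.map (homOfLE (Finset.mem_Ico.1 j.2).1) ≫ φ j) =
        (biproduct.lift fun j : Finset.Ico m (m + N) =>
        X.obj.map (homOfLE (Finset.mem_Ico.1 j.2).1) ≫ φ j) ≫ transfer A _ _ := by
      have hα := leOfHom α
      ext j
      rw [Category.assoc, Category.assoc, biproduct.lift_π, ← Functor.map_comp_assoc]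
      by_cases hj : j.1 ∈ Finset.Ico m (m + N)
      · rw [transfer_π_of_mem _ hj, biproduct.lift_π]
        rfl
      -- Here `j ≥ m + N`, so `X^m ⟶ X^j` vanishes: this is where the `N`-complex condition enters.
      · rw [transfer_π_of_notMem _ hj, comp_zero, X.map_eq_zero, zero_comp]
        have := Finset.mem_Ico.1 j.2
        simp only [Finset.mem_Ico] at hj
        omega
    exact this

/-- The projections of the summands of `cofree A N`. -/
noncomputable def cofreeπ (n : ℤ) (j : Finset.Ico n (n + N)) : (cofree A N).obj.obj n ⟶ A j :=
  biproduct.π (fun j : Finset.Ico n (n + N) => A j) j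

/-- The inclusions of the summands of `cofree A N`. -/
noncomputable def cofreeι (n : ℤ) (j : Finset.Ico n (n + N)) : A j ⟶ (cofree A N).obj.obj n :=
  biproduct.ι (fun j : Finset.Ico n (n + N) => A j) j

theorem cofree_hom_ext {n : ℤ} {W : C} {f g : W ⟶ (cofree A N).obj.obj n}
    (h : ∀ j, f ≫ cofreeπ n j = g ≫ cofreeπ n j) : f = g :=
  biproduct.hom_ext (f := fun j : Finset.Ico n (n + N) => A j) _ _ h

theorem cofree_hom_ext' {n : ℤ} {W : C} {f g : (cofree A N).obj.obj n ⟶ W}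
    (h : ∀ j, cofreeι n j ≫ f = cofreeι n j ≫ g) : f = g :=
  biproduct.hom_ext' (f := fun j : Finset.Ico n (n + N) => A j) _ _ h

theorem cofree_map_π {m n : ℤ} (φ : m ⟶ n) (j : Finset.Ico n (n + N))
    (hj : j.1 ∈ Finset.Ico m (m + N)) :
    (cofree A N).obj.map φ ≫ cofreeπ n j = cofreeπ m ⟨j, hj⟩ := transfer_π_of_mem _ hj

theorem cofreeι_map {m n : ℤ} (φ : m ⟶ n) {j : ℤ} (hm : j ∈ Finset.Ico m (m + N))
    (hn : j ∈ Finset.Ico n (n + N)) :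
    cofreeι m ⟨j, hm⟩ ≫ (cofree A N).obj.map φ = cofreeι n ⟨j, hn⟩ :=
  ι_transfer_of_mem (⟨j, hm⟩ : Finset.Ico m (m + N)) hn

theorem toCofree_app_π {X : NComplex C N} (φ : ∀ n, X.obj.obj n ⟶ A n) (n : ℤ)
    (j : Finset.Ico n (n + N)) : (toCofree φ).hom.app n ≫ cofreeπ n j =
      X.obj.map (homOfLE (Finset.mem_Ico.1 j.2).1) ≫ φ j := biproduct.lift_π _ _

/-- The components of a morphism into `cofree A N`. -/
noncomputable def ofToCofree (hN : 0 < N) {X : NComplex C N} (f : X ⟶ cofree A N) (n : ℤ) :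
    X.obj.obj n ⟶ A n :=
  f.hom.app n ≫ cofreeπ n ⟨n, by simp [hN]⟩

theorem toCofree_ofToCofree (hN : 0 < N) {X : NComplex C N} (f : X ⟶ cofree A N) :
    toCofree (ofToCofree hN f) = f := NComplex.hom_ext fun n => cofree_hom_ext fun j => by
  rw [toCofree_app_π, ofToCofree, NComplex.naturality_assoc]
  exact congrArg _ (cofree_map_π (homOfLE (Finset.mem_Ico.1 j.2).1) ⟨j.1, by simp [hN]⟩ j.2)

/-- A morphism into `cofree A N` is an arbitrary family of morphisms to the `A n`. Degreewise
retractions therefore suffice to extend it, although they do not commute with the differentials. -/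
theorem isInjective_cofree (hN : 0 < N) : IsInjective (termsplit C N) (cofree A N) := by
  intro X Y i hi f
  have hi' := (admissibleMono_termsplit_iff _).1 hi
  choose Z p r s h₁ h₂ h₃ h₄ using hi'
  refine ⟨toCofree fun n => r n ≫ ofToCofree hN f n, ?_⟩
  conv_rhs => rw [← toCofree_ofToCofree hN f]
  refine NComplex.hom_ext fun n => cofree_hom_ext fun j => ?_
  refine (Category.assoc (i.hom.app n) _ _).trans ?_
  rw [toCofree_app_π, toCofree_app_π, ← NComplex.naturality_assoc, reassoc_of% (h₁ j)]

/-- Morphisms out of `cofree A N`. -/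
noncomputable def fromCofree {X : NComplex C N} (ψ : ∀ n : ℤ, A n ⟶ X.obj.obj (n - N + 1)) :
    cofree A N ⟶ X :=
  NComplex.mkHom (fun n => biproduct.desc fun j : Finset.Ico n (n + N) =>
    ψ j ≫ X.obj.map (homOfLE (by have := Finset.mem_Ico.1 j.2; omega))) fun m n α => by
    have : transfer A _ _ ≫ (biproduct.desc fun j : Finset.Ico n (n + N) =>
        ψ j ≫ X.obj.map (homOfLE (by have := Finset.mem_Ico.1 j.2; omega))) =
        (biproduct.desc fun j : Finset.Ico m (m + N) =>
        ψ j ≫ X.obj.map (homOfLE (by have := Finset.mem_Ico.1 j.2; omega))) ≫ X.obj.map α := by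
      have hα := leOfHom α
      ext j
      rw [biproduct.ι_desc_assoc, Category.assoc, ← Functor.map_comp, ← Category.assoc]
      by_cases hj : j.1 ∈ Finset.Ico n (n + N)
      · rw [ι_transfer_of_mem _ hj, biproduct.ι_desc]
        rfl
      · rw [ι_transfer_of_notMem _ hj, zero_comp, X.map_eq_zero, comp_zero]
        have := Finset.mem_Ico.1 j.2
        simp only [Finset.mem_Ico] at hj
        omega
    exact this

theorem ι_fromCofree_app {X : NComplex C N} (ψ : ∀ n : ℤ, A n ⟶ X.obj.obj (n - N + 1)) (n : ℤ)
    (j : Finset.Ico n (n + N)) : cofreeι n j ≫ (fromCofree ψ).hom.app n =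
      ψ j ≫ X.obj.map (homOfLE (by have := Finset.mem_Ico.1 j.2; omega)) := biproduct.ι_desc _ _

/-- The components of a morphism out of `cofree A N`. -/
noncomputable def ofFromCofree (hN : 0 < N) {X : NComplex C N} (f : cofree A N ⟶ X) (n : ℤ) :
    A n ⟶ X.obj.obj (n - N + 1) :=
  cofreeι (n - N + 1) ⟨n, by simp; omega⟩ ≫ f.hom.app (n - N + 1)

theorem fromCofree_ofFromCofree (hN : 0 < N) {X : NComplex C N} (f : cofree A N ⟶ X) :
    fromCofree (ofFromCofree hN f) = f := NComplex.hom_ext fun n => cofree_hom_ext' fun j => by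
  rw [ι_fromCofree_app, ofFromCofree, Category.assoc, ← NComplex.naturality, ← Category.assoc]
  have : cofreeι (A := A) (N := N) (j.1 - N + 1) ⟨j.1, by simp; omega⟩ ≫ (cofree A N).obj.map
      (homOfLE (by have := Finset.mem_Ico.1 j.2; omega)) = cofreeι n j :=
    cofreeι_map _ _ j.2
  exact congrArg (· ≫ f.hom.app n) this

/-- The summand `A n` occupies the degrees `n - N + 1, …, n`. A morphism out of it is determined by
its freely chosen component in the lowest of these, so it can be lifted with degreewise sections. -/
theorem isProjective_cofree (hN : 0 < N) : IsProjective (termsplit C N) (cofree A N) := by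
  intro X Y p hp f
  have hp' := (admissibleEpi_termsplit_iff _).1 hp
  choose Z i r s h₁ h₂ h₃ h₄ using hp'
  refine ⟨fromCofree fun n => ofFromCofree hN f n ≫ s _, ?_⟩
  conv_rhs => rw [← fromCofree_ofFromCofree hN f]
  refine NComplex.hom_ext fun n => cofree_hom_ext' fun j => ?_
  refine (Category.assoc _ _ (p.hom.app n)).symm.trans ?_
  rw [ι_fromCofree_app, ι_fromCofree_app, Category.assoc, Category.assoc, NComplex.naturality,
    reassoc_of% (h₂ _)]

theorem admissibleMono_toCofree (hN : 0 < N) (X : NComplex C N) :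
    AdmissibleMono (termsplit C N) (toCofree (A := X.obj.obj) fun n => 𝟙 (X.obj.obj n)) := by
  refine (admissibleMono_termsplit_iff _).2 fun n => ?_
  refine SplitMonic.of_section (splitEpic_π (A := X.obj.obj) (s := Finset.Ico n (n + N))
    ⟨n, by simp [hN]⟩) ((toCofree_app_π _ n _).trans ?_)
  exact (Category.comp_id _).trans (X.obj.map_id n)

theorem admissibleEpi_fromCofree (hN : 0 < N) (X : NComplex C N) :
    AdmissibleEpi (termsplit C N) (fromCofree (A := fun n => X.obj.obj (n - N + 1))
      fun n => 𝟙 (X.obj.obj (n - N + 1))) := by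
  refine (admissibleEpi_termsplit_iff _).2 fun n => ?_
  obtain ⟨m, hm, hm'⟩ : ∃ m : ℤ, m ∈ Finset.Ico n (n + N) ∧ m - N + 1 = n :=
    -- The summand of index `n + N - 1` begins in degree `n`, so it maps to `X^n` by the identity.
    ⟨n + N - 1, by simp; omega, by omega⟩
  have h := ι_fromCofree_app (A := fun n => X.obj.obj (n - N + 1))
    (fun n => 𝟙 (X.obj.obj (n - N + 1))) n ⟨m, hm⟩
  have h' := splitMonic_ι (A := fun n => X.obj.obj (n - N + 1)) (s := Finset.Ico n (n + N)) ⟨m, hm⟩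
  subst hm'
  exact SplitEpic.of_retraction h' (h.trans ((Category.id_comp _).trans (X.obj.map_id _)))

/-- Projectives are retracts of covers and injectives are retracts of hulls. Both are cofree
complexes, which are projective and injective. -/
theorem isFrobenius_termsplit [HasZeroObject C] [HasBinaryBiproducts C] (hN : 0 < N) :
    IsFrobenius (termsplit C N) where
  exact := isExactCategory_termsplit C N
  enoughInjectives X := ⟨_, _, isInjective_cofree hN, admissibleMono_toCofree hN X⟩
  enoughProjectives X := ⟨_, _, isProjective_cofree hN, admissibleEpi_fromCofree hN X⟩
  projective_iff_injective X := by
    constructor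
    · intro h
      obtain ⟨s, hs⟩ := h _ (admissibleEpi_fromCofree hN X) (𝟙 X)
      exact (isInjective_cofree hN).of_retract s _ hs
    · intro h
      obtain ⟨s, hs⟩ := h _ (admissibleMono_toCofree hN X) (𝟙 X)
      exact (isProjective_cofree hN).of_retract _ s hs

/-- The interval `[n, n + N)` splits at `n + r`: the left part is the image of the incoming map and
the right part the image of the outgoing one. -/
theorem splitAcyclicPair_cofree {m n l : ℤ} {r : ℕ} (hr : r ≤ N) (hm : m = n - N + r)
    (hl : l = n + r) (φ : m ⟶ n) (ψ : n ⟶ l) :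
    SplitAcyclicPair ((cofree A N).obj.map φ) ((cofree A N).obj.map ψ) := by
  refine ⟨sumOver A (Finset.Ico n (n + r)), sumOver A (Finset.Ico (n + r) (n + N)),
    transfer A _ _, transfer A _ _, transfer A _ _, transfer A _ _, (transfer_comp ?_).symm,
    (transfer_comp ?_).symm, splitEpic_transfer ?_, splitMonic_transfer ?_, ?_,
    ⟨transferSplitting ?_ ?_ ?_ ?_⟩⟩
  case refine_5 =>
    exact (transfer_comp (by intro j; simp only [Finset.mem_Ico]; omega)).trans
      (transfer_eq_zero (by intro j; simp only [Finset.mem_Ico]; omega))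
  all_goals intro j; simp only [Finset.mem_Ico]; omega

end Cofree

/-! ### Extensions of acyclic pairs. -/

section AcyclicPair

variable {C : Type u} [Category.{v} C] [Preadditive C] {S : ObjectProperty (ShortComplex C)}

namespace IsExactCategory

theorem admissibleMono_biprod_map (hS : IsExactCategory S) [HasBinaryBiproducts C] {X Y : C}
    {i : X ⟶ Y} (hi : AdmissibleMono S i) (Z : C) : AdmissibleMono S (biprod.map i (𝟙 Z)) := by
  refine hS.pushout i biprod.inl biprod.inl _ hi ⟨⟨by simp⟩, ⟨PushoutCocone.IsColimit.mk _
    (fun c => biprod.desc c.inl (biprod.inr ≫ c.inr)) (fun c => ?_) (fun c => ?_)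
    fun c m h₁ h₂ => ?_⟩⟩
  · simp
  · ext
    · simp [c.condition]
    · simp
  · ext
    · simp [h₁]
    · simp [← h₂]

theorem admissibleEpi_biprod_map (hS : IsExactCategory S) [HasBinaryBiproducts C] {X Y : C}
    {p : X ⟶ Y} (hp : AdmissibleEpi S p) (Z : C) : AdmissibleEpi S (biprod.map p (𝟙 Z)) := by
  refine hS.pullback biprod.fst _ p biprod.fst hp ⟨⟨by simp⟩, ⟨PullbackCone.IsLimit.mk _
    (fun c => biprod.lift c.fst (c.snd ≫ biprod.snd)) (fun c => ?_) (fun c => ?_)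
    fun c m h₁ h₂ => ?_⟩⟩
  · simp
  · ext
    · simp [c.condition]
    · simp
  · ext
    · simp [h₁]
    · simp [← h₂]

theorem admissibleMono_id_biprod_map (hS : IsExactCategory S) [HasBinaryBiproducts C] {X Y : C}
    {i : X ⟶ Y} (hi : AdmissibleMono S i) (Z : C) : AdmissibleMono S (biprod.map (𝟙 Z) i) := by
  have := hS.comp_mono _ _ (hS.comp_mono _ _ (hS.admissibleMono_iso (biprod.braiding Z X))
    (hS.admissibleMono_biprod_map hi Z)) (hS.admissibleMono_iso (biprod.braiding Y Z))
  convert this using 1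
  ext <;> simp

theorem conflation_of_isPullback (hS : IsExactCategory S) [HasBinaryBiproducts C] {W X Y Z : C}
    {p : X ⟶ Z} (hp : AdmissibleEpi S p) {f : Y ⟶ Z} {f' : W ⟶ X} {p' : W ⟶ Y}
    (sq : IsPullback f' p' p (-f)) :
    S (.mk (biprod.lift f' p') (biprod.desc p f) (by simp [sq.w])) := by
  have hp' : AdmissibleEpi S (biprod.desc p f) := by
    have h₁ : AdmissibleEpi S (biprod.fst : Z ⊞ Y ⟶ Z) :=
      ⟨Y, biprod.inr, by simp, hS.of_splitting
        { r := biprod.snd, s := biprod.inl, id := by rw [add_comm]; exact biprod.total }⟩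
    have h₂ := hS.admissibleEpi_iso (C := C) (X := Z ⊞ Y) (Y := Z ⊞ Y)
      ⟨biprod.desc biprod.inl (biprod.lift f (𝟙 _)), biprod.desc biprod.inl (biprod.lift (-f) (𝟙 _)),
        by ext <;> simp, by ext <;> simp⟩
    have := hS.comp_epi _ _ (hS.comp_epi _ _ (hS.admissibleEpi_biprod_map hp Y) h₂) h₁
    convert this using 1
    ext <;> simp
  have : Mono (biprod.lift f' p') := ⟨fun a b hab => by
    have h₁ := hab =≫ biprod.fst
    have h₂ := hab =≫ biprod.snd
    simp only [Category.assoc, biprod.lift_fst, biprod.lift_snd] at h₁ h₂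
    exact sq.hom_ext h₁ h₂⟩
  refine hS.conflation_of_kernel hp' _ fun W k hk => ?_
  have e : (k ≫ biprod.fst) ≫ p = (k ≫ biprod.snd) ≫ (-f) := by
    rw [biprod.desc_eq, Preadditive.comp_add] at hk
    simpa using eq_neg_of_add_eq_zero_left hk
  exact ⟨sq.lift _ _ e, by ext <;> simp⟩

/-- Acyclicity of an upper triangular extension of acyclic pairs. -/
theorem isAcyclicPair_biprod (hS : IsExactCategory S) [HasBinaryBiproducts C]
    {X₁ X₂ X₃ Z₁ Z₂ Z₃ : C} {f : X₁ ⟶ X₂} {g : X₂ ⟶ X₃} {f' : Z₁ ⟶ Z₂} {g' : Z₂ ⟶ Z₃}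
    (hX : IsAcyclicPair S f g) (hZ : IsAcyclicPair S f' g') (s : Z₁ ⟶ X₂) (t : Z₂ ⟶ X₃)
    (w : s ≫ g + f' ≫ t = 0) :
    IsAcyclicPair S (biprod.desc (biprod.lift f 0) (biprod.lift s f'))
      (biprod.desc (biprod.lift g 0) (biprod.lift t g')) := by
  obtain ⟨K, L, e, m, p, q, hmp, rfl, rfl, he, hq, hX⟩ := hX
  obtain ⟨K', L', e', m', p', q', hmp', rfl, rfl, he', hq', hZ⟩ := hZ
  have : Mono q := hS.mono_f hq.choose_spec.choose_spec.choose_spec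
  have : Epi e' := hS.epi_g he'.choose_spec.choose_spec.choose_spec
  have : Epi p := hS.epi_g hX
  have : Mono m' := hS.mono_f hZ
  -- the connecting morphism
  obtain ⟨d, hd, hd'⟩ : ∃ d : K' ⟶ L, e' ≫ d = -(s ≫ p) ∧ d ≫ q = m' ≫ t := by
    obtain ⟨A, k, wk, hk⟩ := he'
    obtain ⟨d, hd⟩ := hS.exists_desc hk (-(s ≫ p)) (by
      rw [← cancel_mono q, zero_comp, Preadditive.comp_neg, Preadditive.neg_comp, neg_eq_zero]
      have := k ≫= w
      simpa [reassoc_of% wk] using this)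
    refine ⟨d, hd, ?_⟩
    rw [← cancel_epi e', reassoc_of% hd, Preadditive.neg_comp, Category.assoc]
    rw [Category.assoc] at w
    exact neg_eq_of_add_eq_zero_right w
  have hp : AdmissibleEpi S p := ⟨_, _, _, hX⟩
  have hm' : AdmissibleMono S m' := ⟨_, _, _, hZ⟩
  have := hS.hasPullback p (-d) hp
  have := hS.hasPushout m' (-d) hm'
  -- An element `(x, z)` is killed by the second matrix when `z = m' k'` and `p x = -d k'`. So the
  -- kernel is a pullback, an extension of `K'` by `K`; dually the image of the second matrix is a
  -- pushout, an extension of `L'` by `L`.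
  obtain ⟨KY, u, v, sq⟩ : ∃ (KY : C) (u : KY ⟶ X₂) (v : KY ⟶ K'), IsPullback u v p (-d) :=
    ⟨_, _, _, IsPullback.of_hasPullback p (-d)⟩
  obtain ⟨LY, α, β, sq'⟩ : ∃ (LY : C) (α : Z₂ ⟶ LY) (β : L ⟶ LY), IsPushout m' (-d) α β :=
    ⟨_, _, _, IsPushout.of_hasPushout m' (-d)⟩
  have hKY := hS.conflation_of_isPullback hp sq
  -- the epic onto the kernel
  obtain ⟨κ, hκ₁, hκ₂⟩ : ∃ κ : K ⟶ KY, κ ≫ u = m ∧ κ ≫ v = 0 :=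
    ⟨sq.lift m 0 (by rw [hmp, zero_comp]), by simp, by simp⟩
  have hκ := hS.pullback_conflation hX sq hκ₁ hκ₂
  have := hS.mono_f hκ
  obtain ⟨σ, hσ₁, hσ₂⟩ : ∃ σ : Z₁ ⟶ KY, σ ≫ u = s ∧ σ ≫ v = e' :=
    ⟨sq.lift s e' (by simp [hd]), by simp, by simp⟩
  -- It is the pullback of `e'` along `v`: the lift `σ` of `e'` together with the kernel `κ` of `v`
  -- parametrizes the fibre product.
  have he₂ : AdmissibleEpi S (biprod.desc κ σ) := by
    refine hS.pullback biprod.snd _ e' v he' ⟨⟨by ext <;> simp [hκ₂, hσ₂]⟩, ⟨?_⟩⟩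
    have hl : ∀ c : PullbackCone e' v, ∃ l : c.pt ⟶ K,
        l ≫ κ = c.snd - c.fst ≫ σ := fun c =>
      hS.exists_lift hκ _ (by simp [c.condition, hσ₂])
    choose l hl using hl
    refine PullbackCone.IsLimit.mk _ (fun c => biprod.lift (l c) c.fst) (fun c => by simp)
      (fun c => by simp [hl]) fun c k h₁ h₂ => ?_
    ext
    · rw [biprod.lift_fst, ← cancel_mono κ, hl, ← h₂, ← h₁, biprod.desc_eq]
      simp
    · simpa using h₁
  have hYe := hS.comp_epi _ _ (hS.admissibleEpi_biprod_map he Z₁) he₂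
  -- the monic out of the cokernel
  obtain ⟨π, hπ₁, hπ₂⟩ : ∃ π : LY ⟶ L', α ≫ π = p' ∧ β ≫ π = 0 :=
    ⟨sq'.desc p' 0 (by rw [hmp', comp_zero]), by simp, by simp⟩
  have hπ := hS.pushout_conflation hZ sq' hπ₁ hπ₂
  have := hS.epi_g hπ
  obtain ⟨ρ, hρ₁, hρ₂⟩ : ∃ ρ : LY ⟶ X₃, α ≫ ρ = -t ∧ β ≫ ρ = q :=
    ⟨sq'.desc (-t) q (by simp [hd']), by simp, by simp⟩
  have hq₂ : AdmissibleMono S (biprod.lift ρ π) := by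
    refine hS.pushout q β biprod.inl _ hq ⟨⟨by ext <;> simp [hρ₂, hπ₂]⟩, ⟨?_⟩⟩
    have hl : ∀ c : PushoutCocone q β, ∃ l : L' ⟶ c.pt,
        π ≫ l = c.inr - ρ ≫ c.inl := fun c =>
      hS.exists_desc hπ _ (by rw [Preadditive.comp_sub, reassoc_of% hρ₂, c.condition, sub_self])
    choose l hl using hl
    refine PushoutCocone.IsColimit.mk _ (fun c => biprod.desc c.inl (l c)) (fun c => by simp)
      (fun c => by simp [hl]) fun c k h₁ h₂ => ?_
    ext
    · simpa using h₁
    · rw [biprod.inr_desc, ← cancel_epi π, hl, ← h₂, ← h₁, biprod.lift_eq]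
      simp
  have hYq := hS.comp_mono _ _ hq₂ (hS.admissibleMono_id_biprod_map hq' X₃)
  -- the short exact sequence
  have hm₂ := hS.comp_mono _ _ ⟨_, _, _, hKY⟩ (hS.admissibleMono_id_biprod_map hm' X₂)
  have : Epi (biprod.desc (p ≫ β) (-α)) := ⟨fun a b hab => by
    have h₁ := biprod.inl ≫= hab
    have h₂ := biprod.inr ≫= hab
    simp only [biprod.inl_desc_assoc, Category.assoc, cancel_epi] at h₁
    simp only [biprod.inr_desc_assoc, Preadditive.neg_comp, neg_inj] at h₂
    exact sq'.hom_ext h₂ h₁⟩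
  have hw : (biprod.lift u v ≫ biprod.map (𝟙 X₂) m') ≫ biprod.desc (p ≫ β) (-α) = 0 := by
    rw [Category.assoc, biprod.lift_eq]
    simp [sq'.w, reassoc_of% sq.w]
  have hY : S (.mk _ _ hw) := by
    refine hS.conflation_of_cokernel hm₂ hw fun W k hk => ?_
    obtain ⟨l, hl⟩ := hS.exists_desc hKY (biprod.map (𝟙 X₂) m' ≫ k) (by simpa using hk)
    have h₁ := biprod.inl ≫= hl
    have h₂ := biprod.inr ≫= hl
    simp only [biprod.inl_desc_assoc, biprod.inl_map_assoc, Category.id_comp] at h₁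
    simp only [biprod.inr_desc_assoc, biprod.inr_map_assoc] at h₂
    exact ⟨sq'.desc (-(biprod.inr ≫ k)) l (by simp [h₂]), by ext <;> simp [h₁]⟩
  -- The final factor with `-𝟙` undoes the sign of `-α` in the cokernel map.
  refine ⟨KY, LY, _, _, _, biprod.lift ρ π ≫ biprod.map (𝟙 X₃) q' ≫
    biprod.map (𝟙 X₃) (-𝟙 _), hw, ?_, ?_, hYe, ?_, hY⟩
  · ext <;> simp [hσ₁, reassoc_of% hσ₂, reassoc_of% hκ₂, hκ₁]
  · ext <;> simp [hρ₁, hρ₂, reassoc_of% hπ₁, reassoc_of% hπ₂]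
  · have := hS.comp_mono _ _ hYq (hS.admissibleMono_iso
      (biprod.mapIso (Iso.refl X₃) ⟨-𝟙 Z₃, -𝟙 Z₃, by simp, by simp⟩))
    simpa using this

end IsExactCategory

end AcyclicPair

/-! ### Stable properties of pairs: acyclicity and exactness under `Hom(-, P)`. -/

section PairProperty

/-- Properties of pairs of composable morphisms. -/
abbrev PairProperty (C : Type u) [Category.{v} C] :=
  ∀ ⦃X' X X'' : C⦄, (X' ⟶ X) → (X ⟶ X'') → Prop

/-- The formal properties shared by the various notions of acyclicity for pairs. -/
structure PairProperty.IsStable {C : Type u} [Category.{v} C] [Preadditive C]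
    (W : PairProperty C) : Prop where
  of_iso : ∀ ⦃X' X X'' Y' Y Y'' : C⦄ {f : X' ⟶ X} {g : X ⟶ X''} {f' : Y' ⟶ Y} {g' : Y ⟶ Y''}
    (a : X' ≅ Y') (b : X ≅ Y) (c : X'' ≅ Y''), f ≫ b.hom = a.hom ≫ f' →
    g ≫ c.hom = b.hom ≫ g' → W f g → W f' g'
  comp : ∀ ⦃X' X X'' Y' Y'' : C⦄ {f : X' ⟶ X} {g : X ⟶ X''} {e : Y' ⟶ X'} {m : X'' ⟶ Y''},
    SplitEpic e → SplitMonic m → W f g → W (e ≫ f) (g ≫ m)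
  split : ∀ T : ShortComplex C, T.Splitting → W T.f T.g
  ext : ∀ ⦃T₁ T₂ T₃ : ShortComplex C⦄ (Φ : T₁ ⟶ T₂) (Ψ : T₂ ⟶ T₃), T₁.Splitting →
    T₂.Splitting → T₃.Splitting → Φ.τ₂ ≫ Ψ.τ₂ = 0 → W Φ.τ₁ Ψ.τ₁ → W Φ.τ₃ Ψ.τ₃ → W Φ.τ₂ Ψ.τ₂

/-- The inverse image of a property of pairs under a functor. -/
def PairProperty.inverseImage {C : Type u} [Category.{v} C] {D : Type u'} [Category.{v'} D]
    (W : PairProperty D) (F : C ⥤ D) : PairProperty C := fun _ _ _ f g => W (F.map f) (F.map g)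

/-- Exactness after applying the functor `Hom(-, P)`. -/
def HomExact {C : Type u} [Category.{v} C] [Preadditive C] (P : C) : PairProperty C :=
  fun _ X X'' f g => (∀ z : X'' ⟶ P, f ≫ g ≫ z = 0) ∧ ∀ y : X ⟶ P, f ≫ y = 0 → ∃ z : X'' ⟶ P, g ≫ z = y

variable {C : Type u} [Category.{v} C] [Preadditive C] {D : Type u'} [Category.{v'} D]
  [Preadditive D]

theorem SplitEpic.map {X Y : C} {p : X ⟶ Y} (h : SplitEpic p) (F : C ⥤ D) [F.Additive] :
    SplitEpic (F.map p) := by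
  obtain ⟨K, κ, ρ, s, h₁, h₂, h₃, h₄⟩ := h
  refine ⟨_, F.map κ, F.map ρ, F.map s, ?_, ?_, ?_, ?_⟩ <;>
    simp only [← Functor.map_comp, ← F.map_add, h₁, h₂, h₃, h₄, CategoryTheory.Functor.map_id,
      F.map_zero]

theorem SplitMonic.map {X Y : C} {p : X ⟶ Y} (h : SplitMonic p) (F : C ⥤ D) [F.Additive] :
    SplitMonic (F.map p) := by
  obtain ⟨K, κ, ρ, s, h₁, h₂, h₃, h₄⟩ := h
  refine ⟨_, F.map κ, F.map ρ, F.map s, ?_, ?_, ?_, ?_⟩ <;>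
    simp only [← Functor.map_comp, ← F.map_add, h₁, h₂, h₃, h₄, CategoryTheory.Functor.map_id,
      F.map_zero]

namespace PairProperty.IsStable

theorem inverseImage {W : PairProperty D} (hW : W.IsStable) (F : C ⥤ D) [F.Additive] :
    (W.inverseImage F).IsStable where
  of_iso _ _ _ _ _ _ f g f' g' a b c h₁ h₂ h := hW.of_iso (F.mapIso a) (F.mapIso b) (F.mapIso c)
    (by simp only [Functor.mapIso_hom, ← F.map_comp, h₁])
    (by simp only [Functor.mapIso_hom, ← F.map_comp, h₂]) h
  comp _ _ _ _ _ f g e m he hm h := by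
    have := hW.comp (he.map F) (hm.map F) h
    rwa [← F.map_comp, ← F.map_comp] at this
  split T σ := hW.split (T.map F) (σ.map F)
  ext T₁ T₂ T₃ Φ Ψ σ₁ σ₂ σ₃ w h₁ h₃ := hW.ext (F.mapShortComplex.map Φ) (F.mapShortComplex.map Ψ)
    (σ₁.map F) (σ₂.map F) (σ₃.map F) ((F.map_comp _ _).symm.trans (by
      rw [w]
      exact F.map_zero _ _)) h₁ h₃

variable {W : PairProperty C}

theorem of_splitAcyclicPair (hW : W.IsStable) {X' X X'' : C} {f : X' ⟶ X} {g : X ⟶ X''}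
    (h : SplitAcyclicPair f g) : W f g := by
  obtain ⟨Z, Y, e, m, e', m', rfl, rfl, he, hm, w, ⟨σ⟩⟩ := h
  exact hW.comp he hm (hW.split _ σ)

theorem of_isZero (hW : W.IsStable) {X' X X'' : C} (f : X' ⟶ X) (g : X ⟶ X'') (hX : IsZero X) :
    W f g := by
  have h := hW.split (.mk (0 : X ⟶ X) (0 : X ⟶ X) (by simp))
    ⟨0, 0, hX.eq_of_src _ _, hX.eq_of_src _ _, hX.eq_of_src _ _⟩
  have := hW.comp (e := f) (m := g)
    ⟨X', 𝟙 _, 𝟙 _, 0, by simp, hX.eq_of_src _ _, hX.eq_of_tgt _ _, by simp⟩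
    ⟨X'', 𝟙 _, 0, 𝟙 _, hX.eq_of_src _ _, by simp, hX.eq_of_src _ _, by simp⟩ h
  convert this using 1
  · exact hX.eq_of_tgt _ _
  · exact hX.eq_of_src _ _

/-- A direct sum of pairs is a split extension of one by the other. -/
theorem biprod_map (hW : W.IsStable) [HasBinaryBiproducts C] {X' X X'' Y' Y Y'' : C} {f : X' ⟶ X}
    {g : X ⟶ X''} {f' : Y' ⟶ Y} {g' : Y ⟶ Y''} (h : W f g) (h' : W f' g') (w : f ≫ g = 0)
    (w' : f' ≫ g' = 0) : W (biprod.map f f') (biprod.map g g') := by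
  have σ : ∀ A B : C, (ShortComplex.mk (biprod.inl : A ⟶ A ⊞ B) biprod.snd (by simp)).Splitting :=
    fun A B => { r := biprod.fst, s := biprod.inr, id := by simp }
  exact hW.ext (T₁ := .mk (biprod.inl : X' ⟶ X' ⊞ Y') biprod.snd (by simp))
    (T₂ := .mk (biprod.inl : X ⟶ X ⊞ Y) biprod.snd (by simp))
    (T₃ := .mk (biprod.inl : X'' ⟶ X'' ⊞ Y'') biprod.snd (by simp))
    ⟨f, biprod.map f f', f', by simp, by simp⟩ ⟨g, biprod.map g g', g', by simp, by simp⟩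
    (σ _ _) (σ _ _) (σ _ _) (by ext <;> simp [reassoc_of% w, reassoc_of% w']) h h'

end PairProperty.IsStable

theorem isStable_homExact (P : C) : (HomExact P).IsStable where
  of_iso _ _ _ _ _ _ f g f' g' a b c h₁ h₂ h := by
    refine ⟨fun z => ?_, fun y hy => ?_⟩
    · rw [← cancel_epi a.hom, ← reassoc_of% h₁, ← reassoc_of% h₂, h.1, comp_zero]
    · obtain ⟨z, hz⟩ := h.2 (b.hom ≫ y) (by rw [reassoc_of% h₁, hy, comp_zero])
      exact ⟨c.inv ≫ z, by rw [← cancel_epi b.hom, ← reassoc_of% h₂, c.hom_inv_id_assoc, hz]⟩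
  comp X' X X'' Y' Y'' f g e m he hm h := by
    obtain ⟨K, κ, ρ, s, -, h₂, -, -⟩ := he
    obtain ⟨K', κ', ρ', s', h₁', -, -, -⟩ := hm
    refine ⟨fun z => by simp [h.1], fun y hy => ?_⟩
    obtain ⟨z, hz⟩ := h.2 y (by
      have := s ≫= hy
      rwa [Category.assoc, reassoc_of% h₂, comp_zero] at this)
    exact ⟨ρ' ≫ z, by rw [Category.assoc, reassoc_of% h₁', hz]⟩
  split T σ := ⟨fun z => by rw [← Category.assoc, T.zero, zero_comp], fun y hy => ⟨σ.s ≫ y, by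
    rw [← Category.assoc, σ.g_s]
    simp [hy]⟩⟩
  ext T₁ T₂ T₃ Φ Ψ σ₁ σ₂ σ₃ w h₁ h₃ := by
    refine ⟨fun z => by rw [← Category.assoc, w, zero_comp], fun y hy => ?_⟩
    obtain ⟨z, hz⟩ := h₁.2 (T₂.f ≫ y) (by rw [← Category.assoc, Φ.comm₁₂, Category.assoc, hy, comp_zero])
    -- After subtracting a solution on the subobject, `y` vanishes on `T₂.f` and descends to the
    -- quotient, where exactness of the third pair applies.
    have e : T₂.g ≫ σ₂.s ≫ (y - Ψ.τ₂ ≫ σ₃.r ≫ z) = y - Ψ.τ₂ ≫ σ₃.r ≫ z := by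
      rw [← Category.assoc, σ₂.g_s, Preadditive.sub_comp, Category.id_comp, sub_eq_self,
        Category.assoc, Preadditive.comp_sub, ← hz, ← reassoc_of% Ψ.comm₁₂, reassoc_of% σ₃.f_r,
        sub_self, comp_zero]
    obtain ⟨t, ht⟩ := h₃.2 (σ₂.s ≫ (y - Ψ.τ₂ ≫ σ₃.r ≫ z)) (by
      rw [← Category.id_comp Φ.τ₃, ← σ₁.s_g, Category.assoc, Category.assoc, ← reassoc_of% Φ.comm₂₃,
        e, Preadditive.comp_sub, hy, reassoc_of% w, zero_comp, sub_zero, comp_zero])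
    refine ⟨σ₃.r ≫ z + T₃.g ≫ t, ?_⟩
    rw [Preadditive.comp_add, reassoc_of% Ψ.comm₂₃, ht, e, add_sub_cancel]

/-- Only the extension property is not formal. The splittings identify the middle pair with a pair
of triangular matrices, to which `isAcyclicPair_biprod` applies; its compatibility condition is the
off-diagonal entry of the zero composite. -/
theorem isStable_isAcyclicPair {S : ObjectProperty (ShortComplex C)} (hS : IsExactCategory S) :
    PairProperty.IsStable (fun _ _ _ f g => IsAcyclicPair S f g) := by
  have := hS.hasBinaryBiproducts
  have hiso : ∀ ⦃X' X X'' Y' Y Y'' : C⦄ {f : X' ⟶ X} {g : X ⟶ X''} {f' : Y' ⟶ Y} {g' : Y ⟶ Y''}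
      (a : X' ≅ Y') (b : X ≅ Y) (c : X'' ≅ Y''), f ≫ b.hom = a.hom ≫ f' →
      g ≫ c.hom = b.hom ≫ g' → IsAcyclicPair S f g → IsAcyclicPair S f' g' := by
    rintro X' X X'' Y' Y Y'' f g f' g' a b c h₁ h₂ ⟨Z, L, e, m, e', m', w, rfl, rfl, he, hm, h⟩
    refine ⟨Z, L, a.inv ≫ e, m ≫ b.hom, b.inv ≫ e', m' ≫ c.hom, by simp [w], ?_, ?_,
      hS.comp_epi _ _ (hS.admissibleEpi_iso a.symm) he,
      hS.comp_mono _ _ hm (hS.admissibleMono_iso c),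
      hS.of_iso _ h (Iso.refl _) b (Iso.refl _) (by simp) (by simp)⟩
    · rw [← cancel_epi a.hom, ← h₁]
      simp
    · rw [← cancel_epi b.hom, ← h₂]
      simp
  refine ⟨hiso, ?_, ?_, ?_⟩
  · rintro X' X X'' Y' Y'' f g k l ⟨K, κ, ρ, s, h₁, h₂, h₃, h₄⟩ ⟨K', κ', ρ', s', h₁', h₂', h₃', h₄'⟩
      ⟨Z, L, e, m, e', m', w, rfl, rfl, he, hm, h⟩
    exact ⟨Z, L, k ≫ e, m, e', m' ≫ l, w, by simp, by simp,
      hS.comp_epi _ _ ⟨K, κ, h₃, hS.of_splitting ⟨ρ, s, h₁, h₂, h₄⟩⟩ he,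
      hS.comp_mono _ _ hm ⟨K', κ', h₃', hS.of_splitting ⟨ρ', s', h₁', h₂', h₄'⟩⟩, h⟩
  · intro T σ
    exact ⟨_, _, 𝟙 _, T.f, T.g, 𝟙 _, T.zero, by simp, by simp, hS.id_epi _, hS.id_mono _,
      hS.of_splitting σ⟩
  · intro T₁ T₂ T₃ Φ Ψ σ₁ σ₂ σ₃ w h₁ h₃
    refine hiso σ₁.isoBinaryBiproduct.symm σ₂.isoBinaryBiproduct.symm σ₃.isoBinaryBiproduct.symm
      ?_ ?_ (hS.isAcyclicPair_biprod h₁ h₃ (σ₁.s ≫ Φ.τ₂ ≫ σ₂.r) (σ₂.s ≫ Ψ.τ₂ ≫ σ₃.r) ?_)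
    · ext
      · simp [ShortComplex.Splitting.isoBinaryBiproduct, Φ.comm₁₂]
      · have := σ₁.s_g
        have e : σ₁.s ≫ Φ.τ₂ ≫ T₂.g = Φ.τ₃ := by rw [Φ.comm₂₃, reassoc_of% this]
        simp [ShortComplex.Splitting.isoBinaryBiproduct, biprod.lift_desc, ← e, ← Preadditive.comp_add, σ₂.id]
    · ext
      · simp [ShortComplex.Splitting.isoBinaryBiproduct, Ψ.comm₁₂]
      · have := σ₂.s_g
        have e : σ₂.s ≫ Ψ.τ₂ ≫ T₃.g = Ψ.τ₃ := by rw [Ψ.comm₂₃, reassoc_of% this]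
        simp [ShortComplex.Splitting.isoBinaryBiproduct, biprod.lift_desc, ← e, ← Preadditive.comp_add, σ₃.id]
    · have e : σ₁.s ≫ Φ.τ₂ ≫ (σ₂.r ≫ T₂.f + T₂.g ≫ σ₂.s) ≫ Ψ.τ₂ ≫ σ₃.r = 0 := by
        rw [σ₂.id, Category.id_comp, reassoc_of% w, zero_comp, comp_zero]
      have h₂ := σ₃.f_r
      have h₄ := σ₁.s_g
      simp only [Preadditive.add_comp, Preadditive.comp_add, Category.assoc,
        ← reassoc_of% Ψ.comm₁₂, h₂, Category.comp_id] at e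
      rw [reassoc_of% Φ.comm₂₃, reassoc_of% h₄] at e
      simpa using e

end PairProperty

/-! ### Pairs between cokernels of hulls and between kernels of covers. -/

section Syzygy

variable {C : Type u} [Category.{v} C] [Preadditive C]

/-- The pair is the direct sum of the pair `(a, b)` and split pairs. -/
theorem PairProperty.IsStable.of_stably_eq {W : PairProperty C} (hW : W.IsStable)
    [HasBinaryBiproducts C] {X₁ X₂ X₃ B₁ B₂ P₁ P₂ P₃ : C} {a : X₁ ⟶ X₂} {b : X₂ ⟶ X₃}
    (h : W a b) (w : a ≫ b = 0) {f : P₁ ⟶ P₂} {g : P₂ ⟶ P₃} {e : P₁ ⟶ X₁ ⊞ B₁}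
    (he : SplitEpic e) (φ : P₂ ≅ X₂ ⊞ (B₁ ⊞ B₂)) {m : X₃ ⊞ B₂ ⟶ P₃} (hm : SplitMonic m)
    (hf : f ≫ φ.hom = e ≫ biprod.map a biprod.inl)
    (hg : φ.inv ≫ g = biprod.map b biprod.snd ≫ m) : W f g := by
  have h₁ : W (biprod.inl : B₁ ⟶ B₁ ⊞ B₂) biprod.snd :=
    hW.split (.mk biprod.inl biprod.snd (by simp)) { r := biprod.fst, s := biprod.inr, id := by simp }
  have h₂ := hW.comp he hm (hW.biprod_map h h₁ w (by simp))
  exact hW.of_iso (Iso.refl _) φ.symm (Iso.refl _) (by simp [← hf]) (by simp [← hg]) h₂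

/-- The data of a split exact sequence `X ⟶ A ⊞ A' ⟶ P` whose first component is the inclusion of
a direct summand with complement `B`. The second component is `ε`. -/
structure Cosyzygy {X A A' P : C} (B : C) (ε : X ⟶ A') (ψ : A ⟶ P) (θ : A' ⟶ P) where
  a : X ⟶ A
  ρ : A ⟶ X
  q : A ⟶ B
  s : B ⟶ A
  a_ρ : a ≫ ρ = 𝟙 X
  s_q : s ≫ q = 𝟙 B
  a_q : a ≫ q = 0
  s_ρ : s ≫ ρ = 0
  total : ρ ≫ a + q ≫ s = 𝟙 A
  κ : P ⟶ B
  pr : P ⟶ A'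
  ψ_κ : ψ ≫ κ = q
  θ_κ : θ ≫ κ = 0
  ψ_pr : ψ ≫ pr = -(ρ ≫ ε)
  θ_pr : θ ≫ pr = 𝟙 A'
  a_ψ : a ≫ ψ = -(ε ≫ θ)
  id : κ ≫ s ≫ ψ + pr ≫ θ = 𝟙 P

variable {W : PairProperty C}

/-- Write `Aᵢ` as `Xᵢ ⊞ Bᵢ`, so that `Pᵢ` is `Bᵢ ⊞ Aᵢ₊₁`. Then `f` kills `B₀` and sends `A₁` to `P₁`
by `-d₁` on `X₁` and the identity on `B₁`; similarly for `g`. So the pair is the sum of `(d₁, d₂)`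
and the split pair `B₁ ⟶ B₁ ⊞ B₂ ⟶ B₂`, composed with a split epic and a split monic. The sign is
absorbed by `-c₂.ρ` in the isomorphism. -/
theorem PairProperty.IsStable.of_cosyzygy (hW : W.IsStable) [HasBinaryBiproducts C]
    {X₀ X₁ X₂ X₃ A₀ A₁ A₂ A₃ B₀ B₁ B₂ P₀ P₁ P₂ : C} {ε₀ : X₀ ⟶ A₁} {ε₁ : X₁ ⟶ A₂}
    {ε₂ : X₂ ⟶ A₃} {ψ₀ : A₀ ⟶ P₀} {ψ₁ : A₁ ⟶ P₁} {ψ₂ : A₂ ⟶ P₂} {θ₀ : A₁ ⟶ P₀} {θ₁ : A₂ ⟶ P₁}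
    {θ₂ : A₃ ⟶ P₂} (c₀ : Cosyzygy B₀ ε₀ ψ₀ θ₀) (c₁ : Cosyzygy B₁ ε₁ ψ₁ θ₁)
    (c₂ : Cosyzygy B₂ ε₂ ψ₂ θ₂) {a₃ : X₃ ⟶ A₃} (ha₃ : SplitMonic a₃) {d₁ : X₁ ⟶ X₂} {d₂ : X₂ ⟶ X₃}
    (hd₁ : ε₁ = d₁ ≫ c₂.a) (hd₂ : ε₂ = d₂ ≫ a₃) (h : W d₁ d₂) (w : d₁ ≫ d₂ = 0) {f : P₀ ⟶ P₁}
    {g : P₁ ⟶ P₂} (hf : ψ₀ ≫ f = 0) (hf' : θ₀ ≫ f = ψ₁) (hg : ψ₁ ≫ g = 0) (hg' : θ₁ ≫ g = ψ₂) :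
    W f g := by
  have ef : f = c₀.pr ≫ ψ₁ := by
    rw [← Category.id_comp f, ← c₀.id]
    simp [hf, hf']
  have eg : g = c₁.pr ≫ ψ₂ := by
    rw [← Category.id_comp g, ← c₁.id]
    simp [hg, hg']
  have he : SplitEpic (c₀.pr ≫ biprod.lift c₁.ρ c₁.q) := by
    refine ⟨B₀, c₀.s ≫ ψ₀, c₀.κ, biprod.desc c₁.a c₁.s ≫ θ₀, ?_, ?_, ?_, ?_⟩
    · simp [c₀.ψ_κ, c₀.s_q]
    · simp only [Category.assoc, reassoc_of% c₀.θ_pr]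
      ext <;> simp [c₁.a_ρ, c₁.s_q, c₁.a_q, c₁.s_ρ]
    · simp [reassoc_of% c₀.ψ_pr, reassoc_of% c₀.s_ρ]
    · rw [← c₀.id]
      simp [biprod.lift_desc_assoc, c₁.total]
  obtain ⟨B₃, q₃, ρ₃, s₃, h₁, h₂, h₃, h₄⟩ := ha₃
  have hm : SplitMonic (biprod.desc (a₃ ≫ θ₂) (c₂.s ≫ ψ₂)) := by
    refine ⟨B₃, c₂.pr ≫ q₃, biprod.lift (c₂.pr ≫ ρ₃) c₂.κ, s₃ ≫ θ₂, ?_, ?_, ?_, ?_⟩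
    · ext <;> simp [reassoc_of% c₂.θ_pr, c₂.θ_κ, c₂.ψ_κ, c₂.s_q, reassoc_of% c₂.ψ_pr,
        reassoc_of% c₂.s_ρ, h₁]
    · simp [reassoc_of% c₂.θ_pr, h₂]
    · ext <;> simp [reassoc_of% c₂.θ_pr, reassoc_of% c₂.ψ_pr, reassoc_of% c₂.s_ρ, h₃]
    · have := congrArg (fun k => c₂.pr ≫ k ≫ θ₂) h₄
      simp only [Preadditive.add_comp, Preadditive.comp_add, Category.assoc, Category.id_comp] at this
      rw [← c₂.id, ← this]
      simp [biprod.lift_desc]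
      abel
  refine hW.of_stably_eq h w he ⟨biprod.lift (c₁.pr ≫ (-c₂.ρ)) (biprod.lift c₁.κ (c₁.pr ≫ c₂.q)),
    biprod.desc (-(c₂.a ≫ θ₁)) (biprod.desc (c₁.s ≫ ψ₁) (c₂.s ≫ θ₁)), ?_, ?_⟩ hm ?_ ?_
  · have := congrArg (fun k => c₁.pr ≫ k ≫ θ₁) c₂.total
    simp only [Preadditive.add_comp, Preadditive.comp_add, Category.assoc, Category.id_comp] at this
    rw [← c₁.id, ← this]
    simp [biprod.lift_desc]
    abel
  · ext <;> simp [reassoc_of% c₁.θ_pr, c₁.θ_κ, c₁.ψ_κ, c₁.s_q, reassoc_of% c₁.ψ_pr,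
        reassoc_of% c₁.s_ρ, c₂.a_ρ, c₂.a_q, c₂.s_ρ, c₂.s_q]
  · ext <;> simp [ef, reassoc_of% c₁.ψ_pr, c₁.ψ_κ, hd₁, c₂.a_ρ, c₂.a_q]
  · ext <;> simp [eg, reassoc_of% c₁.θ_pr, reassoc_of% c₁.ψ_pr, c₂.a_ψ, reassoc_of% c₁.s_ρ, hd₂]

/-- The data of a split exact sequence `K ⟶ A ⊞ A' ⟶ X` whose second component is the projection
to a direct summand with complement `B`. The first component is `ε`. -/
structure Syzygy {X A A' K : C} (B : C) (ε : A ⟶ X) (ψ : K ⟶ A) (θ : K ⟶ A') where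
  b : A' ⟶ X
  s : X ⟶ A'
  j : B ⟶ A'
  r : A' ⟶ B
  s_b : s ≫ b = 𝟙 X
  j_r : j ≫ r = 𝟙 B
  j_b : j ≫ b = 0
  s_r : s ≫ r = 0
  total : b ≫ s + r ≫ j = 𝟙 A'
  κ : B ⟶ K
  incl : A ⟶ K
  κ_ψ : κ ≫ ψ = 0
  κ_θ : κ ≫ θ = j
  incl_ψ : incl ≫ ψ = 𝟙 A
  incl_θ : incl ≫ θ = -(ε ≫ s)
  θ_b : θ ≫ b = -(ψ ≫ ε)
  id : ψ ≫ incl + θ ≫ r ≫ κ = 𝟙 K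

/-- Dual to `of_cosyzygy`: here `Kᵢ` is the sum of `Aᵢ` and the complement `Bᵢ₊₁` of the next
`Xᵢ₊₁`, and the pair is the sum of `(d₀, d₁)` and a split pair. -/
theorem PairProperty.IsStable.of_syzygy (hW : W.IsStable) [HasBinaryBiproducts C]
    {X₀ X₁ X₂ X₃ A₀ A₁ A₂ A₃ B₁ B₂ B₃ K₀ K₁ K₂ : C} {ε₀ : A₀ ⟶ X₁} {ε₁ : A₁ ⟶ X₂}
    {ε₂ : A₂ ⟶ X₃} {ψ₀ : K₀ ⟶ A₀} {ψ₁ : K₁ ⟶ A₁} {ψ₂ : K₂ ⟶ A₂} {θ₀ : K₀ ⟶ A₁} {θ₁ : K₁ ⟶ A₂}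
    {θ₂ : K₂ ⟶ A₃} (c₀ : Syzygy B₁ ε₀ ψ₀ θ₀) (c₁ : Syzygy B₂ ε₁ ψ₁ θ₁)
    (c₂ : Syzygy B₃ ε₂ ψ₂ θ₂) {b₀ : A₀ ⟶ X₀} (hb₀ : SplitEpic b₀) {d₀ : X₀ ⟶ X₁} {d₁ : X₁ ⟶ X₂}
    (hd₀ : ε₀ = b₀ ≫ d₀) (hd₁ : ε₁ = c₀.b ≫ d₁) (h : W d₀ d₁) (w : d₀ ≫ d₁ = 0) {f : K₀ ⟶ K₁}
    {g : K₁ ⟶ K₂} (hf : f ≫ θ₁ = 0) (hf' : f ≫ ψ₁ = θ₀) (hg : g ≫ θ₂ = 0) (hg' : g ≫ ψ₂ = θ₁) :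
    W f g := by
  have ef : f = θ₀ ≫ c₁.incl := by
    rw [← Category.comp_id f, ← c₁.id]
    simp [reassoc_of% hf, reassoc_of% hf']
  have eg : g = θ₁ ≫ c₂.incl := by
    rw [← Category.comp_id g, ← c₂.id]
    simp [reassoc_of% hg, reassoc_of% hg']
  obtain ⟨B₀, j₀, r₀, s₀, h₁, h₂, h₃, h₄⟩ := hb₀
  have he : SplitEpic (biprod.lift (ψ₀ ≫ b₀) (θ₀ ≫ c₀.r)) := by
    refine ⟨B₀, j₀ ≫ c₀.incl, ψ₀ ≫ r₀, biprod.desc (s₀ ≫ c₀.incl) c₀.κ, ?_, ?_, ?_, ?_⟩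
    · simp [reassoc_of% c₀.incl_ψ, h₁]
    · ext <;> simp [reassoc_of% c₀.incl_ψ, reassoc_of% c₀.incl_θ, reassoc_of% c₀.κ_ψ,
        reassoc_of% c₀.κ_θ, h₂, c₀.s_r, c₀.j_r]
    · ext <;> simp [reassoc_of% c₀.incl_ψ, reassoc_of% c₀.incl_θ, h₃, c₀.s_r]
    · have := congrArg (fun k => ψ₀ ≫ k ≫ c₀.incl) h₄
      simp only [Preadditive.add_comp, Preadditive.comp_add, Category.assoc, Category.id_comp] at this
      rw [← c₀.id, ← this]
      simp [biprod.lift_desc]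
      abel
  have hm : SplitMonic (biprod.desc c₁.s c₁.j ≫ c₂.incl) := by
    refine ⟨B₃, θ₂ ≫ c₂.r, ψ₂ ≫ biprod.lift c₁.b c₁.r, c₂.κ, ?_, ?_, ?_, ?_⟩
    · simp only [Category.assoc, reassoc_of% c₂.incl_ψ]
      ext <;> simp [c₁.s_b, c₁.s_r, c₁.j_b, c₁.j_r]
    · simp [reassoc_of% c₂.κ_θ, c₂.j_r]
    · simp [reassoc_of% c₂.incl_θ, c₂.s_r]
    · rw [← c₂.id]
      simp [biprod.lift_desc_assoc, c₁.total]
  refine hW.of_stably_eq h w he ⟨biprod.lift (ψ₁ ≫ (-c₀.b)) (biprod.lift (ψ₁ ≫ c₀.r) (θ₁ ≫ c₁.r)),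
    biprod.desc (-(c₀.s ≫ c₁.incl)) (biprod.desc (c₀.j ≫ c₁.incl) c₁.κ), ?_, ?_⟩ hm ?_ ?_
  · have := congrArg (fun k => ψ₁ ≫ k ≫ c₁.incl) c₀.total
    simp only [Preadditive.add_comp, Preadditive.comp_add, Category.assoc, Category.id_comp] at this
    rw [← c₁.id, ← this]
    simp [biprod.lift_desc]
    abel
  · ext <;> simp [reassoc_of% c₁.incl_ψ, reassoc_of% c₁.incl_θ, reassoc_of% c₁.κ_ψ,
      reassoc_of% c₁.κ_θ, c₀.s_b, c₀.s_r, c₀.j_b, c₀.j_r, c₁.s_r, c₁.j_r]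
  · ext <;> simp [ef, reassoc_of% c₁.incl_ψ, reassoc_of% c₁.incl_θ, c₀.θ_b, hd₀, c₁.s_r]
  · ext <;> simp [eg, reassoc_of% c₁.incl_θ, reassoc_of% c₁.κ_θ, hd₁, reassoc_of% c₀.s_b,
      reassoc_of% c₀.j_b]

end Syzygy

section SyzygyData

variable {C : Type u} [Category.{v} C] [Preadditive C]

/-- As `a` is a split monic with complement `B`, the cokernel of `(a, ε)` is the sum of `B` and
`T.X₃`. The projections `κ` and `pr` come from the maps `τ.r ≫ q` and `T.g - τ.r ≫ ρ ≫ ε`, which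
vanish on `i`. -/
theorem exists_cosyzygy {X P : C} {T : ShortComplex C} (τ : T.Splitting) {i : X ⟶ T.X₂}
    {p : T.X₂ ⟶ P} {w : i ≫ p = 0} (σ : (ShortComplex.mk i p w).Splitting) {a : X ⟶ T.X₁}
    {ε : X ⟶ T.X₃} (ha : SplitMonic a) (hia : i ≫ τ.r = a) (hiε : i ≫ T.g = ε) :
    ∃ (B : C) (c : Cosyzygy B ε (T.f ≫ p) (τ.s ≫ p)), c.a = a := by
  obtain ⟨B, q, ρ, s, h₁, h₂, h₃, h₄⟩ := ha
  have hs : s ≫ ρ = 0 := by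
    have := s ≫= h₄ =≫ ρ
    simpa [h₁, reassoc_of% h₂] using this
  have e : p ≫ σ.s = 𝟙 _ - σ.r ≫ i := σ.g_s
  have e' : σ.s ≫ p = 𝟙 _ := σ.s_g
  have t₁ := τ.f_r
  have t₂ := τ.s_g
  have t₃ := τ.s_r
  have t₄ := T.zero
  have hi : i = a ≫ T.f + ε ≫ τ.s := by
    rw [← hia, ← hiε, Category.assoc, Category.assoc, ← Preadditive.comp_add, τ.id, Category.comp_id]
  have h₅ : p ≫ σ.s ≫ τ.r ≫ q = τ.r ≫ q := by
    simp [reassoc_of% e, reassoc_of% hia, h₃]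
  have h₆ : p ≫ σ.s ≫ (T.g - τ.r ≫ ρ ≫ ε) = T.g - τ.r ≫ ρ ≫ ε := by
    simp [reassoc_of% e, reassoc_of% hia, hiε, reassoc_of% h₁]
  have h₇ : a ≫ T.f ≫ p = -(ε ≫ τ.s ≫ p) := by
    rw [hi, Preadditive.add_comp, Category.assoc, Category.assoc] at w
    exact eq_neg_of_add_eq_zero_left w
  refine ⟨B, ⟨a, ρ, q, s, h₁, h₂, h₃, hs, h₄, σ.s ≫ τ.r ≫ q, σ.s ≫ (T.g - τ.r ≫ ρ ≫ ε), ?_, ?_, ?_,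
    ?_, h₇, ?_⟩, rfl⟩
  · rw [Category.assoc, h₅, reassoc_of% t₁]
  · rw [Category.assoc, h₅, reassoc_of% t₃, zero_comp]
  · rw [Category.assoc, h₆]
    simp [t₄, reassoc_of% t₁]
  · rw [Category.assoc, h₆]
    simp [t₂, reassoc_of% t₃]
  · have h₈ := congrArg (fun k => σ.s ≫ τ.r ≫ k ≫ T.f ≫ p) h₄
    have h₉ := congrArg (fun k => σ.s ≫ k ≫ p) τ.id
    simp only [Preadditive.add_comp, Preadditive.comp_add, Category.assoc, Category.id_comp,
      h₇, e'] at h₈ h₉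
    rw [← h₉, ← h₈]
    simp
    abel

theorem exists_syzygy {X K : C} {T : ShortComplex C} (τ : T.Splitting) {k : K ⟶ T.X₂}
    {p : T.X₂ ⟶ X} {w : k ≫ p = 0} (σ : (ShortComplex.mk k p w).Splitting) {b : T.X₃ ⟶ X}
    {ε : T.X₁ ⟶ X} (hb : SplitEpic b) (hbp : τ.s ≫ p = b) (hεp : T.f ≫ p = ε) :
    ∃ (B : C) (c : Syzygy B ε (k ≫ τ.r) (k ≫ T.g)), c.b = b := by
  obtain ⟨B, j, r, s, h₁, h₂, h₃, h₄⟩ := hb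
  have hs : s ≫ r = 0 := by
    have := s ≫= h₄ =≫ r
    simpa [h₁, reassoc_of% h₂] using this
  have e : σ.r ≫ k = 𝟙 _ - p ≫ σ.s := σ.r_f
  have e' : k ≫ σ.r = 𝟙 _ := σ.f_r
  have t₁ := τ.f_r
  have t₂ := τ.s_g
  have t₃ := τ.s_r
  have t₄ := T.zero
  have hp : p = τ.r ≫ ε + T.g ≫ b := by
    rw [← hbp, ← hεp, ← Category.assoc, ← Category.assoc, ← Preadditive.add_comp, τ.id,
      Category.id_comp]
  have h₅ : (j ≫ τ.s ≫ σ.r) ≫ k = j ≫ τ.s := by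
    simp [e, reassoc_of% hbp, reassoc_of% h₃]
  have h₆ : ((T.f - ε ≫ s ≫ τ.s) ≫ σ.r) ≫ k = T.f - ε ≫ s ≫ τ.s := by
    simp [e, reassoc_of% hbp, reassoc_of% hεp, reassoc_of% h₂]
  have h₇ : k ≫ T.g ≫ b = -(k ≫ τ.r ≫ ε) := by
    rw [hp, Preadditive.comp_add] at w
    exact eq_neg_of_add_eq_zero_right w
  refine ⟨B, ⟨b, s, j, r, h₂, h₁, h₃, hs, (add_comm _ _).trans h₄, j ≫ τ.s ≫ σ.r,
    (T.f - ε ≫ s ≫ τ.s) ≫ σ.r, ?_, ?_, ?_, ?_, by simpa using h₇, ?_⟩, rfl⟩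
  · rw [← Category.assoc, h₅, Category.assoc, t₃, comp_zero]
  · rw [← Category.assoc, h₅, Category.assoc, t₂, Category.comp_id]
  · rw [← Category.assoc, h₆]
    simp [t₃, t₁]
  · rw [← Category.assoc, h₆]
    simp [t₂, t₄]
  · have h₈ := congrArg (fun l => k ≫ T.g ≫ l ≫ τ.s ≫ σ.r) h₄
    have h₉ := congrArg (fun l => k ≫ l ≫ σ.r) τ.id
    simp only [Preadditive.add_comp, Preadditive.comp_add, Category.assoc, Category.id_comp,
      reassoc_of% h₇, Preadditive.neg_comp, e'] at h₈ h₉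
    rw [← h₉, ← h₈]
    simp
    abel

end SyzygyData

/-! ### Acyclicity positions of extensions, hull cokernels and cover kernels. -/

section NPair

variable {C : Type u} [Category.{v} C]

/-- The pairs that enter the definition of acyclicity at position `n` satisfy `W`. -/
def NPair (W : PairProperty C) (N : ℕ) (X : ℤ ⥤ C) (n : ℤ) : Prop :=
  ∀ (r : ℕ) (m l : ℤ) (φ : m ⟶ n) (ψ : n ⟶ l), 1 ≤ r → r < N → m = n - N + r → l = n + r →
    W (X.map φ) (X.map ψ)

variable [Preadditive C] {W : PairProperty C} {N : ℕ} {X Y Z : NComplex C N}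

theorem NPair.ext (hW : W.IsStable) {f : X ⟶ Y} {g : Y ⟶ Z} {w : f ≫ g = 0}
    (h : termsplit C N (.mk f g w)) {n : ℤ} (hX : NPair W N X.obj n) (hZ : NPair W N Z.obj n) :
    NPair W N Y.obj n := by
  intro r m l φ ψ hr hr' hm hl
  obtain ⟨σ₁⟩ := h m
  obtain ⟨σ₂⟩ := h n
  obtain ⟨σ₃⟩ := h l
  have hY : Y.obj.map φ ≫ Y.obj.map ψ = 0 := by
    rw [← Functor.map_comp]
    exact Y.map_eq_zero _ (by omega)
  exact hW.ext (T₁ := ShortComplex.mk (f.hom.app m) (g.hom.app m) (NComplex.comp_app_eq w m))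
    (T₂ := ShortComplex.mk (f.hom.app n) (g.hom.app n) (NComplex.comp_app_eq w n))
    (T₃ := ShortComplex.mk (f.hom.app l) (g.hom.app l) (NComplex.comp_app_eq w l))
    ⟨X.obj.map φ, Y.obj.map φ, Z.obj.map φ, NComplex.naturality f φ, NComplex.naturality g φ⟩
    ⟨X.obj.map ψ, Y.obj.map ψ, Z.obj.map ψ, NComplex.naturality f ψ, NComplex.naturality g ψ⟩
    σ₁ σ₂ σ₃ hY (hX r m l φ ψ hr hr' hm hl) (hZ r m l φ ψ hr hr' hm hl)

theorem NPair.of_isZero (hW : W.IsStable) {X : ℤ ⥤ C} {n : ℤ} (h : IsZero (X.obj n)) :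
    NPair W N X n := fun _ _ _ _ _ _ _ _ _ => hW.of_isZero _ _ h

variable [HasFiniteBiproducts C]

theorem nPair_cofree (hW : W.IsStable) (A : ℤ → C) (n : ℤ) : NPair W N (cofree A N).obj n :=
  fun _ _ _ φ ψ _ hr hm hl => hW.of_splitAcyclicPair (splitAcyclicPair_cofree hr.le hm hl φ ψ)

/-- The family of differentials `X n ⟶ X j` for `j ∈ s`. -/
noncomputable def spread (X : ℤ ⥤ C) (n : ℤ) (s : Finset ℤ) (hs : ∀ j ∈ s, n ≤ j) :
    X.obj n ⟶ sumOver X.obj s :=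
  biproduct.lift fun j => X.map (homOfLE (hs j j.2))

theorem spread_π (X : ℤ ⥤ C) {n : ℤ} {s : Finset ℤ} (hs : ∀ j ∈ s, n ≤ j) (j : s) :
    spread X n s hs ≫ biproduct.π (fun j : s => X.obj j) j = X.map (homOfLE (hs j j.2)) :=
  biproduct.lift_π _ _

theorem spread_transfer (X : ℤ ⥤ C) (n : ℤ) {s t : Finset ℤ} (hs : ∀ j ∈ s, n ≤ j) (ht : t ⊆ s) :
    spread X n s hs ≫ transfer X.obj s t = spread X n t fun j hj => hs j (ht hj) := by
  refine biproduct.hom_ext _ _ fun j => ?_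
  rw [Category.assoc, transfer_π_of_mem j (ht j.2), spread, spread, biproduct.lift_π,
    biproduct.lift_π]

theorem map_spread (X : ℤ ⥤ C) {m n : ℤ} (φ : m ⟶ n) {s : Finset ℤ} (hs : ∀ j ∈ s, n ≤ j) :
    X.map φ ≫ spread X n s hs = spread X m s fun j hj => (leOfHom φ).trans (hs j hj) := by
  refine biproduct.hom_ext _ _ fun j => ?_
  rw [Category.assoc, spread, spread, biproduct.lift_π, biproduct.lift_π, ← X.map_comp]
  rfl

/-- The component of index `n` is the identity. -/
theorem splitMonic_spread (X : ℤ ⥤ C) {n : ℤ} {s : Finset ℤ} (hs : ∀ j ∈ s, n ≤ j) (hn : n ∈ s) :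
    SplitMonic (spread X n s hs) :=
  SplitMonic.of_section (splitEpic_π (A := X.obj) ⟨n, hn⟩)
    ((biproduct.lift_π _ _).trans (X.map_id n))

/-- The cokernel of the inclusion of a complex into an injective hull is as acyclic as
the complex. -/
theorem nPair_of_cosyzygy (hW : W.IsStable) [HasBinaryBiproducts C]
    (p : ∀ n, sumOver X.obj.obj (Finset.Ico n (n + N)) ⟶ Y.obj.obj n)
    (hp : ∀ {m n : ℤ} (φ : m ⟶ n), transfer X.obj.obj _ _ ≫ p n = p m ≫ Y.obj.map φ)
    (w : ∀ n, spread X.obj n (Finset.Ico n (n + N)) (fun _ hj => (Finset.mem_Ico.1 hj).1) ≫ p n = 0)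
    (σ : ∀ n, (ShortComplex.mk _ (p n) (w n)).Splitting) {n : ℤ}
    (hX : ∀ k, n < k → k < n + N → NPair W N X.obj k) : NPair W N Y.obj n := by
  intro r m l φ ψ hr hr' hm hl
  have key : ∀ {n l k : ℤ} (hnl : n < l) (hlk : l ≤ k) (hk : k = n + N),
      ∃ (B : C) (c : Cosyzygy B (spread X.obj n (Finset.Ico l k) (fun _ hj =>
        hnl.le.trans (Finset.mem_Ico.1 hj).1)) (transfer X.obj.obj (Finset.Ico n l) _ ≫ p n)
        (transfer X.obj.obj (Finset.Ico l k) _ ≫ p n)),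
        c.a = spread X.obj n (Finset.Ico n l) (fun _ hj => (Finset.mem_Ico.1 hj).1) := by
    intro n l k hnl hlk hk
    refine exists_cosyzygy (transferSplitting (A := X.obj.obj) (s := Finset.Ico n l)
      (t := Finset.Ico n (n + N)) (r := Finset.Ico l k) ?_ ?_ ?_ ?_) (σ n)
      (splitMonic_spread _ _ ?_) (spread_transfer _ _ _ ?_) (spread_transfer _ _ _ ?_)
    all_goals try intro j
    all_goals simp only [Finset.mem_Ico]; omega
  -- Since `l = m + N`, the hulls in degrees `m`, `n`, `l` are cut at `n`, `l`, `n + N`, and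
  -- consecutive ones share a block.
  obtain ⟨B₀, c₀, h₀⟩ := key (n := m) (l := n) (k := l) (by omega) (by omega) (by omega)
  obtain ⟨B₁, c₁, h₁⟩ := key (n := n) (l := l) (k := n + N) (by omega) (by omega) (by omega)
  obtain ⟨B₂, c₂, h₂⟩ := key (n := l) (l := n + N) (k := l + N) (by omega) (by omega) (by omega)
  -- The underlying pair is `X^n ⟶ X^l ⟶ X^{n+N}`, the pair of `X` at `l = n + r` with parameter `N
  -- - r`.
  refine hW.of_cosyzygy c₀ c₁ c₂ (splitMonic_spread X.obj (n := n + N)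
    (fun _ hj => (Finset.mem_Ico.1 hj).1) ?_) (d₁ := X.obj.map ψ)
    (d₂ := X.obj.map (homOfLE (by omega))) ?_ (map_spread _ _ _).symm
    (hX l (by omega) (by omega) (N - r) _ _ _ _ (by omega) (by omega) (by omega) (by omega)) ?_ ?_ ?_ ?_ ?_
  · simp only [Finset.mem_Ico]; omega
  · rw [h₂, map_spread]
  · rw [← Functor.map_comp]
    exact X.map_eq_zero _ le_rfl
  · rw [Category.assoc, ← hp, ← Category.assoc, transfer_comp, transfer_eq_zero, zero_comp] <;>
      intro j <;> simp only [Finset.mem_Ico] <;> omega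
  · rw [Category.assoc, ← hp, ← Category.assoc, transfer_comp]
    intro j; simp only [Finset.mem_Ico]; omega
  · rw [Category.assoc, ← hp, ← Category.assoc, transfer_comp, transfer_eq_zero, zero_comp] <;>
      intro j <;> simp only [Finset.mem_Ico] <;> omega
  · rw [Category.assoc, ← hp, ← Category.assoc, transfer_comp]
    intro j; simp only [Finset.mem_Ico]; omega

/-- The family of differentials `X (j - N + 1) ⟶ X n` for `j ∈ s`. -/
noncomputable def gather (X : ℤ ⥤ C) (N : ℕ) (n : ℤ) (s : Finset ℤ) (hs : ∀ j ∈ s, j - N + 1 ≤ n) :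
    sumOver (fun j => X.obj (j - N + 1)) s ⟶ X.obj n :=
  biproduct.desc fun j => X.map (homOfLE (hs j j.2))

theorem ι_gather (X : ℤ ⥤ C) {n : ℤ} {s : Finset ℤ} (hs : ∀ j ∈ s, j - N + 1 ≤ n) (j : s) :
    biproduct.ι (fun j : s => X.obj (j - N + 1)) j ≫ gather X N n s hs =
      X.map (homOfLE (hs j j.2)) := biproduct.ι_desc _ _

theorem transfer_gather (X : ℤ ⥤ C) (n : ℤ) {s t : Finset ℤ} (hs : ∀ j ∈ s, j - N + 1 ≤ n)
    (ht : t ⊆ s) : transfer _ t s ≫ gather X N n s hs = gather X N n t fun j hj => hs j (ht hj) := by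
  refine biproduct.hom_ext' _ _ fun j => ?_
  rw [← Category.assoc, ι_transfer_of_mem (A := fun j => X.obj (j - N + 1)) j (ht j.2), ι_gather]
  exact (ι_gather X (fun j hj => hs j (ht hj)) j).symm

theorem gather_map (X : ℤ ⥤ C) {m n : ℤ} (φ : m ⟶ n) {s : Finset ℤ} (hs : ∀ j ∈ s, j - N + 1 ≤ m) :
    gather X N m s hs ≫ X.map φ = gather X N n s fun j hj => (hs j hj).trans (leOfHom φ) := by
  refine biproduct.hom_ext' _ _ fun j => ?_
  rw [← Category.assoc, gather, gather, biproduct.ι_desc, biproduct.ι_desc, ← X.map_comp]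
  rfl

/-- The component of index `n + N - 1` is the identity of `X^n`. -/
theorem splitEpic_gather (X : ℤ ⥤ C) {n : ℤ} {s : Finset ℤ} (hs : ∀ j ∈ s, j - N + 1 ≤ n)
    (hn : n + N - 1 ∈ s) : SplitEpic (gather X N n s hs) := by
  obtain ⟨j, hj, rfl⟩ : ∃ j ∈ s, j - N + 1 = n := ⟨_, hn, by omega⟩
  exact SplitEpic.of_retraction (splitMonic_ι (A := fun j => X.obj (j - N + 1)) ⟨j, hj⟩)
    ((biproduct.ι_desc _ _).trans (X.map_id _))

/-- The kernel of the projection of a projective cover to a complex is as acyclic as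
the complex. -/
theorem nPair_of_syzygy (hW : W.IsStable) [HasBinaryBiproducts C]
    (κ : ∀ n : ℤ, Y.obj.obj n ⟶ sumOver (fun j => X.obj.obj (j - N + 1)) (Finset.Ico n (n + N)))
    (hκ : ∀ {m n : ℤ} (φ : m ⟶ n), κ m ≫ transfer _ _ _ = Y.obj.map φ ≫ κ n)
    (w : ∀ n, κ n ≫ gather X.obj N n (Finset.Ico n (n + N))
      (fun j hj => by have := (Finset.mem_Ico.1 hj).2; omega) = 0)
    (σ : ∀ n, (ShortComplex.mk (κ n) _ (w n)).Splitting) {n : ℤ}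
    (hX : ∀ k, n - N < k → k < n → NPair W N X.obj k) : NPair W N Y.obj n := by
  intro r m l φ ψ hr hr' hm hl
  have key : ∀ {n l k : ℤ} (hnl : n ≤ l) (hlk : l < k) (hk : k = n + N),
      ∃ (B : C) (c : Syzygy B (gather X.obj N n (Finset.Ico n l) (fun j hj => by
        have := (Finset.mem_Ico.1 hj).2; omega)) (κ n ≫ transfer _ _ (Finset.Ico n l))
        (κ n ≫ transfer _ _ (Finset.Ico l k))),
        c.b = gather X.obj N n (Finset.Ico l k) (fun j hj => by
          have := (Finset.mem_Ico.1 hj).2; omega) := by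
    intro n l k hnl hlk hk
    refine exists_syzygy (transferSplitting (A := fun j => X.obj.obj (j - N + 1))
      (s := Finset.Ico n l) (t := Finset.Ico n (n + N)) (r := Finset.Ico l k) ?_ ?_ ?_ ?_) (σ n)
      (splitEpic_gather _ _ ?_) (transfer_gather _ _ _ ?_) (transfer_gather _ _ _ ?_)
    all_goals try intro j
    all_goals simp only [Finset.mem_Ico]; omega
  obtain ⟨B₀, c₀, h₀⟩ := key (n := m) (l := n) (k := l) (by omega) (by omega) (by omega)
  obtain ⟨B₁, c₁, h₁⟩ := key (n := n) (l := l) (k := n + N) (by omega) (by omega) (by omega)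
  obtain ⟨B₂, c₂, h₂⟩ := key (n := l) (l := n + N) (k := l + N) (by omega) (by omega) (by omega)
  -- The underlying pair is `X^{n-N} ⟶ X^m ⟶ X^n`, the pair of `X` at `m = n - N + r` with parameter
  -- `N - r`.
  refine hW.of_syzygy c₀ c₁ c₂ (splitEpic_gather X.obj (N := N) (n := n - N) (s := Finset.Ico m n)
    (fun j hj => by have := (Finset.mem_Ico.1 hj).2; omega) ?_)
    (d₀ := X.obj.map (homOfLE (by omega))) (d₁ := X.obj.map φ) (gather_map _ _ _).symm ?_
    (hX m (by omega) (by omega) (N - r) _ _ _ _ (by omega) (by omega) (by omega) (by omega)) ?_ ?_ ?_ ?_ ?_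
  · simp only [Finset.mem_Ico]; omega
  · rw [h₀, gather_map]
  · rw [← Functor.map_comp]
    exact X.map_eq_zero _ (by omega)
  · rw [← Category.assoc, ← hκ, Category.assoc, transfer_comp, transfer_eq_zero, comp_zero] <;>
      intro j <;> simp only [Finset.mem_Ico] <;> omega
  · rw [← Category.assoc, ← hκ, Category.assoc, transfer_comp]
    intro j; simp only [Finset.mem_Ico]; omega
  · rw [← Category.assoc, ← hκ, Category.assoc, transfer_comp, transfer_eq_zero, comp_zero] <;>
      intro j <;> simp only [Finset.mem_Ico] <;> omega
  · rw [← Category.assoc, ← hκ, Category.assoc, transfer_comp]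
    intro j; simp only [Finset.mem_Ico]; omega

/-- The embedding of a complex into an injective complex. -/
noncomputable abbrev hull (X : NComplex C N) : X ⟶ cofree X.obj.obj N := toCofree fun _ => 𝟙 _

/-- The projection of a projective complex to a complex. -/
noncomputable abbrev cover (X : NComplex C N) : cofree (fun n => X.obj.obj (n - N + 1)) N ⟶ X :=
  fromCofree fun _ => 𝟙 _

theorem hull_app (X : NComplex C N) (n : ℤ) : (hull X).hom.app n =
    spread X.obj n (Finset.Ico n (n + N)) fun _ hj => (Finset.mem_Ico.1 hj).1 := by
  refine cofree_hom_ext fun j => (toCofree_app_π _ n j).trans ?_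
  exact (Category.comp_id _).trans (spread_π X.obj (n := n)
    (fun _ hj => (Finset.mem_Ico.1 hj).1) j).symm

theorem cover_app (X : NComplex C N) (n : ℤ) : (cover X).hom.app n =
    gather X.obj N n (Finset.Ico n (n + N))
      fun j hj => by have := (Finset.mem_Ico.1 hj).2; omega := by
  refine cofree_hom_ext' fun j => (ι_fromCofree_app _ n j).trans ?_
  exact (Category.id_comp _).trans (ι_gather X.obj (N := N) (n := n)
    (fun j hj => by have := (Finset.mem_Ico.1 hj).2; omega) j).symm

/-- Transport of a splitting along equalities. -/
def Splitting.congr {A B D : C} {f f' : A ⟶ B} {g g' : B ⟶ D} {w : f ≫ g = 0} {w' : f' ≫ g' = 0}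
    (hf : f = f') (hg : g = g') (σ : (ShortComplex.mk f g w).Splitting) :
    (ShortComplex.mk f' g' w').Splitting where
  r := σ.r
  s := σ.s
  f_r := hf ▸ σ.f_r
  s_g := hg ▸ σ.s_g
  id := hf ▸ hg ▸ σ.id

theorem NPair.of_hull (hW : W.IsStable) [HasBinaryBiproducts C] {p : cofree X.obj.obj N ⟶ Y}
    {w : hull X ≫ p = 0} (h : termsplit C N (.mk (hull X) p w)) {n : ℤ}
    (hX : ∀ k, n < k → k < n + N → NPair W N X.obj k) : NPair W N Y.obj n := by
  have w' : ∀ n, spread X.obj n (Finset.Ico n (n + N)) (fun _ hj => (Finset.mem_Ico.1 hj).1) ≫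
      p.hom.app n = 0 := fun n => by
    rw [← hull_app]
    exact NComplex.comp_app_eq w n
  refine nPair_of_cosyzygy hW (fun n => p.hom.app n) (fun φ => NComplex.naturality p φ) w'
    (fun n => Splitting.congr (hull_app X n) rfl (h n).some) hX

theorem NPair.of_cover (hW : W.IsStable) [HasBinaryBiproducts C]
    {κ : Y ⟶ cofree (fun n => X.obj.obj (n - N + 1)) N}
    {w : κ ≫ cover X = 0} (h : termsplit C N (.mk κ (cover X) w)) {n : ℤ}
    (hX : ∀ k, n - N < k → k < n → NPair W N X.obj k) : NPair W N Y.obj n := by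
  have w' : ∀ n, κ.hom.app n ≫ gather X.obj N n (Finset.Ico n (n + N))
      (fun j hj => by have := (Finset.mem_Ico.1 hj).2; omega) = 0 := fun n => by
    rw [← cover_app]
    exact NComplex.comp_app_eq w n
  refine nPair_of_syzygy hW (fun n => κ.hom.app n) (fun φ => (NComplex.naturality κ φ).symm) w'
    (fun n => Splitting.congr rfl (cover_app X n) (h n).some) hX

end NPair

/-! ### Boundedness and acyclicity conditions under local implications. -/

section Positions

/-- A predicate on the integers that is implied locally by two cofinite predicates is cofinite. -/
theorem finite_of_local (N : ℕ) {p q r : ℤ → Prop} (h : ∀ n : ℤ, (∀ k, n - N ≤ k → k ≤ n + N → p k) →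
    (∀ k, n - N ≤ k → k ≤ n + N → q k) → r n) (hp : {k | ¬ p k}.Finite) (hq : {k | ¬ q k}.Finite) :
    {k | ¬ r k}.Finite := by
  -- A bad position for `r` lies within distance `N` of a bad position for `p` or `q`.
  refine ((hp.union hq).image2 (· + ·) (Set.finite_Icc (-N : ℤ) N)).subset fun n hn => ?_
  by_contra hn'
  refine hn (h n (fun k hk hk' => ?_) (fun k hk hk' => ?_))
  · by_contra hk''
    exact hn' ⟨k, Or.inl hk'', n - k, ⟨by omega, by omega⟩, add_sub_cancel k n⟩
  · by_contra hk''
    exact hn' ⟨k, Or.inr hk'', n - k, ⟨by omega, by omega⟩, add_sub_cancel k n⟩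

variable {C : Type u} [Category.{v} C] {N : ℕ} {X X' Y : ℤ ⥤ C}

theorem SatisfiesBound.of_local (h : ∀ n : ℤ, (∀ k, n - N ≤ k → k ≤ n + N → IsZero (X.obj k)) →
    (∀ k, n - N ≤ k → k ≤ n + N → IsZero (X'.obj k)) → IsZero (Y.obj n)) {c : Bound}
    (hX : SatisfiesBound X c) (hX' : SatisfiesBound X' c) : SatisfiesBound Y c := by
  cases c with
  | inf => trivial
  | plus =>
    obtain ⟨m, hm⟩ := hX
    obtain ⟨m', hm'⟩ := hX'
    exact ⟨min m m' - N, fun n hn => h n (fun k _ _ => hm k (by omega)) fun k _ _ => hm' k (by omega)⟩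
  | minus =>
    obtain ⟨m, hm⟩ := hX
    obtain ⟨m', hm'⟩ := hX'
    exact ⟨max m m' + N, fun n hn => h n (fun k _ _ => hm k (by omega)) fun k _ _ => hm' k (by omega)⟩
  | b => exact finite_of_local N h hX hX'

theorem SatisfiesBound.of_isZero (h : ∀ n, IsZero (X.obj n)) (c : Bound) : SatisfiesBound X c := by
  cases c with
  | inf => trivial
  | plus => exact ⟨0, fun k _ => h k⟩
  | minus => exact ⟨0, fun k _ => h k⟩
  | b => simp [SatisfiesBound, h]

theorem SatisfiesBound.plus_of_b (h : SatisfiesBound X .b) : SatisfiesBound X .plus := by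
  obtain ⟨m, hm⟩ := Set.Finite.bddBelow h
  refine ⟨m - 1, fun k hk => ?_⟩
  by_contra hk'
  have := hm hk'
  omega

theorem SatisfiesBound.minus_of_b (h : SatisfiesBound X .b) : SatisfiesBound X .minus := by
  obtain ⟨m, hm⟩ := Set.Finite.bddAbove h
  refine ⟨m + 1, fun k hk => ?_⟩
  by_contra hk'
  have := hm hk'
  omega

variable [Preadditive C] {S : ObjectProperty (ShortComplex C)}

/-- One window of radius `N` serves every `♮`: half-infinite ranges shrink by at most `N` and
cofinite ones stay cofinite. Two source complexes are allowed so that extensions are included. -/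
theorem SatisfiesAcyc.of_local (h : ∀ n : ℤ, (∀ k, n - N ≤ k → k ≤ n + N → NAcyclicAt S N X k) →
    (∀ k, n - N ≤ k → k ≤ n + N → NAcyclicAt S N X' k) → NAcyclicAt S N Y n)
    (h' : ∀ n : ℤ, (∀ k, n - N ≤ k → k ≤ n + N → TotallyNAcyclicAt S N X k) →
    (∀ k, n - N ≤ k → k ≤ n + N → TotallyNAcyclicAt S N X' k) → TotallyNAcyclicAt S N Y n) {c : Acyc}
    (hX : SatisfiesAcyc S N X c) (hX' : SatisfiesAcyc S N X' c) : SatisfiesAcyc S N Y c := by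
  cases c with
  | inf => trivial
  | plus =>
    obtain ⟨m, hm⟩ := hX
    obtain ⟨m', hm'⟩ := hX'
    exact ⟨min m m' - N, fun n hn => h n (fun k _ _ => hm k (by omega)) fun k _ _ => hm' k (by omega)⟩
  | minus =>
    obtain ⟨m, hm⟩ := hX
    obtain ⟨m', hm'⟩ := hX'
    exact ⟨max m m' + N, fun n hn => h n (fun k _ _ => hm k (by omega)) fun k _ _ => hm' k (by omega)⟩
  | b => exact finite_of_local N h hX hX'
  | empty => exact fun n => h n (fun k _ _ => hX k) fun k _ _ => hX' k
  | emptyStar => exact fun n => h' n (fun k _ _ => hX k) fun k _ _ => hX' k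

theorem SatisfiesAcyc.of_totally (h : ∀ n, TotallyNAcyclicAt S N X n) (c : Acyc) :
    SatisfiesAcyc S N X c := by
  cases c with
  | inf => trivial
  | plus => exact ⟨0, fun k _ => (h k).1⟩
  | minus => exact ⟨0, fun k _ => (h k).1⟩
  | b => simp [SatisfiesAcyc, fun k => (h k).1]
  | empty => exact fun k => (h k).1
  | emptyStar => exact h

theorem SatisfiesAcyc.plus_of_b (h : SatisfiesAcyc S N X .b) : SatisfiesAcyc S N X .plus := by
  obtain ⟨m, hm⟩ := Set.Finite.bddBelow h
  refine ⟨m - 1, fun k hk => ?_⟩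
  by_contra hk'
  have := hm hk'
  omega

theorem SatisfiesAcyc.minus_of_b (h : SatisfiesAcyc S N X .b) : SatisfiesAcyc S N X .minus := by
  obtain ⟨m, hm⟩ := Set.Finite.bddAbove h
  refine ⟨m + 1, fun k hk => ?_⟩
  by_contra hk'
  have := hm hk'
  omega

theorem SatisfiesAcyc.b_of_empty (h : SatisfiesAcyc S N X .empty) : SatisfiesAcyc S N X .b := by
  have : {k : ℤ | ¬ NAcyclicAt S N X k} = ∅ := by
    ext k
    simp [h k]
  exact (congrArg Set.Finite this).mpr Set.finite_empty

theorem SatisfiesAcyc.empty_of_emptyStar (h : SatisfiesAcyc S N X .emptyStar) :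
    SatisfiesAcyc S N X .empty := fun k => (h k).1

end Positions

/-! ### Translation of (total) acyclicity into properties of pairs. -/

section Pairs

theorem admissibleEpi_abExact {X Y : AddCommGrpCat.{v}} (p : X ⟶ Y) [Epi p] :
    AdmissibleEpi abExact p :=
  ⟨kernel p, kernel.ι p, kernel.condition p, ShortComplex.ShortExact.mk'
    (ShortComplex.exact_of_f_is_kernel _ (kernelIsKernel p)) (inferInstanceAs (Mono (kernel.ι p)))
    (inferInstanceAs (Epi p))⟩

theorem admissibleMono_abExact {X Y : AddCommGrpCat.{v}} (i : X ⟶ Y) [Mono i] :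
    AdmissibleMono abExact i :=
  ⟨cokernel i, cokernel.π i, cokernel.condition i, ShortComplex.ShortExact.mk'
    (ShortComplex.exact_of_g_is_cokernel _ (cokernelIsCokernel i)) (inferInstanceAs (Mono i))
    (inferInstanceAs (Epi (cokernel.π i)))⟩

/-- In an abelian category the factorizations through the kernel and the image of `g` always exist,
so acyclicity is ordinary exactness at the middle term. -/
theorem isAcyclicPair_abExact_iff {X' X X'' : AddCommGrpCat.{v}} (f : X' ⟶ X) (g : X ⟶ X'') :
    IsAcyclicPair abExact f g ↔ f ≫ g = 0 ∧ ∀ y : X, g y = 0 → ∃ x : X', f x = y := by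
  constructor
  · rintro ⟨Z, W, e, m, e', m', w, rfl, rfl, ⟨_, _, _, he⟩, ⟨_, _, _, hm⟩, h⟩
    have he' : Epi e := he.epi_g
    have hm' : Mono m' := hm.mono_f
    refine ⟨by simp [reassoc_of% w], fun y hy => ?_⟩
    rw [AddCommGrpCat.mono_iff_injective] at hm'
    rw [AddCommGrpCat.epi_iff_surjective] at he'
    obtain ⟨z, rfl⟩ := (ShortComplex.ab_exact_iff _).1 h.exact y
      (hm' (by simpa using hy))
    obtain ⟨x, rfl⟩ := he' z
    exact ⟨x, by simp⟩
  · rintro ⟨w, h⟩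
    have hk : (ShortComplex.mk (kernel.ι g) g (kernel.condition g)).Exact :=
      ShortComplex.exact_of_f_is_kernel _ (kernelIsKernel g)
    have hw : kernel.ι g ≫ factorThruImage g = 0 := by
      rw [← cancel_mono (image.ι g)]
      simp
    have he : Epi (kernel.lift g f w) := by
      rw [AddCommGrpCat.epi_iff_surjective]
      intro z
      obtain ⟨x, hx⟩ := h (kernel.ι g z) (by
        rw [← ConcreteCategory.comp_apply, kernel.condition]
        rfl)
      refine ⟨x, (AddCommGrpCat.mono_iff_injective (kernel.ι g)).1 inferInstance ?_⟩
      rw [← hx, ← ConcreteCategory.comp_apply, kernel.lift_ι]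
    refine ⟨kernel g, image g, kernel.lift g f w, kernel.ι g, factorThruImage g, image.ι g, hw,
      by simp, by simp, admissibleEpi_abExact _, admissibleMono_abExact _,
      ShortComplex.ShortExact.mk' ?_ (inferInstanceAs (Mono (kernel.ι g)))
        (inferInstanceAs (Epi (factorThruImage g)))⟩
    rw [ShortComplex.ab_exact_iff]
    intro y hy
    refine (ShortComplex.ab_exact_iff _).1 hk y ?_
    change g y = 0
    rw [← image.fac g, ConcreteCategory.comp_apply]
    change (image.ι g) ((factorThruImage g) y) = 0
    rw [show factorThruImage g y = 0 from hy, map_zero]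

variable {C : Type u} [Category.{v} C] [Preadditive C] {N : ℕ}

theorem nAcyclicAt_iff (S : ObjectProperty (ShortComplex C)) (X : ℤ ⥤ C) (n : ℤ) :
    NAcyclicAt S N X n ↔ NPair (fun _ _ _ f g => IsAcyclicPair S f g) N X n := by
  have key : ∀ {a b c a' b' c' : ℤ} (_ : a = a') (_ : b = b') (_ : c = c') (φ : a ⟶ b) (ψ : b ⟶ c)
      (φ' : a' ⟶ b') (ψ' : b' ⟶ c'), IsAcyclicPair S (X.map φ) (X.map ψ) ↔
      IsAcyclicPair S (X.map φ') (X.map ψ') := by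
    rintro a b c _ _ _ rfl rfl rfl φ ψ φ' ψ'
    rw [Subsingleton.elim φ φ', Subsingleton.elim ψ ψ']
  -- Integer division rounds down: `-1` has quotient `-1` and remainder `1` modulo `2`.
  have h₁ : ∀ r, contractIndex N n r (n - 1) = n - N + r := fun r => by
    have h : (n - 1 - n) / 2 = -1 := by omega
    have h' : (n - 1 - n) % 2 = 1 := by omega
    rw [contractIndex, h, h']
    ring
  have h₂ : ∀ r, contractIndex N n r n = n := fun r => by simp [contractIndex]
  have h₃ : ∀ r, contractIndex N n r (n + 1) = n + r := fun r => by
    have h : (n + 1 - n) / 2 = 0 := by omega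
    have h' : (n + 1 - n) % 2 = 1 := by omega
    rw [contractIndex, h, h']
    ring
  constructor
  · intro h r m l φ ψ hr hr' hm hl
    exact (key ((h₁ r).trans hm.symm) (h₂ r) ((h₃ r).trans hl.symm) _ _ φ ψ).1 (h r hr hr')
  · intro h r hr hr'
    exact (key (h₁ r) (h₂ r) (h₃ r) _ _ (homOfLE (by omega)) (homOfLE (by omega))).2
      (h r _ _ (homOfLE (by omega)) (homOfLE (by omega)) hr hr' rfl rfl)

/-- Reversing the order exchanges the two morphisms of a pair and replaces the parameter `r` by `N -
r`; the family of all pairs at a position is preserved. -/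
theorem nAcyclicAt_homSeq_iff (X : ℤ ⥤ C) (P : C) (n : ℤ) :
    NAcyclicAt abExact N (homSeq X P) n ↔ NPair (HomExact P) N X (-n) := by
  rw [nAcyclicAt_iff]
  have key : ∀ {m l : ℤ} (φ : m ⟶ n) (ψ : n ⟶ l), IsAcyclicPair abExact ((homSeq X P).map φ)
      ((homSeq X P).map ψ) ↔ HomExact P (X.map (homOfLE (neg_le_neg (leOfHom ψ))))
        (X.map (homOfLE (neg_le_neg (leOfHom φ)))) := by
    intro m l φ ψ
    rw [isAcyclicPair_abExact_iff]
    refine and_congr ⟨fun h z => ?_, fun h => ?_⟩ Iff.rfl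
    · exact ConcreteCategory.congr_hom h z
    · ext z
      exact h z
  constructor
  · intro h r m l φ ψ hr hr' hm hl
    obtain ⟨m', rfl⟩ : ∃ m', m = -m' := ⟨-m, by omega⟩
    obtain ⟨l', rfl⟩ : ∃ l', l = -l' := ⟨-l, by omega⟩
    exact (key (homOfLE (by omega)) (homOfLE (by omega))).1
      (h (N - r) l' m' _ _ (by omega) (by omega) (by omega) (by omega))
  · intro h r m l φ ψ hr hr' hm hl
    exact (key φ ψ).2 (h (N - r) _ _ _ _ (by omega) (by omega) (by omega) (by omega))

theorem totallyNAcyclicAt_iff (S : ObjectProperty (ShortComplex C)) (X : ℤ ⥤ C) (n : ℤ) :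
    TotallyNAcyclicAt S N X n ↔ NPair (fun _ _ _ f g => IsAcyclicPair S f g) N X n ∧
      ∀ P : C, IsProjective S P → NPair (HomExact P) N X n := by
  simp only [TotallyNAcyclicAt, nAcyclicAt_iff S, nAcyclicAt_homSeq_iff, neg_neg]

end Pairs

theorem isZero_map_of_retract {C : Type u} [Category.{v} C] {D : Type u'} [Category.{v'} D]
    [Preadditive D] (F : C ⥤ D) {X Y : C} (i : X ⟶ Y) (r : Y ⟶ X) (h : i ≫ r = 𝟙 X)
    (hY : IsZero (F.obj Y)) : IsZero (F.obj X) := by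
  refine (IsZero.iff_id_eq_zero _).2 ?_
  rw [← F.map_id, ← h, F.map_comp, hY.eq_of_tgt (F.map i) 0, zero_comp]

/-! ### The subcategories with boundedness and acyclicity conditions. -/

section Verdier

variable {E : Type u} [Category.{v} E] [Preadditive E] {C : Type u'} [Category.{v'} C]
  [Preadditive C] {S : ObjectProperty (ShortComplex E)} {N : ℕ} (F : C ⥤ E) [F.Additive]

/-- The complexes over `C` whose image under `F` belongs to `verdier S N a`. -/
abbrev verdierOf (S : ObjectProperty (ShortComplex E)) (N : ℕ) (F : C ⥤ E) [F.Additive]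
    (a : Bound × Acyc) : ObjectProperty (NComplex C N) :=
  (verdier S N a).inverseImage (mapNComplex F N)

variable {F}

/-- Every closure property is obtained here. An argument valid for all stable pair properties over
`C` is applied to the inverse images under `F` of acyclicity in `E` and of exactness under `Hom(-,
P)` for each projective `P`, which treats acyclic and totally acyclic complexes at once. -/
theorem verdierOf_of_local (hS : IsExactCategory S) {X X' Y : NComplex C N}
    (hz : ∀ n : ℤ, (∀ k, n - N ≤ k → k ≤ n + N → IsZero (F.obj (X.obj.obj k))) →
      (∀ k, n - N ≤ k → k ≤ n + N → IsZero (F.obj (X'.obj.obj k))) → IsZero (F.obj (Y.obj.obj n)))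
    (hW : ∀ W : PairProperty C, W.IsStable → ∀ n : ℤ,
      (∀ k, n - N ≤ k → k ≤ n + N → NPair W N X.obj k) →
      (∀ k, n - N ≤ k → k ≤ n + N → NPair W N X'.obj k) → NPair W N Y.obj n) {a : Bound × Acyc}
    (hX : verdierOf S N F a X) (hX' : verdierOf S N F a X') : verdierOf S N F a Y := by
  have h₁ := hW _ ((isStable_isAcyclicPair hS).inverseImage F)
  have h₂ := fun P : E => hW _ ((isStable_homExact P).inverseImage F)
  refine ⟨SatisfiesBound.of_local hz hX.1 hX'.1, SatisfiesAcyc.of_local (fun n h h' => ?_)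
    (fun n h h' => ?_) hX.2 hX'.2⟩
  · exact (nAcyclicAt_iff _ _ _).2 (h₁ n (fun k hk hk' => (nAcyclicAt_iff _ _ _).1 (h k hk hk'))
      fun k hk hk' => (nAcyclicAt_iff _ _ _).1 (h' k hk hk'))
  · exact (totallyNAcyclicAt_iff _ _ _).2
      ⟨h₁ n (fun k hk hk' => ((totallyNAcyclicAt_iff _ _ _).1 (h k hk hk')).1)
        fun k hk hk' => ((totallyNAcyclicAt_iff _ _ _).1 (h' k hk hk')).1, fun P hP =>
      h₂ P n (fun k hk hk' => ((totallyNAcyclicAt_iff _ _ _).1 (h k hk hk')).2 P hP)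
        fun k hk hk' => ((totallyNAcyclicAt_iff _ _ _).1 (h' k hk hk')).2 P hP⟩

theorem isExtensionClosed_verdierOf (hS : IsExactCategory S) (a : Bound × Acyc) :
    IsExtensionClosed (termsplit C N) (verdierOf S N F a) := by
  intro T hT h₁ h₃
  refine verdierOf_of_local hS (fun n h h' => ?_) (fun W hW n h h' => ?_) h₁ h₃
  · obtain ⟨σ⟩ := hT n
    have e := congrArg F.map σ.id
    refine (IsZero.iff_id_eq_zero _).2 ?_
    rw [← F.map_id]
    refine e.symm.trans ?_
    rw [F.map_add, F.map_comp, F.map_comp, (h n (by omega) (by omega)).eq_of_tgt (F.map σ.r) 0,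
      (h' n (by omega) (by omega)).eq_of_src (F.map σ.s) 0, zero_comp, comp_zero, add_zero]
  · exact NPair.ext hW hT (h n (by omega) (by omega)) (h' n (by omega) (by omega))

theorem exists_isZero_verdierOf [HasZeroObject C] (hS : IsExactCategory S) (a : Bound × Acyc) :
    ∃ Z : NComplex C N, IsZero Z ∧ verdierOf S N F a Z := by
  obtain ⟨Z, hZ⟩ := exists_isZero_nComplex C N
  have hZ' : ∀ n, IsZero (F.obj (Z.obj.obj n)) := fun n => by
    refine (IsZero.iff_id_eq_zero _).2 ?_
    have : 𝟙 (Z.obj.obj n) = 0 := congrArg (fun k => k.hom.app n) (hZ.eq_of_src (𝟙 Z) 0)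
    rw [← F.map_id, this, F.map_zero]
  exact ⟨Z, hZ, SatisfiesBound.of_isZero hZ' _, SatisfiesAcyc.of_totally (fun n =>
    (totallyNAcyclicAt_iff _ _ _).2 ⟨NPair.of_isZero (isStable_isAcyclicPair hS) (hZ' n),
      fun P _ => NPair.of_isZero (isStable_homExact P) (hZ' n)⟩) _⟩

variable [HasFiniteBiproducts C]

theorem isZero_map_sumOver {A : ℤ → C} {s : Finset ℤ} (h : ∀ j ∈ s, IsZero (F.obj (A j))) :
    IsZero (F.obj (sumOver A s)) := by
  refine (IsZero.iff_id_eq_zero _).2 ?_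
  rw [← F.map_id, ← biproduct.total, F.map_sum]
  refine Finset.sum_eq_zero fun j _ => ?_
  have : F.map (biproduct.π (fun j : s => A j) j) = 0 := (h j j.2).eq_of_tgt _ _
  rw [F.map_comp, this, zero_comp]

theorem isZero_map_cofree {A : ℤ → C} {n : ℤ}
    (h : ∀ j ∈ Finset.Ico n (n + N), IsZero (F.obj (A j))) :
    IsZero (F.obj ((cofree A N).obj.obj n)) := isZero_map_sumOver h

variable [HasBinaryBiproducts C]

/-- The cokernel of the hull must lie in the subcategory as well, since admissibility is required
for the induced structure. Boundedness holds because the cokernel is a degreewise retract of the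
hull, acyclicity by `NPair.of_hull`. -/
theorem exists_conflation_hull (hS : IsExactCategory S) (hN : 0 < N) {a : Bound × Acyc}
    (X : (verdierOf S N F a).FullSubcategory) :
    ∃ (I : (verdierOf S N F a).FullSubcategory) (i : X ⟶ I), IsInjective (termsplit C N) I.obj ∧
      AdmissibleMono (induced (termsplit C N) (verdierOf S N F a)) i := by
  have hz : ∀ n : ℤ, (∀ k, n - N ≤ k → k ≤ n + N → IsZero (F.obj (X.obj.obj.obj k))) →
      IsZero (F.obj ((cofree X.obj.obj.obj N).obj.obj n)) := fun n h =>
    isZero_map_cofree fun j hj => by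
      have := Finset.mem_Ico.1 hj
      exact h j (by omega) (by omega)
  obtain ⟨Y, p, w, h⟩ := admissibleMono_toCofree hN X.obj
  have hI : verdierOf S N F a (cofree X.obj.obj.obj N) :=
    verdierOf_of_local hS (fun n h _ => hz n h) (fun W hW n _ _ => nPair_cofree hW _ n)
      X.property X.property
  have hY : verdierOf S N F a Y := verdierOf_of_local hS (fun n h' _ => by
      obtain ⟨σ⟩ := h n
      exact isZero_map_of_retract F σ.s (p.hom.app n) σ.s_g (hz n h'))
    (fun W hW n h' _ => NPair.of_hull hW h fun k hk hk' => h' k (by omega) (by omega))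
    X.property X.property
  exact ⟨⟨_, hI⟩, ObjectProperty.homMk (toCofree fun n => 𝟙 _), isInjective_cofree hN,
    ⟨Y, hY⟩, ObjectProperty.homMk p, ObjectProperty.hom_ext _ w, h⟩

theorem exists_conflation_cover (hS : IsExactCategory S) (hN : 0 < N) {a : Bound × Acyc}
    (X : (verdierOf S N F a).FullSubcategory) :
    ∃ (Q : (verdierOf S N F a).FullSubcategory) (p : Q ⟶ X), IsProjective (termsplit C N) Q.obj ∧
      AdmissibleEpi (induced (termsplit C N) (verdierOf S N F a)) p := by
  have hz : ∀ n : ℤ, (∀ k, n - N ≤ k → k ≤ n + N → IsZero (F.obj (X.obj.obj.obj k))) →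
      IsZero (F.obj ((cofree (fun n => X.obj.obj.obj (n - N + 1)) N).obj.obj n)) := fun n h =>
    isZero_map_cofree fun j hj => by
      have := Finset.mem_Ico.1 hj
      exact h _ (by omega) (by omega)
  obtain ⟨Y, i, w, h⟩ := admissibleEpi_fromCofree hN X.obj
  have hI : verdierOf S N F a (cofree (fun n => X.obj.obj.obj (n - N + 1)) N) :=
    verdierOf_of_local hS (fun n h _ => hz n h) (fun W hW n _ _ => nPair_cofree hW _ n)
      X.property X.property
  have hY : verdierOf S N F a Y := verdierOf_of_local hS (fun n h' _ => by
      obtain ⟨σ⟩ := h n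
      exact isZero_map_of_retract F (i.hom.app n) σ.r σ.f_r (hz n h'))
    (fun W hW n h' _ => NPair.of_cover hW h fun k hk hk' => h' k (by omega) (by omega))
    X.property X.property
  exact ⟨⟨_, hI⟩, ObjectProperty.homMk (fromCofree fun n => 𝟙 _), isProjective_cofree hN,
    ⟨Y, hY⟩, ObjectProperty.homMk i, ObjectProperty.hom_ext _ w, h⟩

theorem verdier_le_of_arrow (hS : IsExactCategory S) {a b : Bound × Acyc} (h : Arrow a b) :
    verdier S N a ≤ verdier S N b := by
  have hb : ∀ {X : ℤ ⥤ E} {n : ℤ}, IsZero (X.obj n) → NAcyclicAt S N X n := fun hn =>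
    (nAcyclicAt_iff _ _ _).2 (NPair.of_isZero (isStable_isAcyclicPair hS) hn)
  rintro X ⟨h₁, h₂⟩
  cases h
  -- In these arrows boundedness is traded for acyclicity: a complex is acyclic wherever its object
  -- is zero.
  case b_to_plus_b | b_to_minus_b =>
    refine ⟨?_, Set.Finite.subset h₁ fun n hn hn' => hn (hb hn')⟩
    first | exact h₁.plus_of_b | exact h₁.minus_of_b
  case plus_to_inf_plus => exact ⟨trivial, h₁.imp fun m hm k hk => hb (hm k hk)⟩
  case minus_to_inf_minus => exact ⟨trivial, h₁.imp fun m hm k hk => hb (hm k hk)⟩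
  all_goals
    refine ⟨?_, ?_⟩
    · first | trivial | exact h₁ | exact h₁.plus_of_b | exact h₁.minus_of_b
    · first | trivial | exact h₂ | exact h₂.plus_of_b | exact h₂.minus_of_b | exact h₂.b_of_empty |
        exact h₂.empty_of_emptyStar

/-- The statements (a), (b), (c) for the complexes over `C` whose image under an additive functor
`F` to an exact category satisfies boundedness and acyclicity conditions. -/
theorem stable_diagram_verdierOf [HasZeroObject C] (hS : IsExactCategory S) (hN : 0 < N) :
    (∀ a, IsExtensionClosed (termsplit C N) (verdierOf S N F a) ∧
        IsFullyExact (termsplit C N) (verdierOf S N F a)) ∧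
      (∀ a, IsSubFrobenius (termsplit C N) (verdierOf S N F a)) ∧
      ∃ (hK : IsFrobenius (termsplit C N))
        (hP : ∀ a, IsFrobenius (induced (termsplit C N) (verdierOf S N F a))),
        IsStableDiagram (termsplit C N) hK (verdierOf S N F) hP := by
  have hK : IsFrobenius (termsplit C N) := isFrobenius_termsplit hN
  have hex : ∀ a, IsFullyExact (termsplit C N) (verdierOf S N F a) := fun a =>
    IsExtensionClosed.isExactCategory hK.exact (isExtensionClosed_verdierOf hS a)
      (exists_isZero_verdierOf hS a)
  have hsub : ∀ a, IsSubFrobenius (termsplit C N) (verdierOf S N F a) := fun a =>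
    ⟨hK, hex a, exists_conflation_cover hS hN, exists_conflation_hull hS hN⟩
  exact ⟨fun a => ⟨isExtensionClosed_verdierOf hS a, hex a⟩, hsub, hK,
    fun a => (hsub a).isFrobenius, isStableDiagram hK _ hsub
      (fun a b hab X hX => verdier_le_of_arrow hS hab _ hX) fun X => ⟨trivial, trivial⟩⟩

theorem hasFiniteBiproducts_of_binary (C : Type u) [Category.{v} C] [Preadditive C]
    [HasZeroObject C] [HasBinaryBiproducts C] : HasFiniteBiproducts C := by
  have := hasFiniteProducts_of_has_binary_and_terminal (C := C)
  exact HasFiniteBiproducts.of_hasFiniteProducts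

end Verdier

end NCplx

theorem mainTheorem9 {E : Type u} [Category.{v} E] [Preadditive E]
    (S : ObjectProperty (ShortComplex E)) (hS : IsExactCategory S) (N : ℕ) (hN : 2 ≤ N) :
    -- the subcategories `C_N^{#,♮}(E)` of `C_N(E)`
    ((∀ a, IsExtensionClosed (termsplit E N) (verdier S N a) ∧
        IsFullyExact (termsplit E N) (verdier S N a)) ∧
      (∀ a, IsSubFrobenius (termsplit E N) (verdier S N a)) ∧
      ∃ (hK : IsFrobenius (termsplit E N))
        (hP : ∀ a, IsFrobenius (induced (termsplit E N) (verdier S N a))),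
        IsStableDiagram (termsplit E N) hK (verdier S N) hP) ∧
    -- the subcategories `C_N^{#,♮_E}(A)` of `C_N(A)`, for a full additive subcategory `A` of `E`
    ∀ (A : ObjectProperty E) [HasZeroObject A.FullSubcategory]
      [HasBinaryBiproducts A.FullSubcategory],
      (∀ a, IsExtensionClosed (termsplit A.FullSubcategory N) (verdierIn S A N a) ∧
        IsFullyExact (termsplit A.FullSubcategory N) (verdierIn S A N a)) ∧
      (∀ a, IsSubFrobenius (termsplit A.FullSubcategory N) (verdierIn S A N a)) ∧
      ∃ (hK : IsFrobenius (termsplit A.FullSubcategory N))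
        (hP : ∀ a, IsFrobenius (induced (termsplit A.FullSubcategory N) (verdierIn S A N a))),
        IsStableDiagram (termsplit A.FullSubcategory N) hK (verdierIn S A N) hP := by
  have := hS.hasZeroObject
  have := hS.hasBinaryBiproducts
  have := hasFiniteBiproducts_of_binary E
  -- Whiskering with the identity functor changes complexes only up to definitional equality, so the
  -- absolute statement is the case `F = 𝟭 E`.
  refine ⟨stable_diagram_verdierOf (F := 𝟭 E) hS (by omega), fun A _ _ => ?_⟩
  have := hasFiniteBiproducts_of_binary A.FullSubcategory
  exact stable_diagram_verdierOf (F := A.ι) hS (by omega)
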